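/- Let $n\ge 2$, $M\ge 1$, let $\Omega\subset\mathbb R^n$ be a bounded Lipschitz domain (open and connected), and let $D\subset\Omega$ be Lebesgue measurable with $0\le\mathcal L^n(D)<\mathcal L^n(\Omega)$. Fix $\lambda>0$, $1<\zeta<\infty$ and $f\in L^\zeta(\Omega-D)^M$. Let $F:\mathbb R^{nM}\to[0,\infty)$ be of class $C^1$ and strictly convex with $F(0)=0$, and suppose that there are constants $\nu_1,\nu_2>0$ and $\nu_3\in\mathbb R$ such that $$|DF(P)|\le\nu_1,\qquad F(P)\ge\nu_2|P|-\nu_3\qquad\text{for all }P\in\mathbb R^{nM}.$$ Let $F^*(Q)=\sup_{P\in\mathbb R^{nM}}[P:Q-F(P)]\in[0,\infty]$ be the conjugate function and $F^\infty(P)=\lim_{t\to\infty}F(tP)/t$ the recession function of $F$. For $\varkappa\in L^\infty(\Omega)^{nM}$ put $$R[\varkappa]=\inf_{w\in W^{1,1}(\Omega)^M\cap L^\zeta(\Omega-D)^M}\left\{\int_\Omega[\varkappa:\nabla w-F^*(\varkappa)]\,dx+\frac{\lambda}{\zeta}\int_{\Omega-D}|w-f|^\zeta\,dx\right\}\in[-\infty,\infty].$$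 For $u\in BV(\Omega)^M\cap L^\zeta(\Omega-D)^M$, let $\nabla u=\nabla^a u\,\mathcal L^n+\nabla^s u$ be the Lebesgue decomposition of the tensor-valued measure $\nabla u$, with $\nabla^a u$ the density of its absolutely continuous part, and put $$K[u]=\int_\Omega F(\nabla^a u)\,dx+\int_\Omega F^\infty\!\left(\frac{\nabla^s u}{|\nabla^s u|}\right)d|\nabla^s u|+\frac{\lambda}{\zeta}\int_{\Omega-D}|u-f|^\zeta\,dx.$$ **Theorem 1.3.** The dual problem of maximizing $R$ in $L^\infty(\Omega)^{nM}$ has exactly one solution $\sigma$ (up to equality almost everywhere). Moreover, $$\sigma=DF(\nabla^a u)\quad\text{a.e. on }\Omega$$ for every minimizer $u$ of $K$ in $BV(\Omega)^M\cap L^\zeta(\Omega-D)^M$. -/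

import Mathlib

open MeasureTheory Filter Set
open scoped ENNReal NNReal Topology RealInnerProductSpace

namespace Inpainting

noncomputable section

/-- The space `ℝⁿ` containing the image domain. -/
abbrev Dom (n : ℕ) : Type := EuclideanSpace ℝ (Fin n)

/-- The space `ℝᴹ` of image values. -/
abbrev Val (M : ℕ) : Type := EuclideanSpace ℝ (Fin M)

/-- The space `ℝⁿᴹ` of gradients. The entry `(i, j)` is the `j`-th partial derivative of the `i`-th
component; the inner product is `P : Q = ∑ᵢⱼ Pᵢⱼ Qᵢⱼ`, and the norm is the Euclidean one. -/
abbrev Tens (n M : ℕ) : Type := EuclideanSpace ℝ (Fin M × Fin n)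

/-- A bounded Lipschitz domain: bounded, open, connected, and near each boundary point it is the
region strictly above the graph of a Lipschitz function in some direction `e`. The graph function is
evaluated only at points of the hyperplane orthogonal to `e`. -/
structure IsBoundedLipschitzDomain {n : ℕ} (Ω : Set (Dom n)) : Prop where
  isBounded : Bornology.IsBounded Ω
  isOpen : IsOpen Ω
  isConnected : IsConnected Ω
  lipschitz_boundary : ∀ x₀ ∈ frontier Ω, ∃ e : Dom n, ‖e‖ = 1 ∧ ∃ g : Dom n → ℝ,
    (∃ C : ℝ≥0, LipschitzWith C g) ∧
      ∀ᶠ x in 𝓝 x₀, (x ∈ Ω ↔ g (x - ⟪e, x⟫ • e) < ⟪e, x⟫)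

/-- Test functions on `Ω`: smooth, with compact support contained in `Ω`. -/
structure IsTest {n : ℕ} (Ω : Set (Dom n)) (φ : Dom n → ℝ) : Prop where
  smooth : ContDiff ℝ (⊤ : ℕ∞) φ
  hasCompactSupport : HasCompactSupport φ
  tsupport_subset : tsupport φ ⊆ Ω

/-- The `j`-th partial derivative. -/
def pderiv {n : ℕ} (j : Fin n) (φ : Dom n → ℝ) (x : Dom n) : ℝ :=
  fderiv ℝ φ x (EuclideanSpace.single j 1)

/-- `w ∈ W^{1,1}(Ω)ᴹ`, with weak gradient `G`. -/
structure IsW11 {n M : ℕ} (Ω : Set (Dom n)) (w : Dom n → Val M) (G : Dom n → Tens n M) : Prop where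
  integrable : IntegrableOn w Ω
  integrable_grad : IntegrableOn G Ω
  weak_grad : ∀ φ, IsTest Ω φ → ∀ i j,
    ∫ x in Ω, w x i * pderiv j φ x = -∫ x in Ω, φ x * G x (i, j)

/-- `u ∈ BV(Ω)ᴹ`, with distributional gradient the tensor-valued measure `Du` on `Ω`
(extended by zero to `ℝⁿ`) of finite total variation. -/
structure IsBV {n M : ℕ} (Ω : Set (Dom n)) (u : Dom n → Val M)
    (Du : VectorMeasure (Dom n) (Tens n M)) : Prop where
  integrable : IntegrableOn u Ω
  restrict_eq : Du.restrict Ω = Du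
  finite_variation : Du.variation univ < ∞
  distrib_grad : ∀ φ, IsTest Ω φ → ∀ i j,
    ∫ x in Ω, u x i * pderiv j φ x = -(∫ᵛ x, φ x ∂•Du) (i, j)

/-- The `p`-th component of a tensor-valued measure, as a signed measure. -/
def component {n M : ℕ} (ν : VectorMeasure (Dom n) (Tens n M)) (p : Fin M × Fin n) :
    SignedMeasure (Dom n) :=
  ν.mapRange (EuclideanSpace.proj p : Tens n M →L[ℝ] ℝ).toLinearMap.toAddMonoidHom
    (EuclideanSpace.proj p : Tens n M →L[ℝ] ℝ).continuous

/-- The Radon–Nikodym density of (the absolutely continuous part of) a tensor-valued measure `ν`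
with respect to a positive measure `m`, taken componentwise. -/
def density {n M : ℕ} (ν : VectorMeasure (Dom n) (Tens n M)) (m : Measure (Dom n)) (x : Dom n) :
    Tens n M :=
  WithLp.toLp 2 fun p => (component ν p).rnDeriv m x

/-- `∇ᵃu`: the Lebesgue density of the absolutely continuous part of `∇u`. -/
def acGrad {n M : ℕ} (Du : VectorMeasure (Dom n) (Tens n M)) : Dom n → Tens n M :=
  density Du volume

/-- `∇ˢu`: the singular part of `∇u` in its Lebesgue decomposition `∇u = ∇ᵃu 𝓛ⁿ + ∇ˢu`. -/
def singGrad {n M : ℕ} (Du : VectorMeasure (Dom n) (Tens n M)) :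
    VectorMeasure (Dom n) (Tens n M) :=
  Du - (volume : Measure (Dom n)).withDensityᵥ (acGrad Du)

/-- The recession function `F^∞(P) = lim_{t → ∞} F(tP) / t`. -/
def recession {n M : ℕ} (F : Tens n M → ℝ) (P : Tens n M) : ℝ :=
  limUnder atTop fun t : ℝ => F (t • P) / t

/-- The data fitting term `(l / ζ) ∫_{Ω - D} |w - f|^ζ dx`. -/
def dataTerm {n M : ℕ} (Ω D : Set (Dom n)) (f : Dom n → Val M) (l ζ : ℝ) (w : Dom n → Val M) : ℝ :=
  l / ζ * ∫ x in Ω \ D, ‖w x - f x‖ ^ ζ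

/-- The relaxed functional
`K[u] = ∫_Ω F(∇ᵃu) dx + ∫_Ω F^∞(∇ˢu / |∇ˢu|) d|∇ˢu| + (l / ζ) ∫_{Ω - D} |u - f|^ζ dx`
at a function `u` of bounded variation with gradient measure `Du`. -/
def K {n M : ℕ} (Ω D : Set (Dom n)) (f : Dom n → Val M) (F : Tens n M → ℝ) (l ζ : ℝ)
    (u : Dom n → Val M) (Du : VectorMeasure (Dom n) (Tens n M)) : ℝ :=
  (∫ x in Ω, F (acGrad Du x)) +
    (∫ x in Ω, recession F (density (singGrad Du) (singGrad Du).variation x)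
      ∂(singGrad Du).variation) +
    dataTerm Ω D f l ζ u

/-- `u`, with gradient measure `Du`, minimizes `K` in `BV(Ω)ᴹ ∩ L^ζ(Ω - D)ᴹ`. -/
structure IsKMinimizer {n M : ℕ} (Ω D : Set (Dom n)) (f : Dom n → Val M) (F : Tens n M → ℝ)
    (l ζ : ℝ) (u : Dom n → Val M) (Du : VectorMeasure (Dom n) (Tens n M)) : Prop where
  isBV : IsBV Ω u Du
  memLp : MemLp u (ENNReal.ofReal ζ) (volume.restrict (Ω \ D))
  le : ∀ v Dv, IsBV Ω v Dv → MemLp v (ENNReal.ofReal ζ) (volume.restrict (Ω \ D)) →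
    K Ω D f F l ζ u Du ≤ K Ω D f F l ζ v Dv

/-- The conjugate function `F^*(Q) = sup_P (P : Q - F(P))`. -/
def conj {n M : ℕ} (F : Tens n M → ℝ) (Q : Tens n M) : EReal :=
  ⨆ P : Tens n M, ((⟪P, Q⟫ - F P : ℝ) : EReal)

/-- The Lagrangian `∫_Ω (κ : ∇w - F^*(κ)) dx + (l / ζ) ∫_{Ω - D} |w - f|^ζ dx`, where `G = ∇w`.
Since `F(0) = 0`, the function `F^*` takes values in `[0, ∞]`; as `κ : ∇w` is integrable, the first
integral is `∫_Ω κ : ∇w dx - ∫_Ω F^*(κ) dx`, with `∫_Ω F^*(κ) dx` in `[0, ∞]`. -/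
def lagrangian {n M : ℕ} (Ω D : Set (Dom n)) (f : Dom n → Val M) (F : Tens n M → ℝ) (l ζ : ℝ)
    (w : Dom n → Val M) (G κ : Dom n → Tens n M) : EReal :=
  ((∫ x in Ω, ⟪κ x, G x⟫ : ℝ) : EReal) - ((∫⁻ x in Ω, (conj F (κ x)).toENNReal : ℝ≥0∞) : EReal) +
    ((dataTerm Ω D f l ζ w : ℝ) : EReal)

/-- The dual functional `R[κ]`: the infimum of the Lagrangian over
`w ∈ W^{1,1}(Ω)ᴹ ∩ L^ζ(Ω - D)ᴹ`. -/
def R {n M : ℕ} (Ω D : Set (Dom n)) (f : Dom n → Val M) (F : Tens n M → ℝ) (l ζ : ℝ)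
    (κ : Dom n → Tens n M) : EReal :=
  ⨅ (w : Dom n → Val M) (G : Dom n → Tens n M) (_ : IsW11 Ω w G)
    (_ : MemLp w (ENNReal.ofReal ζ) (volume.restrict (Ω \ D))), lagrangian Ω D f F l ζ w G κ

/-- `σ` solves the dual problem `R → max` in `L^∞(Ω)ⁿᴹ`. -/
def IsDualSolution {n M : ℕ} (Ω D : Set (Dom n)) (f : Dom n → Val M) (F : Tens n M → ℝ) (l ζ : ℝ)
    (σ : Lp (Tens n M) ∞ (volume.restrict Ω)) : Prop :=
  ∀ κ : Lp (Tens n M) ∞ (volume.restrict Ω), R Ω D f F l ζ κ ≤ R Ω D f F l ζ σ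

end

end Inpainting

open Inpainting

/-! ### Vector measures -/

namespace Inpainting

section VectorMeasure

variable {X E : Type*} [MeasurableSpace X] [NormedAddCommGroup E] [NormedSpace ℝ E]
  [CompleteSpace E]

/-! The theorem is convex duality for the primal problem over `W^{1,1}(Ω)ᴹ ∩ L^ζ(Ω - D)ᴹ`, with the
gradient as the perturbed variable. Let `V(p)` be the infimum of `∫ F(∇w + p)` plus the data term
(`perturbedInf`). `V` is convex and `V(p) ≤ V(0) + ν ‖p‖₁`, so Hahn–Banach gives a subgradient at
`0` in the dual of `L¹`, that is, some `σ ∈ L^∞` (`exists_multiplier`). Taking `p = q - ∇w` and the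
supremum over all integrable `q` turns the subgradient inequality into `V(0) ≤ R[σ]`
(`exists_perturbedInf_le_R`). Since `R ≤ V(0)` by Fenchel–Young (`R_le_perturbedInf`), `σ` is a dual
solution, and every dual solution `τ` satisfies `V(0) ≤ R[τ]`.

Such a `σ` is tied to minimizing sequences: if the primal energy of `w_k` tends to `V(0)`, then the
integral of the nonnegative gap `F(∇w_k) + F^*(σ) - σ : ∇w_k` tends to zero
(`integral_fenchelGap_le`), hence the gap vanishes in the limit almost everywhere along a
subsequence. If `∇w_k(x)` then has a cluster point `P`, equality holds in Fenchel–Young and `σ(x) =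
DF(P)`. For uniqueness, linear growth bounds `∇w_k` in `L¹`; Fatou's lemma provides a cluster point
at almost every `x`, and two dual solutions both equal `DF` of it (`eq_of_perturbedInf_le_R`).

For the formula `σ = DF(∇ᵃu)`, a minimizing sequence is needed whose gradients converge in measure
to `∇ᵃu`. It comes from approximating a minimizer `u` of `K` (`IsBV.exists_competitor_le`).
Mollifying `u` with radii shrinking at the boundary gives functions smooth in `Ω` with gradient `A +
B`, where `A` is `L¹`-close to `∇ᵃu` and `B` averages `∇ˢu` against a kernel. Convexity gives `F(A +
B) ≤ F(A) + DF(A + B) : B`, and `DF(Q) : P ≤ F^∞(P)` for all `Q`, so the energy exceeds the first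
two terms of `K[u]` by little (`integral_energy_le`). As `∇ˢu` lives on a Lebesgue null set, `B` is
small outside a set of small measure (`exists_approxGrad_close`). The mollified functions need not
lie in `L^ζ`, so they are truncated smoothly, at a level chosen among many disjoint ranges so that
the transition range carries little gradient. -/

theorem integral_withDensityᵥ_simpleFunc {μ : Measure X} {g : X → E} (hg : Integrable g μ)
    [IsFiniteMeasure (μ.withDensityᵥ g).variation] (φ : SimpleFunc X ℝ) :
    ∫ᵛ x, φ x ∂•(μ.withDensityᵥ g) = ∫ x, φ x • g x ∂μ := by
  have hb : ∀ f : SimpleFunc X ℝ, Integrable (fun x => f x • g x) μ := fun f => by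
    obtain ⟨C, hC⟩ := f.exists_forall_norm_le
    exact hg.bdd_smul C f.aestronglyMeasurable (ae_of_all _ hC)
  induction φ using SimpleFunc.induction with
  | const c hs =>
    rename_i s
    have h1 : (⇑(SimpleFunc.piecewise s hs (SimpleFunc.const X c) (SimpleFunc.const X 0)) : X → ℝ)
        = s.indicator fun _ => c := by
      ext x; by_cases hx : x ∈ s <;> simp [SimpleFunc.piecewise_apply, hx]
    have h2 : (fun x => (s.indicator (fun _ => c) x : ℝ) • g x) = s.indicator fun x => c • g x := by
      ext x; by_cases hx : x ∈ s <;> simp [hx]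
    rw [h1, h2, VectorMeasure.integral_eq_setToFun, setToFun_indicator_const _ hs (by finiteness),
      integral_indicator hs, integral_smul, ← withDensityᵥ_apply hg hs]
    rfl
  | add hd hf hg' =>
    rename_i f f'
    have hi : ∀ f : SimpleFunc X ℝ, (μ.withDensityᵥ g).Integrable f := fun f => by
      obtain ⟨C, hC⟩ := f.exists_forall_norm_le
      exact Integrable.of_bound f.aestronglyMeasurable C (ae_of_all _ hC)
    simp only [SimpleFunc.coe_add, Pi.add_apply, add_smul]
    rw [VectorMeasure.integral_fun_add (hi f) (hi f'), integral_add (hb f) (hb f'), hf, hg']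

/-- Integration of a bounded scalar function against a vector measure with density. -/
theorem integral_withDensityᵥ {μ : Measure X} {g : X → E} (hg : Integrable g μ)
    [IsFiniteMeasure (μ.withDensityᵥ g).variation] {φ : X → ℝ}
    (hφ : Measurable φ) {C : ℝ} (hC : ∀ x, ‖φ x‖ ≤ C) :
    ∫ᵛ x, φ x ∂•(μ.withDensityᵥ g) = ∫ x, φ x • g x ∂μ := by
  have hm := hφ.stronglyMeasurable
  -- A point is needed for this: `C` may be negative if `X` is empty.
  have hC0 : ∀ x, 0 ≤ C := fun x => (norm_nonneg _).trans (hC x)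
  have hlim : ∀ x, Tendsto (fun k => hm.approxBounded C k x) atTop (𝓝 (φ x)) := fun x =>
    hm.tendsto_approxBounded_of_norm_le (hC x)
  have hle : ∀ k x, ‖hm.approxBounded C k x‖ ≤ C := fun k x =>
    hm.norm_approxBounded_le (hC0 x) k x
  have h1 := VectorMeasure.tendsto_integral_of_dominated_convergence (μ := μ.withDensityᵥ g)
    (B := ContinuousLinearMap.lsmul ℝ ℝ) (f := φ)
    (fun _ => C) (fun k => (hm.approxBounded C k).aestronglyMeasurable) (integrable_const _)
    (fun k => ae_of_all _ (hle k)) (ae_of_all _ hlim)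
  have h2 : Tendsto (fun k => ∫ x, hm.approxBounded C k x • g x ∂μ) atTop
      (𝓝 (∫ x, φ x • g x ∂μ)) := by
    refine tendsto_integral_of_dominated_convergence (fun x => C * ‖g x‖)
      (fun k => (hm.approxBounded C k).aestronglyMeasurable.smul hg.aestronglyMeasurable)
      (hg.norm.const_mul C) (fun k => ae_of_all _ fun x => ?_)
      (ae_of_all _ fun x => (hlim x).smul_const _)
    rw [norm_smul]
    exact mul_le_mul_of_nonneg_right (hle k x) (norm_nonneg _)
  refine tendsto_nhds_unique h1 (h2.congr fun k => ?_)
  exact (integral_withDensityᵥ_simpleFunc hg _).symm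

end VectorMeasure

/-! ### Components and Lebesgue decomposition of tensor-valued measures. -/

section Components

variable {n M : ℕ}

theorem component_apply (ν : VectorMeasure (Dom n) (Tens n M)) (p : Fin M × Fin n)
    (s : Set (Dom n)) : component ν p s = ν s p := rfl

theorem variation_component_le (ν : VectorMeasure (Dom n) (Tens n M)) (p : Fin M × Fin n) :
    (component ν p).variation ≤ ν.variation := by
  refine VectorMeasure.variation_le_of_forall_enorm_le fun s _ => ?_
  refine le_trans ?_ (VectorMeasure.enorm_measure_le_variation ν s)
  rw [component_apply, enorm_le_iff_norm_le]
  exact PiLp.norm_apply_le (ν s) p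

/-- Through this bound, finiteness of the variation and singularity to Lebesgue measure pass from
signed measures to tensor-valued ones. -/
theorem variation_le_sum_component (ν : VectorMeasure (Dom n) (Tens n M)) :
    ν.variation ≤ ∑ p, (component ν p).variation := by
  refine VectorMeasure.variation_le_of_forall_enorm_le fun s _ => ?_
  rw [Measure.finsetSum_apply]
  refine le_trans ?_ (Finset.sum_le_sum fun p _ =>
    VectorMeasure.enorm_measure_le_variation (component ν p) s)
  have : ν s = ∑ p, EuclideanSpace.single p (ν s p) := by
    ext q; simp
  calc ‖ν s‖ₑ = ‖∑ p, (EuclideanSpace.single p (ν s p) : Tens n M)‖ₑ := by rw [← this]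
    _ ≤ ∑ p, ‖(EuclideanSpace.single p (ν s p) : Tens n M)‖ₑ := enorm_sum_le _ _
    _ = _ := by
      refine Finset.sum_congr rfl fun p _ => ?_
      rw [component_apply, ← ofReal_norm, ← ofReal_norm, PiLp.norm_single]

instance isFiniteMeasure_variation (ν : VectorMeasure (Dom n) (Tens n M)) :
    IsFiniteMeasure ν.variation := by
  refine ⟨lt_of_le_of_lt (variation_le_sum_component ν univ) ?_⟩
  rw [Measure.finsetSum_apply]
  refine ENNReal.sum_lt_top.2 fun p _ => ?_
  rw [← SignedMeasure.totalVariation_eq_variation]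
  exact measure_lt_top _ _

theorem component_ext {ν ν' : VectorMeasure (Dom n) (Tens n M)}
    (h : ∀ p, component ν p = component ν' p) : ν = ν' := by
  ext s hs p
  rw [← component_apply, ← component_apply, h]

theorem component_withDensityᵥ {m : Measure (Dom n)} {g : Dom n → Tens n M}
    (hg : Integrable g m) (p : Fin M × Fin n) :
    component (m.withDensityᵥ g) p = m.withDensityᵥ fun x => g x p := by
  have hgp : Integrable (fun x => g x p) m :=
    (EuclideanSpace.proj p : Tens n M →L[ℝ] ℝ).integrable_comp hg
  ext s hs
  rw [component_apply, withDensityᵥ_apply hg hs, withDensityᵥ_apply hgp hs]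
  exact ((EuclideanSpace.proj p : Tens n M →L[ℝ] ℝ).integral_comp_comm hg.integrableOn).symm

theorem integrable_density (ν : VectorMeasure (Dom n) (Tens n M)) (m : Measure (Dom n)) :
    Integrable (density ν m) m := by
  have h : density ν m =
      fun x => ∑ p, EuclideanSpace.single p ((component ν p).rnDeriv m x) := by
    funext x; ext q; simp [density]
  rw [h]
  refine integrable_finsetSum _ fun p _ => ?_
  have := (SignedMeasure.integrable_rnDeriv (component ν p) m).smul_const
    (EuclideanSpace.single p (1:ℝ) : Tens n M)
  refine this.congr (ae_of_all _ fun x => ?_)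
  ext q; simp

/-- A tensor-valued measure which is absolutely continuous with respect to a σ-finite measure is
determined by its density. -/
theorem withDensityᵥ_density {ν : VectorMeasure (Dom n) (Tens n M)} {m : Measure (Dom n)}
    [SigmaFinite m] (h : ν.variation ≪ m) : m.withDensityᵥ (density ν m) = ν := by
  refine component_ext fun p => ?_
  rw [component_withDensityᵥ (integrable_density ν m)]
  refine (SignedMeasure.absolutelyContinuous_iff_withDensityᵥ_rnDeriv_eq _ m).1 ?_
  intro s hs
  by_cases hsm : MeasurableSet s
  · rw [Measure.toENNRealVectorMeasure_apply_measurable hsm] at hs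
    have h1 := variation_component_le ν p s
    rw [h hs] at h1
    have := VectorMeasure.enorm_measure_le_variation (component ν p) s
    simpa using this.trans h1
  · exact VectorMeasure.not_measurable _ hsm

/-- The densities are taken componentwise, so the Lebesgue decomposition commutes with taking
components. -/
theorem component_singGrad (ν : VectorMeasure (Dom n) (Tens n M)) (p : Fin M × Fin n) :
    component (singGrad ν) p = (component ν p).singularPart volume := by
  have h1 := SignedMeasure.singularPart_add_withDensity_rnDeriv_eq (s := component ν p) (μ := volume)
  have h2 : component (singGrad ν) p = component ν p - component (volume.withDensityᵥ (acGrad ν)) p := rfl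
  rw [h2, show component (volume.withDensityᵥ (acGrad ν)) p =
    volume.withDensityᵥ ((component ν p).rnDeriv volume) from
      component_withDensityᵥ (integrable_density ν volume) p]
  nth_rewrite 1 [← h1]
  rw [add_sub_cancel_right]

theorem singGrad_variation_mutuallySingular (ν : VectorMeasure (Dom n) (Tens n M)) :
    (singGrad ν).variation ⟂ₘ volume := by
  have h : ∀ p, (component (singGrad ν) p).variation ⟂ₘ (volume : Measure (Dom n)) := fun p => by
    rw [component_singGrad, ← SignedMeasure.totalVariation_eq_variation,
      SignedMeasure.singularPart_totalVariation]
    exact (Measure.mutuallySingular_singularPart _ _).add_left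
      (Measure.mutuallySingular_singularPart _ _)
  refine Measure.MutuallySingular.mono_ac ?_
    (Measure.absolutelyContinuous_of_le (variation_le_sum_component _)) Measure.AbsolutelyContinuous.rfl
  rw [← Measure.sum_fintype]
  exact Measure.MutuallySingular.sum_left.2 h

/-- This replaces integrals against the gradient measure by Bochner integrals of its densities; the
approximation of `BV` functions works with the densities only. -/
theorem integral_bounded_eq (ν : VectorMeasure (Dom n) (Tens n M)) {φ : Dom n → ℝ}
    (hφ : Measurable φ) {C : ℝ} (hC : ∀ x, ‖φ x‖ ≤ C) :
    ∫ᵛ x, φ x ∂•ν = (∫ x, φ x • acGrad ν x) +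
      ∫ x, φ x • density (singGrad ν) (singGrad ν).variation x ∂(singGrad ν).variation := by
  -- Polar decomposition: the singular part is absolutely continuous with respect to its own
  -- variation.
  have hs := withDensityᵥ_density (Measure.AbsolutelyContinuous.refl (singGrad ν).variation)
  have hdec : ν = volume.withDensityᵥ (acGrad ν) + singGrad ν := by simp [singGrad]
  have hint : ∀ ν' : VectorMeasure (Dom n) (Tens n M), ν'.Integrable φ := fun ν' =>
    Integrable.of_bound hφ.aestronglyMeasurable C (ae_of_all _ hC)
  conv_lhs => rw [hdec]
  rw [VectorMeasure.integral_add_vectorMeasure (hint _) (hint _),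
    show ∫ᵛ x, φ x ∂•(volume.withDensityᵥ (acGrad ν)) = ∫ x, φ x • acGrad ν x from
      integral_withDensityᵥ (integrable_density ν volume) hφ hC]
  congr 1
  have : IsFiniteMeasure ((singGrad ν).variation.withDensityᵥ
      (density (singGrad ν) (singGrad ν).variation)).variation := isFiniteMeasure_variation _
  rw [← integral_withDensityᵥ (integrable_density _ _) hφ hC, hs]

end Components
end Inpainting

/-! ### Sobolev functions as functions of bounded variation. -/

namespace Inpainting

variable {n M : ℕ}

/-- The primal functional on `W^{1,1}`, at a function `w` with weak gradient `G`. -/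
noncomputable def primal (Ω D : Set (Dom n)) (f : Dom n → Val M) (F : Tens n M → ℝ) (l ζ : ℝ)
    (w : Dom n → Val M) (G : Dom n → Tens n M) : ℝ :=
  (∫ x in Ω, F (G x)) + dataTerm Ω D f l ζ w

theorem IsTest.bounded {Ω : Set (Dom n)} {φ : Dom n → ℝ} (hφ : IsTest Ω φ) :
    ∃ C, ∀ x, ‖φ x‖ ≤ C :=
  hφ.hasCompactSupport.exists_bound_of_continuous hφ.smooth.continuous

theorem IsTest.eq_zero {Ω : Set (Dom n)} {φ : Dom n → ℝ} (hφ : IsTest Ω φ) {x : Dom n}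
    (hx : x ∉ Ω) : φ x = 0 :=
  image_eq_zero_of_notMem_tsupport fun h => hx (hφ.tsupport_subset h)

theorem acGrad_withDensityᵥ {G : Dom n → Tens n M} (hG : Integrable G) :
    acGrad (volume.withDensityᵥ G) =ᵐ[volume] G := by
  have h : ∀ p, ∀ᵐ x : Dom n, G x p = (component (volume.withDensityᵥ G) p).rnDeriv volume x := by
    intro p
    have hGp : Integrable (fun x => G x p) :=
      (EuclideanSpace.proj p : Tens n M →L[ℝ] ℝ).integrable_comp hG
    refine SignedMeasure.eq_rnDeriv 0 _ hGp VectorMeasure.MutuallySingular.zero_left ?_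
    rw [zero_add, component_withDensityᵥ hG]
  filter_upwards [ae_all_iff.2 h] with x hx
  ext p
  exact (hx p).symm

theorem singGrad_withDensityᵥ {G : Dom n → Tens n M} (hG : Integrable G) :
    singGrad (volume.withDensityᵥ G) = 0 := by
  rw [singGrad, WithDensityᵥEq.congr_ae (acGrad_withDensityᵥ hG), sub_self]

/-- The gradient is extended by zero because a `BV` gradient measure has to be carried by `Ω`. -/
theorem IsW11.isBV {Ω : Set (Dom n)} (hΩ : MeasurableSet Ω) {w : Dom n → Val M}
    {G : Dom n → Tens n M} (h : IsW11 Ω w G) :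
    IsBV Ω w (volume.withDensityᵥ (Ω.indicator G)) := by
  have hG : Integrable (Ω.indicator G) := (integrable_indicator_iff hΩ).2 h.integrable_grad
  refine ⟨h.integrable, ?_, measure_lt_top _ _, fun φ hφ i j => ?_⟩
  · ext s hs : 1
    rw [VectorMeasure.restrict_apply _ hΩ hs, withDensityᵥ_apply hG hs,
      withDensityᵥ_apply hG (hs.inter hΩ), setIntegral_indicator hΩ, setIntegral_indicator hΩ,
      inter_assoc, inter_self]
  · obtain ⟨C, hC⟩ := hφ.bounded
    rw [h.weak_grad φ hφ i j, integral_withDensityᵥ hG hφ.smooth.continuous.measurable hC]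
    have hi : Integrable (fun x => φ x • Ω.indicator G x) :=
      hG.bdd_smul C hφ.smooth.continuous.aestronglyMeasurable (ae_of_all _ hC)
    have h1 := (EuclideanSpace.proj (i, j) : Tens n M →L[ℝ] ℝ).integral_comp_comm hi
    simp only [EuclideanSpace.coe_proj] at h1
    rw [← h1, ← integral_indicator hΩ]
    congr 2
    funext x
    by_cases hx : x ∈ Ω <;> simp [hx]

/-- A gradient measure with a Lebesgue density has no singular part, so the recession term
disappears. -/
theorem K_withDensityᵥ {Ω D : Set (Dom n)} {f : Dom n → Val M} {F : Tens n M → ℝ} {l ζ : ℝ}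
    (hΩ : MeasurableSet Ω) {w : Dom n → Val M} {G : Dom n → Tens n M} (h : IsW11 Ω w G) :
    K Ω D f F l ζ w (volume.withDensityᵥ (Ω.indicator G)) = primal Ω D f F l ζ w G := by
  have hG : Integrable (Ω.indicator G) := (integrable_indicator_iff hΩ).2 h.integrable_grad
  rw [K, primal, singGrad_withDensityᵥ hG, VectorMeasure.variation_zero, Measure.restrict_zero,
    integral_zero_measure, add_zero]
  congr 1
  refine integral_congr_ae ?_
  filter_upwards [ae_restrict_of_ae (acGrad_withDensityᵥ hG), ae_restrict_mem hΩ] with x hx hxΩ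
  rw [hx, indicator_of_mem hxΩ]

/-- A minimizer of the relaxed functional lies below every competitor in `W^{1,1}`. -/
theorem IsKMinimizer.le_primal {Ω D : Set (Dom n)} {f : Dom n → Val M} {F : Tens n M → ℝ}
    {l ζ : ℝ} (hΩ : MeasurableSet Ω) {u : Dom n → Val M} {Du : VectorMeasure (Dom n) (Tens n M)}
    (hu : IsKMinimizer Ω D f F l ζ u Du) {w : Dom n → Val M} {G : Dom n → Tens n M}
    (h : IsW11 Ω w G) (hw : MemLp w (ENNReal.ofReal ζ) (volume.restrict (Ω \ D))) :
    K Ω D f F l ζ u Du ≤ primal Ω D f F l ζ w G := by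
  rw [← K_withDensityᵥ hΩ h]
  exact hu.le _ _ (h.isBV hΩ) hw

end Inpainting

/-! ### Convex integrands of linear growth -/

namespace Inpainting

variable {n M : ℕ}

/-- Convex `C¹` integrands of linear growth, with `F 0 = 0`. -/
structure IsIntegrand (F : Tens n M → ℝ) (ν : ℝ) : Prop where
  nonneg : ∀ P, 0 ≤ F P
  contDiff : ContDiff ℝ 1 F
  convex : ConvexOn ℝ univ F
  zero : F 0 = 0
  pos : 0 < ν
  norm_gradient_le : ∀ P, ‖gradient F P‖ ≤ ν

namespace IsIntegrand

variable {F : Tens n M → ℝ} {ν : ℝ}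

theorem differentiable (hF : IsIntegrand F ν) : Differentiable ℝ F :=
  hF.contDiff.differentiable one_ne_zero

theorem continuous (hF : IsIntegrand F ν) : Continuous F := hF.contDiff.continuous

theorem hasGradientAt (hF : IsIntegrand F ν) (P : Tens n M) :
    HasGradientAt F (gradient F P) P := (hF.differentiable P).hasGradientAt

theorem abs_sub_le (hF : IsIntegrand F ν) (P Q : Tens n M) : |F P - F Q| ≤ ν * ‖P - Q‖ := by
  refine Convex.norm_image_sub_le_of_norm_fderiv_le (𝕜 := ℝ) (fun x _ => hF.differentiable x)
    (fun x _ => ?_) convex_univ (mem_univ Q) (mem_univ P)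
  rw [← (InnerProductSpace.toDual ℝ (Tens n M)).symm.norm_map]
  exact hF.norm_gradient_le x

theorem le_norm (hF : IsIntegrand F ν) (P : Tens n M) : F P ≤ ν * ‖P‖ := by
  simpa [hF.zero] using (le_abs_self _).trans (hF.abs_sub_le P 0)

/-- Restriction to the line through `P` and `Q` reduces this to the tangent inequality in one
variable. -/
theorem add_inner_gradient_le (hF : IsIntegrand F ν) (P Q : Tens n M) :
    F P + ⟪gradient F P, Q - P⟫ ≤ F Q := by
  have hd : HasDerivAt (fun t : ℝ => F (P + t • (Q - P))) ⟪gradient F P, Q - P⟫ 0 := by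
    have h1 : HasFDerivAt F (InnerProductSpace.toDual ℝ _ (gradient F P)) (P + (0 : ℝ) • (Q - P)) := by
      simpa using (hF.hasGradientAt P).hasFDerivAt
    have h2 : HasDerivAt (fun t : ℝ => P + t • (Q - P)) (Q - P) 0 := by
      simpa using ((hasDerivAt_id (0:ℝ)).smul_const (Q - P)).const_add P
    exact h1.comp_hasDerivAt (0:ℝ) h2
  have hc : ConvexOn ℝ univ (fun t : ℝ => F (P + t • (Q - P))) := by
    have := hF.convex.comp_affineMap (AffineMap.lineMap P Q : ℝ →ᵃ[ℝ] Tens n M)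
    refine (show (fun t : ℝ => F (P + t • (Q - P))) = F ∘ AffineMap.lineMap P Q from ?_) ▸ this
    funext t
    simp [AffineMap.lineMap_apply, add_comm]
  have := hc.le_slope_of_hasDerivAt (mem_univ 0) (mem_univ 1) one_pos hd
  simp only [slope_def_field, zero_smul, add_zero, one_smul, add_sub_cancel, sub_zero, div_one] at this
  linarith

/-- The tangent is taken at the end point `P + Q`, which yields an upper bound for the increment;
`inner_gradient_le_recession` then controls the slope wherever it is taken. -/
theorem add_le (hF : IsIntegrand F ν) (P Q : Tens n M) :
    F (P + Q) ≤ F P + ⟪gradient F (P + Q), Q⟫ := by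
  have := hF.add_inner_gradient_le (P + Q) P
  rw [show P - (P + Q) = -Q by abel, inner_neg_right] at this
  linarith

theorem smul_le (hF : IsIntegrand F ν) {t : ℝ} (ht : 0 ≤ t) (ht1 : t ≤ 1) (P : Tens n M) :
    F (t • P) ≤ t * F P := by
  have := hF.convex.2 (mem_univ (0 : Tens n M)) (mem_univ P) (sub_nonneg.2 ht1) ht (by ring)
  simpa [hF.zero] using this

/-- As `F 0 = 0`, convexity makes the quotients nondecreasing, and linear growth bounds them. -/
theorem tendsto_recession (hF : IsIntegrand F ν) (P : Tens n M) :
    Tendsto (fun t : ℝ => F (t • P) / t) atTop (𝓝 (recession F P)) := by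
  -- Replacing `t` by `max t 1` gives monotonicity on the whole line and leaves the limit at
  -- infinity unchanged.
  have hmono : Monotone fun t : ℝ => F ((max t 1) • P) / max t 1 := by
    intro s t hst
    have hs : 0 < max s 1 := by positivity
    have ht : 0 < max t 1 := by positivity
    have hle : max s 1 ≤ max t 1 := max_le_max_right 1 hst
    have := hF.smul_le (t := max s 1 / max t 1) (by positivity) ((div_le_one ht).2 hle)
      ((max t 1) • P)
    rw [smul_smul, div_mul_cancel₀ _ ht.ne'] at this
    simp only
    rw [div_le_iff₀ hs]
    calc _ ≤ _ := this
      _ = _ := by field_simp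
  have hbdd : BddAbove (range fun t : ℝ => F ((max t 1) • P) / max t 1) := by
    refine ⟨ν * ‖P‖, ?_⟩
    rintro _ ⟨t, rfl⟩
    have ht : 0 < max t 1 := by positivity
    simp only
    rw [div_le_iff₀ ht]
    have := hF.le_norm ((max t 1) • P)
    rw [norm_smul, Real.norm_of_nonneg ht.le] at this
    linarith
  have hlim := tendsto_atTop_ciSup hmono hbdd
  have hlim' : Tendsto (fun t : ℝ => F (t • P) / t) atTop
      (𝓝 (⨆ t : ℝ, F ((max t 1) • P) / max t 1)) := by
    refine hlim.congr' ?_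
    filter_upwards [eventually_ge_atTop 1] with t ht
    rw [max_eq_left ht]
  exact tendsto_nhds_limUnder ⟨_, hlim'⟩

theorem recession_le_norm (hF : IsIntegrand F ν) (P : Tens n M) : recession F P ≤ ν * ‖P‖ := by
  refine le_of_tendsto (hF.tendsto_recession P) ?_
  filter_upwards [eventually_gt_atTop 0] with t ht
  rw [div_le_iff₀ ht]
  have := hF.le_norm (t • P)
  rw [norm_smul, Real.norm_of_nonneg ht.le] at this
  linarith

theorem recession_nonneg (hF : IsIntegrand F ν) (P : Tens n M) : 0 ≤ recession F P := by
  refine ge_of_tendsto (hF.tendsto_recession P) ?_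
  filter_upwards [eventually_gt_atTop 0] with t ht
  exact div_nonneg (hF.nonneg _) ht.le

/-- Divide the tangent inequality at `Q`, evaluated at `t • P`, by `t` and let `t → ∞`. The bound
does not depend on `Q`, which is what the energy estimate for mollified singular parts requires. -/
theorem inner_gradient_le_recession (hF : IsIntegrand F ν) (Q P : Tens n M) :
    ⟪gradient F Q, P⟫ ≤ recession F P := by
  have h0 : Tendsto (fun t : ℝ => (F Q - ⟪gradient F Q, Q⟫) / t + ⟪gradient F Q, P⟫) atTop
      (𝓝 (0 + ⟪gradient F Q, P⟫)) :=
    (tendsto_const_nhds.div_atTop tendsto_id).add_const _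
  rw [zero_add] at h0
  refine le_of_tendsto_of_tendsto h0 (hF.tendsto_recession P) ?_
  filter_upwards [eventually_gt_atTop 0] with t ht
  have := hF.add_inner_gradient_le Q (t • P)
  rw [inner_sub_right, inner_smul_right] at this
  rw [le_div_iff₀ ht, add_mul, div_mul_cancel₀ _ ht.ne']
  linarith

theorem measurable_recession (hF : IsIntegrand F ν) : Measurable (recession F) := by
  refine measurable_of_tendsto_metrizable (f := fun (k : ℕ) P => F ((k : ℝ) • P) / k)
    (fun k => ?_) ?_
  · exact ((hF.continuous.comp (continuous_const_smul _)).div_const _).measurable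
  · exact tendsto_pi_nhds.2 fun P => (hF.tendsto_recession P).comp tendsto_natCast_atTop_atTop

/-! ### The conjugate function -/

theorem inner_sub_le_conj (F : Tens n M → ℝ) (P Q : Tens n M) :
    ((⟪P, Q⟫ - F P : ℝ) : EReal) ≤ conj F Q :=
  le_iSup (fun P : Tens n M => ((⟪P, Q⟫ - F P : ℝ) : EReal)) P

theorem conj_nonneg (hF : IsIntegrand F ν) (Q : Tens n M) : 0 ≤ conj F Q := by
  simpa [hF.zero] using inner_sub_le_conj F 0 Q

/-- Fenchel–Young in real form. Finiteness is required because `toReal` sends `∞` to `0`. -/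
theorem inner_le_add_toReal (hF : IsIntegrand F ν) {Q : Tens n M} (hQ : (conj F Q).toENNReal ≠ ∞)
    (P : Tens n M) : ⟪Q, P⟫ ≤ F P + (conj F Q).toENNReal.toReal := by
  have h := inner_sub_le_conj F P Q
  rw [← EReal.coe_toENNReal (hF.conj_nonneg Q), ← ENNReal.ofReal_toReal hQ,
    EReal.coe_ennreal_ofReal, max_eq_left ENNReal.toReal_nonneg] at h
  have := EReal.coe_le_coe_iff.1 h
  rw [real_inner_comm]
  linarith

/-- Equality in the Fenchel–Young inequality forces `Q = DF(P)`. -/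
theorem eq_gradient_of_eq (hF : IsIntegrand F ν) {Q P : Tens n M}
    (hQ : (conj F Q).toENNReal ≠ ∞) (h : F P + (conj F Q).toENNReal.toReal = ⟪Q, P⟫) :
    Q = gradient F P := by
  -- By Fenchel–Young, equality at `P` makes `P` a global minimizer of `F R - ⟪Q, R⟫`, so the
  -- derivative vanishes there.
  have hmin : IsLocalMin (fun R => F R - ⟪Q, R⟫) P :=
    Eventually.of_forall fun R => by
      have := hF.inner_le_add_toReal hQ R
      simp only
      linarith
  have hd : HasFDerivAt (fun R => F R - ⟪Q, R⟫)
      (InnerProductSpace.toDual ℝ _ (gradient F P) - InnerProductSpace.toDual ℝ _ Q) P :=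
    (hF.hasGradientAt P).hasFDerivAt.sub (InnerProductSpace.toDual ℝ _ Q).hasFDerivAt
  have := hmin.hasFDerivAt_eq_zero hd
  rw [sub_eq_zero] at this
  exact ((InnerProductSpace.toDual ℝ _).injective this).symm

/-- Continuity of `F` allows a countable supremum. Measurability of the conjugate and the measurable
choice of nearly optimal slopes both rest on it. -/
theorem conj_eq_iSup_denseSeq (hF : IsIntegrand F ν) (Q : Tens n M) :
    conj F Q = ⨆ k, ((⟪TopologicalSpace.denseSeq (Tens n M) k, Q⟫ -
      F (TopologicalSpace.denseSeq (Tens n M) k) : ℝ) : EReal) := by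
  have hc : Continuous fun P : Tens n M => ((⟪P, Q⟫ - F P : ℝ) : EReal) :=
    continuous_coe_real_ereal.comp ((continuous_id.inner continuous_const).sub hF.continuous)
  refine le_antisymm (iSup_le fun P => ?_) (iSup_le fun k => inner_sub_le_conj F _ Q)
  have hcl : IsClosed {P : Tens n M | ((⟪P, Q⟫ - F P : ℝ) : EReal) ≤
      ⨆ k, ((⟪TopologicalSpace.denseSeq (Tens n M) k, Q⟫ -
        F (TopologicalSpace.denseSeq (Tens n M) k) : ℝ) : EReal)} :=
    isClosed_le hc continuous_const
  have := (TopologicalSpace.denseRange_denseSeq (Tens n M)).closure_eq ▸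
    hcl.closure_subset_iff.2 (by rintro _ ⟨k, rfl⟩; exact le_iSup (fun k =>
      ((⟪TopologicalSpace.denseSeq (Tens n M) k, Q⟫ -
        F (TopologicalSpace.denseSeq (Tens n M) k) : ℝ) : EReal)) k)
  exact this (mem_univ P)

theorem measurable_conj (hF : IsIntegrand F ν) : Measurable (conj F) := by
  have : conj F = fun Q => ⨆ k, ((⟪TopologicalSpace.denseSeq (Tens n M) k, Q⟫ -
      F (TopologicalSpace.denseSeq (Tens n M) k) : ℝ) : EReal) :=
    funext hF.conj_eq_iSup_denseSeq
  rw [this]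
  refine Measurable.iSup fun k => measurable_coe_real_ereal.comp ?_
  exact ((continuous_const.inner continuous_id).sub continuous_const).measurable

end IsIntegrand

end Inpainting

/-! ### Subgradients and the dual of `L¹` -/

namespace Inpainting

section Subgradient

variable {E : Type*} [NormedAddCommGroup E] [NormedSpace ℝ E]

/-- A convex function which is Lipschitz at the origin has a continuous subgradient there. -/
theorem exists_subgradient_zero {Φ : E → ℝ} (hΦ : ConvexOn ℝ univ Φ) {ν : ℝ}
    (hle : ∀ p, Φ p ≤ Φ 0 + ν * ‖p‖) : ∃ Λ : E →L[ℝ] ℝ, ∀ p, Φ 0 + Λ p ≤ Φ p := by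
  -- `S p` is the difference quotient at the origin in direction `p`, and `N p` is the one-sided
  -- directional derivative. `N` is sublinear, so Hahn–Banach, started from the zero subspace, gives
  -- a linear functional below it.
  set S : E → ℝ → ℝ := fun p t => (Φ (t • p) - Φ 0) / t with hS
  set N : E → ℝ := fun p => ⨅ t : Ioi (0 : ℝ), S p t with hN
  have : Nonempty (Ioi (0 : ℝ)) := ⟨⟨1, mem_Ioi.2 one_pos⟩⟩
  have hlow : ∀ p (t : Ioi (0 : ℝ)), -(ν * ‖p‖) ≤ S p t := by
    rintro p ⟨t, ht : 0 < t⟩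
    -- The origin is the midpoint of `t • p` and `-(t • p)`, so the upper bound at one gives a lower
    -- bound at the other.
    have h1 := hΦ.2 (mem_univ (t • p)) (mem_univ (-(t • p))) (by norm_num : (0:ℝ) ≤ 1 / 2)
      (by norm_num : (0:ℝ) ≤ 1 / 2) (by norm_num)
    have h2 := hle (-(t • p))
    rw [smul_neg, add_neg_cancel] at h1
    rw [norm_neg, norm_smul, Real.norm_of_nonneg ht.le] at h2
    simp only [smul_eq_mul] at h1
    simp only [hS]
    rw [le_div_iff₀ ht]
    linarith
  have hbdd : ∀ p, BddBelow (range fun t : Ioi (0 : ℝ) => S p t) := fun p =>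
    ⟨-(ν * ‖p‖), by rintro _ ⟨t, rfl⟩; exact hlow p t⟩
  have hNle : ∀ p {t : ℝ}, 0 < t → N p ≤ S p t := fun p t ht => ciInf_le (hbdd p) ⟨t, ht⟩
  have hmono : ∀ p {s t : ℝ}, 0 < s → s ≤ t → S p s ≤ S p t := by
    intro p s t hs hst
    have ht := hs.trans_le hst
    have h1 := hΦ.2 (mem_univ (0 : E)) (mem_univ (t • p)) (sub_nonneg.2 ((div_le_one ht).2 hst))
      (div_nonneg hs.le ht.le) (by ring)
    rw [smul_zero, zero_add, smul_smul, div_mul_cancel₀ _ ht.ne'] at h1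
    simp only [smul_eq_mul] at h1
    simp only [hS]
    rw [div_le_div_iff₀ hs ht]
    have : t * ((1 - s / t) * Φ 0 + s / t * Φ (t • p)) = (t - s) * Φ 0 + s * Φ (t • p) := by
      field_simp
    nlinarith
  have hN_hom : ∀ c : ℝ, 0 < c → ∀ x, N (c • x) = c * N x := by
    intro c hc x
    have hscale : ∀ {t : ℝ}, 0 < t → S (c • x) t = c * S x (t * c) := by
      intro t ht
      simp only [hS, smul_smul]
      field_simp
    refine le_antisymm ?_ ?_
    · simp only [hN]
      rw [Real.mul_iInf_of_nonneg hc.le]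
      refine le_ciInf fun t => ?_
      have ht : 0 < (t : ℝ) / c := div_pos t.2 hc
      refine (hNle _ ht).trans (le_of_eq ?_)
      rw [hscale ht, div_mul_cancel₀ _ hc.ne']
    · refine le_ciInf fun t => ?_
      rw [hscale t.2]
      exact mul_le_mul_of_nonneg_left (hNle x (mul_pos t.2 hc)) hc.le
  have hN_add : ∀ x y, N (x + y) ≤ N x + N y := by
    intro x y
    have key : ∀ s t : Ioi (0 : ℝ), N (x + y) ≤ S x s + S y t := by
      intro s t
      -- The quotients increase with the step, so both steps may be lowered to `r`; the midpoint of
      -- `r • x` and `r • y` is `(r / 2) • (x + y)`.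
      set r : ℝ := min s t with hr
      have hr0 : 0 < r := lt_min s.2 t.2
      have h1 := hΦ.2 (mem_univ (r • x)) (mem_univ (r • y)) (by norm_num : (0:ℝ) ≤ 1 / 2)
        (by norm_num : (0:ℝ) ≤ 1 / 2) (by norm_num)
      have h2 : N (x + y) ≤ S (x + y) (r / 2) := hNle _ (half_pos hr0)
      have h3 : S (x + y) (r / 2) ≤ S x r + S y r := by
        simp only [hS]
        rw [← add_div, div_le_div_iff₀ (half_pos hr0) hr0]
        have : (r / 2) • (x + y) = (1 / 2 : ℝ) • r • x + (1 / 2 : ℝ) • r • y := by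
          rw [smul_smul, smul_smul, ← smul_add]; ring_nf
        rw [this]
        simp only [smul_eq_mul] at h1
        nlinarith
      exact h2.trans (h3.trans (add_le_add (hmono x hr0 (min_le_left _ _))
        (hmono y hr0 (min_le_right _ _))))
    have h1 : ∀ s : Ioi (0 : ℝ), N (x + y) - S x s ≤ N y := fun s =>
      le_ciInf fun t => by linarith [key s t]
    have h2 : N (x + y) - N y ≤ N x := le_ciInf fun s => by linarith [h1 s]
    linarith
  obtain ⟨g, -, hg⟩ := exists_extension_of_le_sublinear (⊥ : E →ₗ.[ℝ] ℝ) N hN_hom hN_add (by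
    rintro ⟨x, hx⟩
    have hx0 : x = 0 := (Submodule.mem_bot ℝ).1 hx
    subst hx0
    have h0 : N 0 = 0 := by simp [hN, hS]
    rw [h0]
    exact le_of_eq (map_zero (⊥ : E →ₗ.[ℝ] ℝ).toFun))
  have hgΦ : ∀ p, Φ 0 + g p ≤ Φ p := fun p => by
    have := (hg p).trans (hNle p one_pos)
    simp [hS] at this
    linarith
  -- Applied to `p` and `-p`, this one-sided bound gives continuity.
  have hgle : ∀ p, g p ≤ ν * ‖p‖ := fun p => by linarith [hgΦ p, hle p]
  refine ⟨g.mkContinuous ν fun p => ?_, hgΦ⟩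
  rw [Real.norm_eq_abs, abs_le]
  refine ⟨?_, hgle p⟩
  have := hgle (-p)
  rw [map_neg, norm_neg] at this
  linarith

end Subgradient

section DualL1

theorem memLp_one_of_two {X E : Type*} [MeasurableSpace X] {μ : Measure X} [IsFiniteMeasure μ]
    [NormedAddCommGroup E] {g : X → E} (hg : MemLp g 2 μ) : MemLp g 1 μ :=
  hg.mono_exponent (by norm_num)

variable {X E : Type*} [MeasurableSpace X] {μ : Measure X} [IsFiniteMeasure μ]
  [NormedAddCommGroup E] [InnerProductSpace ℝ E]

/-- The inclusion of `L²` into `L¹` over a finite measure space. -/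
noncomputable def inclTwoOne : Lp E 2 μ →L[ℝ] Lp E 1 μ :=
  LinearMap.mkContinuous
    { toFun := fun g => (memLp_one_of_two (Lp.memLp g)).toLp
      map_add' := fun g h => by
        ext1
        filter_upwards [MemLp.coeFn_toLp (memLp_one_of_two (Lp.memLp (g + h))),
          MemLp.coeFn_toLp (memLp_one_of_two (Lp.memLp g)),
          MemLp.coeFn_toLp (memLp_one_of_two (Lp.memLp h)), Lp.coeFn_add g h,
          Lp.coeFn_add (memLp_one_of_two (Lp.memLp g)).toLp (memLp_one_of_two (Lp.memLp h)).toLp]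
          with x h1 h2 h3 h4 h5
        rw [h1, h4, h5, Pi.add_apply, Pi.add_apply, h2, h3]
      map_smul' := fun c g => by
        ext1
        filter_upwards [MemLp.coeFn_toLp (memLp_one_of_two (Lp.memLp (c • g))),
          MemLp.coeFn_toLp (memLp_one_of_two (Lp.memLp g)), Lp.coeFn_smul c g,
          Lp.coeFn_smul c (memLp_one_of_two (Lp.memLp g)).toLp]
          with x h1 h2 h3 h4
        rw [h1, h3, RingHom.id_apply, h4, Pi.smul_apply, Pi.smul_apply, h2] }
    (μ univ ^ (1 - 1 / 2 : ℝ)).toReal fun g => by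
      simp only [LinearMap.coe_mk, AddHom.coe_mk]
      rw [Lp.norm_toLp, Lp.norm_def, ← ENNReal.toReal_mul, mul_comm]
      refine ENNReal.toReal_mono (ENNReal.mul_ne_top (Lp.eLpNorm_ne_top g) (by finiteness)) ?_
      have := eLpNorm_le_eLpNorm_mul_rpow_measure_univ (μ := μ) (p := 1) (q := 2)
        (by norm_num) (Lp.aestronglyMeasurable g)
      simpa using this

theorem coeFn_inclTwoOne (g : Lp E 2 μ) : inclTwoOne g =ᵐ[μ] g :=
  MemLp.coeFn_toLp (memLp_one_of_two (Lp.memLp g))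

theorem norm_inclTwoOne (g : Lp E 2 μ) : ‖inclTwoOne g‖ = ∫ x, ‖g x‖ ∂μ := by
  rw [L1.norm_eq_integral_norm]
  refine integral_congr_ae ?_
  filter_upwards [coeFn_inclTwoOne g] with x hx
  rw [hx]

/-- Every continuous functional on `L¹` over a finite measure space is represented by a function
in `L^∞`. -/
theorem exists_Linfty_representation [CompleteSpace E] (Λ : Lp E 1 μ →L[ℝ] ℝ) :
    ∃ σ : Lp E ∞ μ, ∀ p : Lp E 1 μ, Λ p = ∫ x, ⟪σ x, p x⟫ ∂μ := by
  -- Riesz representation in `L²`, which embeds in `L¹` because the measure is finite.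
  set g : Lp E 2 μ := (InnerProductSpace.toDual ℝ (Lp E 2 μ)).symm (Λ.comp inclTwoOne) with hgdef
  have hg : ∀ q : Lp E 2 μ, Λ (inclTwoOne q) = ∫ x, ⟪g x, q x⟫ ∂μ := fun q => by
    have h1 : ⟪g, q⟫ = (Λ.comp inclTwoOne) q := by
      rw [hgdef, InnerProductSpace.toDual_symm_apply]
    rw [← L2.inner_def, h1]; rfl
  have hgm : StronglyMeasurable g := Lp.stronglyMeasurable g
  have hgi : Integrable g μ := memLp_one_iff_integrable.1 (memLp_one_of_two (Lp.memLp g))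
  set C := ‖Λ‖
  set A : Set X := {x | C < ‖g x‖} with hA
  have hAm : MeasurableSet A := measurableSet_lt measurable_const hgm.norm.measurable
  -- Testing with the direction of `g` on the set `A` where `‖g‖ > ‖Λ‖` gives `∫_A ‖g‖ ≤ ‖Λ‖ μ(A)`,
  -- so `A` is null and `g` is essentially bounded.
  set q₀ : X → E := A.indicator fun x => ‖g x‖⁻¹ • g x with hq₀
  have hq₀m : StronglyMeasurable q₀ := (hgm.norm.measurable.inv.stronglyMeasurable.smul hgm).indicator hAm
  have hq₀n : ∀ x ∈ A, ‖q₀ x‖ = 1 := fun x hx => by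
    have : 0 < ‖g x‖ := (norm_nonneg Λ).trans_lt hx
    rw [hq₀, indicator_of_mem hx, norm_smul, norm_inv, norm_norm, inv_mul_cancel₀ this.ne']
  have hq₀z : ∀ x ∉ A, q₀ x = 0 := fun x hx => indicator_of_notMem hx _
  have hq₀b : ∀ x, ‖q₀ x‖ ≤ 1 := fun x => by
    by_cases hx : x ∈ A
    · exact (hq₀n x hx).le
    · simp [hq₀z x hx]
  have hq₀L : MemLp q₀ 2 μ := MemLp.of_bound hq₀m.aestronglyMeasurable 1 (ae_of_all _ hq₀b)
  have e1 : Λ (inclTwoOne hq₀L.toLp) = ∫ x in A, ‖g x‖ ∂μ := by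
    rw [hg, ← integral_indicator hAm]
    refine integral_congr_ae ?_
    filter_upwards [hq₀L.coeFn_toLp] with x hx
    rw [hx]
    by_cases hxA : x ∈ A
    · have : 0 < ‖g x‖ := (norm_nonneg Λ).trans_lt hxA
      rw [indicator_of_mem hxA, hq₀, indicator_of_mem hxA, inner_smul_right,
        real_inner_self_eq_norm_sq]
      field_simp
    · rw [hq₀z x hxA, indicator_of_notMem hxA, inner_zero_right]
  have e2 : ‖inclTwoOne hq₀L.toLp‖ = ∫ x in A, (1 : ℝ) ∂μ := by
    rw [norm_inclTwoOne, ← integral_indicator hAm]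
    refine integral_congr_ae ?_
    filter_upwards [hq₀L.coeFn_toLp] with x hx
    rw [hx]
    by_cases hxA : x ∈ A
    · rw [indicator_of_mem hxA, hq₀n x hxA]
    · rw [hq₀z x hxA, indicator_of_notMem hxA, norm_zero]
  have e3 : ∫ x in A, (‖g x‖ - C) ∂μ ≤ 0 := by
    rw [integral_sub hgi.norm.integrableOn (integrable_const _)]
    have h1 := (le_abs_self _).trans (Λ.le_opNorm (inclTwoOne hq₀L.toLp))
    rw [e1, e2] at h1
    have h2 : ∫ _ in A, C ∂μ = C * ∫ _ in A, (1 : ℝ) ∂μ := by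
      rw [← integral_const_mul]; simp
    linarith
  have hA0 : μ A = 0 := by
    have hpos : ∀ x ∈ A, 0 < ‖g x‖ - C := fun x hx => sub_pos.2 hx
    have hi : IntegrableOn (fun x => ‖g x‖ - C) A μ :=
      (hgi.norm.sub (integrable_const _)).integrableOn
    by_contra hne
    have := (setIntegral_pos_iff_support_of_nonneg_ae
      ((ae_restrict_iff' hAm).2 (ae_of_all _ fun x hx => (hpos x hx).le)) hi).2 (by
        rw [inter_eq_right.2 fun x hx => ?_]
        · exact pos_iff_ne_zero.2 hne
        · exact (hpos x hx).ne')
    linarith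
  have hgb : ∀ᵐ x ∂μ, ‖g x‖ ≤ C := by
    rw [ae_iff]; simpa [hA, not_le] using hA0
  have hgL : MemLp g ∞ μ := memLp_top_of_bound (Lp.aestronglyMeasurable g) C hgb
  refine ⟨hgL.toLp, fun p => ?_⟩
  have hσ : ∀ p : X → E, ∫ x, ⟪hgL.toLp g x, p x⟫ ∂μ = ∫ x, ⟪g x, p x⟫ ∂μ := fun p => by
    refine integral_congr_ae ?_
    filter_upwards [hgL.coeFn_toLp] with x hx
    rw [hx]
  rw [hσ]
  have hint : ∀ {p : X → E}, Integrable p μ → Integrable (fun x => ⟪g x, p x⟫) μ := by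
    intro p hp
    refine (hp.norm.const_mul C).mono' (hgm.aestronglyMeasurable.inner hp.aestronglyMeasurable) ?_
    filter_upwards [hgb] with x hx
    exact (norm_inner_le_norm _ _).trans (mul_le_mul_of_nonneg_right hx (norm_nonneg _))
  let Λ' : Lp E 1 μ →L[ℝ] ℝ := LinearMap.mkContinuous
    { toFun := fun p => ∫ x, ⟪g x, p x⟫ ∂μ
      map_add' := fun p q => by
        rw [← integral_add (hint (L1.integrable_coeFn p)) (hint (L1.integrable_coeFn q))]
        refine integral_congr_ae ?_
        filter_upwards [Lp.coeFn_add p q] with x hx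
        rw [hx, Pi.add_apply, inner_add_right]
      map_smul' := fun c p => by
        rw [RingHom.id_apply, smul_eq_mul, ← integral_const_mul]
        refine integral_congr_ae ?_
        filter_upwards [Lp.coeFn_smul c p] with x hx
        rw [hx, Pi.smul_apply, inner_smul_right] } C fun p => by
      rw [L1.norm_eq_integral_norm, ← integral_const_mul]
      refine norm_integral_le_of_norm_le ((L1.integrable_coeFn p).norm.const_mul C) ?_
      filter_upwards [hgb] with x hx
      exact (norm_inner_le_norm _ _).trans (mul_le_mul_of_nonneg_right hx (norm_nonneg _))
  change Λ p = Λ' p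
  -- Both functionals are continuous on `L¹` and agree on indicators, which lie in `L²`; simple
  -- functions are dense.
  refine Lp.induction (by norm_num) (motive := fun p => Λ p = Λ' p) (fun c s hs hμs => ?_)
    (fun f g' hf hg' _ h1 h2 => ?_) (isClosed_eq Λ.continuous Λ'.continuous) p
  · have hL : MemLp (s.indicator fun _ => c) 2 μ := memLp_indicator_const 2 hs c (Or.inr hμs.ne)
    have he : (Lp.simpleFunc.indicatorConst 1 hs hμs.ne c : Lp E 1 μ) = inclTwoOne hL.toLp := by
      ext1
      rw [Lp.simpleFunc.coe_indicatorConst]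
      filter_upwards [indicatorConstLp_coeFn (p := 1) (hs := hs) (hμs := hμs.ne) (c := c),
        coeFn_inclTwoOne hL.toLp, hL.coeFn_toLp] with x h1 h2 h3
      rw [h1, h2, h3]
    rw [he, hg]
    refine integral_congr_ae ?_
    filter_upwards [coeFn_inclTwoOne hL.toLp] with x hx
    rw [hx]
  · rw [map_add, map_add, h1, h2]

end DualL1

end Inpainting

/-! ### The dual problem -/

namespace Inpainting

variable {n M : ℕ} {F : Tens n M → ℝ} {ν : ℝ}

namespace IsIntegrand

/-- The first `N` vectors of the dense sequence and `0` compete in the definition of `F^*(Q)`;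
this is the best one among them. -/
noncomputable def bestSlope (F : Tens n M → ℝ) : ℕ → Tens n M → Tens n M
  | 0, _ => 0
  | N + 1, Q =>
    open Classical in
    if ⟪bestSlope F N Q, Q⟫ - F (bestSlope F N Q) ≤
        ⟪TopologicalSpace.denseSeq (Tens n M) N, Q⟫ - F (TopologicalSpace.denseSeq (Tens n M) N)
    then TopologicalSpace.denseSeq (Tens n M) N else bestSlope F N Q

theorem measurable_bestSlope (hF : IsIntegrand F ν) (N : ℕ) : Measurable (bestSlope F N) := by
  induction N with
  | zero => exact measurable_const
  | succ N ih =>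
    refine Measurable.ite (measurableSet_le ?_ ?_) measurable_const ih
    · exact (ih.inner measurable_id).sub (hF.continuous.measurable.comp ih)
    · exact (measurable_const.inner measurable_id).sub measurable_const

theorem bestSlope_bounded (F : Tens n M → ℝ) (N : ℕ) : ∃ C, ∀ Q, ‖bestSlope F N Q‖ ≤ C := by
  induction N with
  | zero => exact ⟨0, fun Q => by simp [bestSlope]⟩
  | succ N ih =>
    obtain ⟨C, hC⟩ := ih
    refine ⟨max C ‖TopologicalSpace.denseSeq (Tens n M) N‖, fun Q => ?_⟩
    rw [bestSlope]
    split_ifs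
    · exact le_max_right _ _
    · exact (hC Q).trans (le_max_left _ _)

theorem monotone_bestSlope (F : Tens n M → ℝ) (Q : Tens n M) :
    Monotone fun N => ⟪bestSlope F N Q, Q⟫ - F (bestSlope F N Q) := by
  refine monotone_nat_of_le_succ fun N => ?_
  simp only [bestSlope]
  split_ifs with h
  · exact h
  · exact le_rfl

theorem denseSeq_le_bestSlope (F : Tens n M → ℝ) (Q : Tens n M) (N : ℕ) :
    ⟪TopologicalSpace.denseSeq (Tens n M) N, Q⟫ - F (TopologicalSpace.denseSeq (Tens n M) N) ≤
      ⟪bestSlope F (N + 1) Q, Q⟫ - F (bestSlope F (N + 1) Q) := by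
  simp only [bestSlope]
  split_ifs with h
  · exact le_rfl
  · exact (not_le.1 h).le

/-- Starting from the slope `0` keeps all values nonnegative, so `ENNReal.ofReal` loses nothing. -/
theorem bestSlope_nonneg (hF : IsIntegrand F ν) (Q : Tens n M) (N : ℕ) :
    0 ≤ ⟪bestSlope F N Q, Q⟫ - F (bestSlope F N Q) := by
  have := monotone_bestSlope F Q (Nat.zero_le N)
  simpa [bestSlope, hF.zero] using this

/-- Each vector of the dense sequence enters the competition at some stage, so the best values
exhaust the supremum. -/
theorem toENNReal_conj_le (hF : IsIntegrand F ν) (Q : Tens n M) :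
    (conj F Q).toENNReal ≤
      ⨆ N, ENNReal.ofReal (⟪bestSlope F N Q, Q⟫ - F (bestSlope F N Q)) := by
  rw [← EReal.toENNReal_coe (x := ⨆ N, ENNReal.ofReal _)]
  refine EReal.toENNReal_le_toENNReal ?_
  rw [hF.conj_eq_iSup_denseSeq]
  refine iSup_le fun k => ?_
  have h1 := denseSeq_le_bestSlope F Q k
  have h2 := hF.bestSlope_nonneg Q (k + 1)
  calc _ ≤ ((⟪bestSlope F (k + 1) Q, Q⟫ - F (bestSlope F (k + 1) Q) : ℝ) : EReal) :=
        EReal.coe_le_coe_iff.2 h1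
    _ = ((ENNReal.ofReal (⟪bestSlope F (k + 1) Q, Q⟫ - F (bestSlope F (k + 1) Q)) : ℝ≥0∞) : EReal) := by
        rw [EReal.coe_ennreal_ofReal, max_eq_left h2]
    _ ≤ _ := EReal.coe_ennreal_le_coe_ennreal_iff.2
        (le_iSup (fun N => ENNReal.ofReal (⟪bestSlope F N Q, Q⟫ - F (bestSlope F N Q))) (k + 1))

theorem integrable_comp (hF : IsIntegrand F ν) {X : Type*} [MeasurableSpace X] {μ : Measure X}
    {G : X → Tens n M} (hG : Integrable G μ) : Integrable (fun x => F (G x)) μ := by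
  refine (hG.norm.const_mul ν).mono' (hF.continuous.comp_aestronglyMeasurable hG.1)
    (ae_of_all _ fun x => ?_)
  rw [Real.norm_of_nonneg (hF.nonneg _)]
  exact hF.le_norm _

/-- Supremum and integral are interchanged: the slopes `bestSlope F N (σ x)` are measurable and
bounded in `x`, hence admissible as `q`, and their values increase with `N`, so monotone convergence
applies. -/
theorem lintegral_conj_le (hF : IsIntegrand F ν) {X : Type*} [MeasurableSpace X] {μ : Measure X}
    [IsFiniteMeasure μ] {σ : X → Tens n M} (hσ : StronglyMeasurable σ) (hσi : Integrable σ μ) {B : ℝ}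
    (hB : ∀ q : X → Tens n M, Integrable q μ → ∫ x, (⟪σ x, q x⟫ - F (q x)) ∂μ ≤ B) :
    ∫⁻ x, (conj F (σ x)).toENNReal ∂μ ≤ ENNReal.ofReal B := by
  refine (lintegral_mono fun x => hF.toENNReal_conj_le (σ x)).trans ?_
  have hmeas : ∀ N, Measurable fun Q => ⟪bestSlope F N Q, Q⟫ - F (bestSlope F N Q) := fun N =>
    ((hF.measurable_bestSlope N).inner measurable_id).sub
      (hF.continuous.measurable.comp (hF.measurable_bestSlope N))
  rw [lintegral_iSup (f := fun N x => ENNReal.ofReal (⟪bestSlope F N (σ x), σ x⟫ -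
      F (bestSlope F N (σ x)))) (fun N => ((hmeas N).comp hσ.measurable).ennreal_ofReal)
    (fun N N' h x => ENNReal.ofReal_le_ofReal (monotone_bestSlope F (σ x) h))]
  refine iSup_le fun N => ?_
  obtain ⟨C, hC⟩ := bestSlope_bounded F N
  have hq : Integrable (fun x => bestSlope F N (σ x)) μ :=
    Integrable.of_bound ((hF.measurable_bestSlope N).comp hσ.measurable).aestronglyMeasurable C
      (ae_of_all _ fun x => hC _)
  have hint : Integrable (fun x => ⟪bestSlope F N (σ x), σ x⟫ - F (bestSlope F N (σ x))) μ := by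
    refine Integrable.sub ?_ (hF.integrable_comp hq)
    refine (hσi.norm.const_mul C).mono' (hq.1.inner hσi.1) (ae_of_all _ fun x => ?_)
    exact (norm_inner_le_norm _ _).trans (mul_le_mul_of_nonneg_right (hC _) (norm_nonneg _))
  rw [← ofReal_integral_eq_lintegral_ofReal hint (ae_of_all _ fun x => hF.bestSlope_nonneg _ N)]
  refine ENNReal.ofReal_le_ofReal ?_
  have := hB _ hq
  simpa only [real_inner_comm] using this

end IsIntegrand

end Inpainting

/-! ### The primal problem and its perturbation in the gradient variable. -/

namespace Inpainting

variable {n M : ℕ}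

/-- Competitors of the primal problem: `w ∈ W^{1,1}(Ω)ᴹ ∩ L^ζ(Ω - D)ᴹ` with weak gradient `G`. -/
structure IsCompetitor (Ω D : Set (Dom n)) (ζ : ℝ) (w : Dom n → Val M) (G : Dom n → Tens n M) :
    Prop where
  isW11 : IsW11 Ω w G
  memLp : MemLp w (ENNReal.ofReal ζ) (volume.restrict (Ω \ D))

section Data

variable {Ω D : Set (Dom n)} {f : Dom n → Val M} {l ζ : ℝ}

theorem integrable_norm_sub_rpow (hζ : 1 < ζ)
    (hf : MemLp f (ENNReal.ofReal ζ) (volume.restrict (Ω \ D))) {w : Dom n → Val M}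
    (hw : MemLp w (ENNReal.ofReal ζ) (volume.restrict (Ω \ D))) :
    IntegrableOn (fun x => ‖w x - f x‖ ^ ζ) (Ω \ D) := by
  have := (hw.sub hf).integrable_norm_rpow (by simpa using zero_lt_one.trans hζ) ENNReal.ofReal_ne_top
  simpa [ENNReal.toReal_ofReal (zero_lt_one.trans hζ).le] using! this

theorem dataTerm_nonneg (hl : 0 < l) (hζ : 1 < ζ) (w : Dom n → Val M) :
    0 ≤ dataTerm Ω D f l ζ w :=
  mul_nonneg (div_nonneg hl.le (zero_lt_one.trans hζ).le)
    (integral_nonneg fun _ => Real.rpow_nonneg (norm_nonneg _) _)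

theorem dataTerm_convex (hl : 0 < l) (hζ : 1 < ζ)
    (hf : MemLp f (ENNReal.ofReal ζ) (volume.restrict (Ω \ D))) {v w : Dom n → Val M}
    (hv : MemLp v (ENNReal.ofReal ζ) (volume.restrict (Ω \ D)))
    (hw : MemLp w (ENNReal.ofReal ζ) (volume.restrict (Ω \ D))) {a b : ℝ} (ha : 0 ≤ a)
    (hb : 0 ≤ b) (hab : a + b = 1) :
    dataTerm Ω D f l ζ (a • v + b • w) ≤ a * dataTerm Ω D f l ζ v + b * dataTerm Ω D f l ζ w := by
  have hiv := integrable_norm_sub_rpow hζ hf hv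
  have hiw := integrable_norm_sub_rpow hζ hf hw
  have hi := integrable_norm_sub_rpow hζ hf ((hv.const_smul a).add (hw.const_smul b))
  have key : ∫ x in Ω \ D, ‖(a • v + b • w) x - f x‖ ^ ζ ≤
      ∫ x in Ω \ D, (a * ‖v x - f x‖ ^ ζ + b * ‖w x - f x‖ ^ ζ) := by
    refine integral_mono hi ((hiv.const_mul a).add (hiw.const_mul b)) fun x => ?_
    have h1 : ‖(a • v + b • w) x - f x‖ ≤ a * ‖v x - f x‖ + b * ‖w x - f x‖ := by
      have : (a • v + b • w) x - f x = a • (v x - f x) + b • (w x - f x) := by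
        have : f x = (a + b) • f x := by rw [hab, one_smul]
        nth_rewrite 1 [this]
        simp only [Pi.add_apply, Pi.smul_apply, add_smul, smul_sub]
        abel
      rw [this]
      refine (norm_add_le _ _).trans (le_of_eq ?_)
      rw [norm_smul, norm_smul, Real.norm_of_nonneg ha, Real.norm_of_nonneg hb]
    refine (Real.rpow_le_rpow (norm_nonneg _) h1 (zero_lt_one.trans hζ).le).trans ?_
    exact (convexOn_rpow hζ.le).2 (norm_nonneg (v x - f x)) (norm_nonneg (w x - f x)) ha hb hab
  rw [integral_add (hiv.const_mul a) (hiw.const_mul b), integral_const_mul, integral_const_mul] at key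
  have := mul_le_mul_of_nonneg_left key (div_nonneg hl.le (zero_lt_one.trans hζ).le)
  simp only [dataTerm]
  linarith

theorem IsW11.combine {v w : Dom n → Val M} {G H : Dom n → Tens n M} (hv : IsW11 Ω v G)
    (hw : IsW11 Ω w H) (a b : ℝ) : IsW11 Ω (a • v + b • w) (a • G + b • H) := by
  refine ⟨(hv.integrable.smul a).add (hw.integrable.smul b),
    (hv.integrable_grad.smul a).add (hw.integrable_grad.smul b), fun φ hφ i j => ?_⟩
  obtain ⟨C, hC⟩ := hφ.bounded
  have hpc : Continuous (pderiv j φ) :=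
    (hφ.smooth.continuous_fderiv (by simp)).clm_apply continuous_const
  have hps : HasCompactSupport (pderiv j φ) := hφ.hasCompactSupport.fderiv_apply (𝕜 := ℝ) _
  obtain ⟨C', hC'⟩ := hps.exists_bound_of_continuous hpc
  have h1 : ∀ {u : Dom n → Val M}, IntegrableOn u Ω →
      IntegrableOn (fun x => u x i * pderiv j φ x) Ω := fun {u} hu =>
    (((EuclideanSpace.proj i : Val M →L[ℝ] ℝ).integrable_comp hu).mul_bdd
      hpc.aestronglyMeasurable (ae_of_all _ hC'))
  have h2 : ∀ {U : Dom n → Tens n M}, IntegrableOn U Ω →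
      IntegrableOn (fun x => φ x * U x (i, j)) Ω := fun {U} hU =>
    (((EuclideanSpace.proj (i, j) : Tens n M →L[ℝ] ℝ).integrable_comp hU).bdd_mul
      hφ.smooth.continuous.aestronglyMeasurable (ae_of_all _ hC))
  have e1 : ∀ x, (a • v + b • w) x i * pderiv j φ x =
      a * (v x i * pderiv j φ x) + b * (w x i * pderiv j φ x) := fun x => by simp; ring
  have e2 : ∀ x, φ x * (a • G + b • H) x (i, j) =
      a * (φ x * G x (i, j)) + b * (φ x * H x (i, j)) := fun x => by simp; ring
  simp only [e1, e2]
  rw [integral_add ((h1 hv.integrable).const_mul a) ((h1 hw.integrable).const_mul b),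
    integral_add ((h2 hv.integrable_grad).const_mul a) ((h2 hw.integrable_grad).const_mul b),
    integral_const_mul, integral_const_mul, integral_const_mul, integral_const_mul,
    hv.weak_grad φ hφ, hw.weak_grad φ hφ]
  ring

theorem IsCompetitor.combine {v w : Dom n → Val M} {G H : Dom n → Tens n M}
    (hv : IsCompetitor Ω D ζ v G) (hw : IsCompetitor Ω D ζ w H) (a b : ℝ) :
    IsCompetitor Ω D ζ (a • v + b • w) (a • G + b • H) :=
  ⟨hv.isW11.combine hw.isW11 a b, (hv.memLp.const_smul a).add (hw.memLp.const_smul b)⟩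

theorem isCompetitor_zero : IsCompetitor Ω D ζ (0 : Dom n → Val M) (0 : Dom n → Tens n M) :=
  ⟨⟨integrable_zero _ _ _, integrable_zero _ _ _, fun φ _ i j => by simp⟩, MemLp.zero⟩

end Data

section Duality

variable {Ω D : Set (Dom n)} {f : Dom n → Val M} {F : Tens n M → ℝ} {l ζ ν : ℝ}

/-- The infimum of the primal problem whose gradient variable is perturbed by `p`. -/
noncomputable def perturbedInf (Ω D : Set (Dom n)) (f : Dom n → Val M) (F : Tens n M → ℝ) (l ζ : ℝ)
    (p : Dom n → Tens n M) : ℝ :=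
  ⨅ a : {a : (Dom n → Val M) × (Dom n → Tens n M) // IsCompetitor Ω D ζ a.1 a.2},
    primal Ω D f F l ζ a.1.1 (a.1.2 + p)

theorem primal_nonneg (hF : IsIntegrand F ν) (hl : 0 < l) (hζ : 1 < ζ) (w : Dom n → Val M)
    (G : Dom n → Tens n M) : 0 ≤ primal Ω D f F l ζ w G :=
  add_nonneg (integral_nonneg fun _ => hF.nonneg _) (dataTerm_nonneg hl hζ w)

theorem perturbedInf_le (hF : IsIntegrand F ν) (hl : 0 < l) (hζ : 1 < ζ) {w : Dom n → Val M}
    {G : Dom n → Tens n M} (h : IsCompetitor Ω D ζ w G) (p : Dom n → Tens n M) :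
    perturbedInf Ω D f F l ζ p ≤ primal Ω D f F l ζ w (G + p) :=
  ciInf_le (f := fun a : {a : (Dom n → Val M) × (Dom n → Tens n M) //
      IsCompetitor Ω D ζ a.1 a.2} => primal Ω D f F l ζ a.1.1 (a.1.2 + p))
    ⟨0, by rintro _ ⟨a, rfl⟩; exact primal_nonneg hF hl hζ _ _⟩ ⟨(w, G), h⟩

theorem le_perturbedInf {p : Dom n → Tens n M} {c : ℝ}
    (h : ∀ w G, IsCompetitor Ω D ζ w G → c ≤ primal Ω D f F l ζ w (G + p)) :
    c ≤ perturbedInf Ω D f F l ζ p := by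
  have : Nonempty {a : (Dom n → Val M) × (Dom n → Tens n M) // IsCompetitor Ω D ζ a.1 a.2} :=
    ⟨⟨(0, 0), isCompetitor_zero⟩⟩
  exact le_ciInf fun a => h _ _ a.2

theorem exists_primal_lt {p : Dom n → Tens n M} {c : ℝ} (h : perturbedInf Ω D f F l ζ p < c) :
    ∃ w G, IsCompetitor Ω D ζ w G ∧ primal Ω D f F l ζ w (G + p) < c := by
  by_contra! hcon
  exact absurd (le_perturbedInf hcon) (not_le.2 h)

theorem perturbedInf_congr {p q : Dom n → Tens n M} (h : p =ᵐ[volume.restrict Ω] q) :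
    perturbedInf Ω D f F l ζ p = perturbedInf Ω D f F l ζ q := by
  refine iInf_congr fun a => ?_
  simp only [primal]
  congr 1
  refine integral_congr_ae ?_
  filter_upwards [h] with x hx
  simp [hx]

theorem primal_combine_le (hF : IsIntegrand F ν) (hl : 0 < l) (hζ : 1 < ζ)
    (hf : MemLp f (ENNReal.ofReal ζ) (volume.restrict (Ω \ D))) {v w : Dom n → Val M}
    (hv : MemLp v (ENNReal.ofReal ζ) (volume.restrict (Ω \ D)))
    (hw : MemLp w (ENNReal.ofReal ζ) (volume.restrict (Ω \ D)))
    {G H : Dom n → Tens n M} (hG : IntegrableOn G Ω) (hH : IntegrableOn H Ω)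
    {a b : ℝ} (ha : 0 ≤ a) (hb : 0 ≤ b) (hab : a + b = 1) :
    primal Ω D f F l ζ (a • v + b • w) (a • G + b • H) ≤
      a * primal Ω D f F l ζ v G + b * primal Ω D f F l ζ w H := by
  have h1 := dataTerm_convex (f := f) hl hζ hf hv hw ha hb hab
  have h2 : ∫ x in Ω, F ((a • G + b • H) x) ≤ ∫ x in Ω, (a * F (G x) + b * F (H x)) := by
    refine integral_mono (hF.integrable_comp ((hG.smul a).add (hH.smul b)))
      (((hF.integrable_comp hG).const_mul a).add ((hF.integrable_comp hH).const_mul b)) fun x => ?_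
    exact hF.convex.2 (mem_univ (G x)) (mem_univ (H x)) ha hb hab
  rw [integral_add ((hF.integrable_comp hG).const_mul a) ((hF.integrable_comp hH).const_mul b),
    integral_const_mul, integral_const_mul] at h2
  simp only [primal]
  linarith

/-- Partial minimization of a jointly convex functional: near-minimizers for `p` and `q` are
combined into a competitor for the combination. -/
theorem perturbedInf_convex (hF : IsIntegrand F ν) (hl : 0 < l) (hζ : 1 < ζ)
    (hf : MemLp f (ENNReal.ofReal ζ) (volume.restrict (Ω \ D))) {p q : Dom n → Tens n M}
    (hp : IntegrableOn p Ω) (hq : IntegrableOn q Ω)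
    {a b : ℝ} (ha : 0 ≤ a) (hb : 0 ≤ b) (hab : a + b = 1) :
    perturbedInf Ω D f F l ζ (a • p + b • q) ≤
      a * perturbedInf Ω D f F l ζ p + b * perturbedInf Ω D f F l ζ q := by
  refine le_of_forall_pos_le_add fun ε hε => ?_
  obtain ⟨v, G, hv, hvlt⟩ := exists_primal_lt
    (lt_add_of_pos_right (perturbedInf Ω D f F l ζ p) hε)
  obtain ⟨w, H, hw, hwlt⟩ := exists_primal_lt
    (lt_add_of_pos_right (perturbedInf Ω D f F l ζ q) hε)
  have h1 := perturbedInf_le (f := f) hF hl hζ (hv.combine hw a b) (a • p + b • q)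
  have h2 := primal_combine_le hF hl hζ hf hv.memLp hw.memLp (hv.isW11.integrable_grad.add hp)
    (hw.isW11.integrable_grad.add hq) ha hb hab
  have e : a • G + b • H + (a • p + b • q) = a • (G + p) + b • (H + q) := by
    rw [smul_add, smul_add]; abel
  rw [e] at h1
  have h3 := mul_le_mul_of_nonneg_left hvlt.le ha
  have h4 := mul_le_mul_of_nonneg_left hwlt.le hb
  have h5 : ε = a * ε + b * ε := by rw [← add_mul, hab, one_mul]
  linarith

/-- A near-minimizer for `p = 0` is kept, and `F` is `ν`-Lipschitz. This one-sided bound is all that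
a continuous subgradient requires. -/
theorem perturbedInf_le_add (hF : IsIntegrand F ν) (hl : 0 < l) (hζ : 1 < ζ)
    {p : Dom n → Tens n M} (hp : IntegrableOn p Ω) :
    perturbedInf Ω D f F l ζ p ≤ perturbedInf Ω D f F l ζ 0 + ν * ∫ x in Ω, ‖p x‖ := by
  refine le_of_forall_pos_le_add fun ε hε => ?_
  obtain ⟨v, G, hv, hvlt⟩ := exists_primal_lt
    (lt_add_of_pos_right (perturbedInf Ω D f F l ζ 0) hε)
  have h1 := perturbedInf_le (f := f) hF hl hζ hv p
  rw [add_zero] at hvlt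
  have hG := hv.isW11.integrable_grad
  have h2 : ∫ x in Ω, F ((G + p) x) ≤ ∫ x in Ω, (F (G x) + ν * ‖p x‖) := by
    refine integral_mono (hF.integrable_comp (hG.add hp))
      ((hF.integrable_comp hG).add (hp.norm.const_mul ν)) fun x => ?_
    have := (le_abs_self _).trans (hF.abs_sub_le (G x + p x) (G x))
    rw [add_sub_cancel_left] at this
    simp only [Pi.add_apply]
    linarith
  rw [integral_add (hF.integrable_comp hG) (hp.norm.const_mul ν), integral_const_mul] at h2
  simp only [primal] at *
  linarith

/-- The perturbed infimum has a subgradient at the origin in `L^∞`. -/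
theorem exists_multiplier [IsFiniteMeasure (volume.restrict Ω)] (hF : IsIntegrand F ν)
    (hl : 0 < l) (hζ : 1 < ζ) (hf : MemLp f (ENNReal.ofReal ζ) (volume.restrict (Ω \ D))) :
    ∃ σ : Lp (Tens n M) ∞ (volume.restrict Ω), ∀ p : Dom n → Tens n M, IntegrableOn p Ω →
      perturbedInf Ω D f F l ζ 0 + ∫ x in Ω, ⟪σ x, p x⟫ ≤ perturbedInf Ω D f F l ζ p := by
  -- `perturbedInf` does not see null sets, so it can be treated as a convex function on the Banach
  -- space `L¹`.
  set Φ : Lp (Tens n M) 1 (volume.restrict Ω) → ℝ := fun p => perturbedInf Ω D f F l ζ p with hΦ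
  have hi : ∀ p : Lp (Tens n M) 1 (volume.restrict Ω), IntegrableOn p Ω := fun p =>
    L1.integrable_coeFn p
  have h0 : Φ 0 = perturbedInf Ω D f F l ζ 0 := perturbedInf_congr (Lp.coeFn_zero _ _ _)
  obtain ⟨Λ, hΛ⟩ := exists_subgradient_zero (Φ := Φ) (ν := ν)
    ⟨convex_univ, fun p _ q _ a b ha hb hab => by
      have h1 := perturbedInf_convex (f := f) hF hl hζ hf (hi p) (hi q) ha hb hab
      have h2 : Φ (a • p + b • q) = perturbedInf Ω D f F l ζ (a • ⇑p + b • ⇑q) := by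
        refine perturbedInf_congr ?_
        filter_upwards [Lp.coeFn_add (a • p) (b • q), Lp.coeFn_smul a p, Lp.coeFn_smul b q]
          with x h1 h2 h3
        rw [h1, Pi.add_apply, Pi.add_apply, h2, h3]
      rw [h2]
      exact h1⟩ fun p => by
      rw [h0, L1.norm_eq_integral_norm]
      exact perturbedInf_le_add hF hl hζ (hi p)
  obtain ⟨σ, hσ⟩ := exists_Linfty_representation Λ
  refine ⟨σ, fun p hp => ?_⟩
  have h1 := hΛ (hp.toL1 p)
  have h2 : Φ (hp.toL1 p) = perturbedInf Ω D f F l ζ p := perturbedInf_congr hp.coeFn_toL1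
  have h3 : Λ (hp.toL1 p) = ∫ x in Ω, ⟪σ x, p x⟫ := by
    rw [hσ]
    refine integral_congr_ae ?_
    filter_upwards [hp.coeFn_toL1] with x hx
    rw [hx]
  rwa [h0, h2, h3] at h1

end Duality

end Inpainting

/-! ### Weak and strong duality. -/

namespace Inpainting

variable {n M : ℕ} {Ω D : Set (Dom n)} {f : Dom n → Val M} {F : Tens n M → ℝ} {l ζ ν : ℝ}

theorem integrable_inner_Linfty (κ : Lp (Tens n M) ∞ (volume.restrict Ω)) {G : Dom n → Tens n M}
    (hG : IntegrableOn G Ω) : IntegrableOn (fun x => ⟪κ x, G x⟫) Ω := by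
  have hκ : ∀ᵐ x ∂(volume.restrict Ω), ‖κ x‖ ≤ ‖κ‖ := by
    filter_upwards [ae_le_eLpNormEssSup (f := κ) (μ := volume.restrict Ω)] with x hx
    rw [Lp.norm_def, eLpNorm_exponent_top, ← toReal_enorm]
    refine ENNReal.toReal_mono ?_ hx
    rw [← eLpNorm_exponent_top]
    exact Lp.eLpNorm_ne_top κ
  refine (hG.norm.const_mul ‖κ‖).mono' ((Lp.aestronglyMeasurable κ).inner hG.1) ?_
  filter_upwards [hκ] with x hx
  exact (norm_inner_le_norm _ _).trans (mul_le_mul_of_nonneg_right hx (norm_nonneg _))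

theorem measurable_toENNReal_conj (hF : IsIntegrand F ν) (κ : Lp (Tens n M) ∞ (volume.restrict Ω)) :
    Measurable fun x => (conj F (κ x)).toENNReal :=
  measurable_ereal_toENNReal.comp (hF.measurable_conj.comp (Lp.stronglyMeasurable κ).measurable)

/-- The defect in the Fenchel–Young inequality. -/
noncomputable def fenchelGap (F : Tens n M → ℝ) (Q P : Tens n M) : ℝ :=
  F P + (conj F Q).toENNReal.toReal - ⟪Q, P⟫

theorem IsIntegrand.fenchelGap_nonneg (hF : IsIntegrand F ν) {Q : Tens n M}
    (hQ : (conj F Q).toENNReal ≠ ∞) (P : Tens n M) : 0 ≤ fenchelGap F Q P := by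
  have := hF.inner_le_add_toReal hQ P
  rw [fenchelGap]
  linarith

section Finite

variable {κ : Lp (Tens n M) ∞ (volume.restrict Ω)}

theorem ae_conj_ne_top (hF : IsIntegrand F ν)
    (hfin : ∫⁻ x in Ω, (conj F (κ x)).toENNReal ≠ ∞) :
    ∀ᵐ x ∂(volume.restrict Ω), (conj F (κ x)).toENNReal ≠ ∞ := by
  filter_upwards [ae_lt_top (measurable_toENNReal_conj hF κ) hfin] with x hx using hx.ne

theorem integrable_conj (hF : IsIntegrand F ν)
    (hfin : ∫⁻ x in Ω, (conj F (κ x)).toENNReal ≠ ∞) :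
    IntegrableOn (fun x => (conj F (κ x)).toENNReal.toReal) Ω :=
  integrable_toReal_of_lintegral_ne_top (measurable_toENNReal_conj hF κ).aemeasurable hfin

theorem integrable_fenchelGap (hF : IsIntegrand F ν)
    (hfin : ∫⁻ x in Ω, (conj F (κ x)).toENNReal ≠ ∞) {G : Dom n → Tens n M}
    (hG : IntegrableOn G Ω) : IntegrableOn (fun x => fenchelGap F (κ x) (G x)) Ω :=
  ((hF.integrable_comp hG).add (integrable_conj hF hfin)).sub (integrable_inner_Linfty κ hG)

theorem integral_fenchelGap (hF : IsIntegrand F ν)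
    (hfin : ∫⁻ x in Ω, (conj F (κ x)).toENNReal ≠ ∞) {G : Dom n → Tens n M}
    (hG : IntegrableOn G Ω) :
    ∫ x in Ω, fenchelGap F (κ x) (G x) = (∫ x in Ω, F (G x)) +
      (∫⁻ x in Ω, (conj F (κ x)).toENNReal).toReal - ∫ x in Ω, ⟪κ x, G x⟫ := by
  have h1 := hF.integrable_comp hG
  have h2 := integrable_conj hF hfin
  have h3 := integrable_inner_Linfty κ hG
  have e : ∫ x in Ω, fenchelGap F (κ x) (G x) =
      (∫ x in Ω, (F (G x) + (conj F (κ x)).toENNReal.toReal)) - ∫ x in Ω, ⟪κ x, G x⟫ :=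
    integral_sub (h1.add h2) h3
  rw [e, integral_add h1 h2, integral_toReal (measurable_toENNReal_conj hF κ).aemeasurable]
  filter_upwards [ae_conj_ne_top hF hfin] with x hx using hx.lt_top

theorem lagrangian_eq (hfin : ∫⁻ x in Ω, (conj F (κ x)).toENNReal ≠ ∞) (w : Dom n → Val M)
    (G : Dom n → Tens n M) :
    lagrangian Ω D f F l ζ w G κ = ((∫ x in Ω, ⟪κ x, G x⟫) -
      (∫⁻ x in Ω, (conj F (κ x)).toENNReal).toReal + dataTerm Ω D f l ζ w : ℝ) := by
  rw [lagrangian]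
  nth_rewrite 1 [← ENNReal.ofReal_toReal hfin]
  rw [EReal.coe_ennreal_ofReal, max_eq_left ENNReal.toReal_nonneg]
  norm_cast

/-- In extended real arithmetic a real number minus `⊤` is `⊥`, and adding the real data term leaves
`⊥`. -/
theorem lagrangian_eq_bot (hfin : ∫⁻ x in Ω, (conj F (κ x)).toENNReal = ∞) (w : Dom n → Val M)
    (G : Dom n → Tens n M) : lagrangian Ω D f F l ζ w G κ = ⊥ := by
  rw [lagrangian, hfin]
  simp

end Finite

/-- If `∫ F^*(κ)` is finite, the difference of the two sides is the integral of the Fenchel–Young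
gap; otherwise the Lagrangian is `⊥`. -/
theorem lagrangian_le_primal (hF : IsIntegrand F ν) (κ : Lp (Tens n M) ∞ (volume.restrict Ω))
    {w : Dom n → Val M} {G : Dom n → Tens n M} (hG : IntegrableOn G Ω) :
    lagrangian Ω D f F l ζ w G κ ≤ (primal Ω D f F l ζ w G : ℝ) := by
  by_cases hfin : ∫⁻ x in Ω, (conj F (κ x)).toENNReal = ∞
  · rw [lagrangian_eq_bot hfin]; exact bot_le
  rw [lagrangian_eq hfin, EReal.coe_le_coe_iff, primal]
  have h1 : 0 ≤ ∫ x in Ω, fenchelGap F (κ x) (G x) := by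
    refine integral_nonneg_of_ae ?_
    filter_upwards [ae_conj_ne_top hF hfin] with x hx using hF.fenchelGap_nonneg hx _
  rw [integral_fenchelGap hF hfin hG] at h1
  linarith

theorem R_le_lagrangian {w : Dom n → Val M} {G : Dom n → Tens n M} (h : IsCompetitor Ω D ζ w G)
    (κ : Dom n → Tens n M) : R Ω D f F l ζ κ ≤ lagrangian Ω D f F l ζ w G κ :=
  iInf_le_of_le w <| iInf_le_of_le G <| iInf_le_of_le h.isW11 <| iInf_le_of_le h.memLp le_rfl

/-- Weak duality. -/
theorem R_le_perturbedInf (hF : IsIntegrand F ν) (κ : Lp (Tens n M) ∞ (volume.restrict Ω)) :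
    R Ω D f F l ζ κ ≤ (perturbedInf Ω D f F l ζ 0 : ℝ) := by
  have h : ∀ w G, IsCompetitor Ω D ζ w G → R Ω D f F l ζ κ ≤ (primal Ω D f F l ζ w G : ℝ) :=
    fun w G hw => (R_le_lagrangian hw κ).trans (lagrangian_le_primal hF κ hw.isW11.integrable_grad)
  induction hR : R Ω D f F l ζ κ with
  | bot => exact bot_le
  -- The zero competitor has real energy, which excludes `⊤`.
  | top => have := h 0 0 isCompetitor_zero; rw [hR] at this; simp at this
  | coe r =>
    rw [EReal.coe_le_coe_iff]
    refine le_perturbedInf fun w G hw => ?_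
    have := h w G hw
    rw [hR, EReal.coe_le_coe_iff] at this
    rwa [add_zero]

/-- Strong duality, with attainment in the dual problem. -/
theorem exists_perturbedInf_le_R [IsFiniteMeasure (volume.restrict Ω)] (hF : IsIntegrand F ν)
    (hl : 0 < l) (hζ : 1 < ζ) (hf : MemLp f (ENNReal.ofReal ζ) (volume.restrict (Ω \ D))) :
    ∃ σ : Lp (Tens n M) ∞ (volume.restrict Ω),
      ((perturbedInf Ω D f F l ζ 0 : ℝ) : EReal) ≤ R Ω D f F l ζ σ := by
  obtain ⟨σ, hσ⟩ := exists_multiplier (D := D) hF hl hζ hf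
  refine ⟨σ, ?_⟩
  have hσi : IntegrableOn σ Ω :=
    memLp_one_iff_integrable.1 ((Lp.memLp σ).mono_exponent le_top)
  -- The perturbation `q - G` moves the gradient of `w` to an arbitrary field `q`, independent of
  -- `w`; the supremum over `q` then produces `∫ F^*(σ)`.
  have key : ∀ w G, IsCompetitor Ω D ζ w G → ∀ q : Dom n → Tens n M, IntegrableOn q Ω →
      ∫ x in Ω, (⟪σ x, q x⟫ - F (q x)) ≤
        (∫ x in Ω, ⟪σ x, G x⟫) + dataTerm Ω D f l ζ w - perturbedInf Ω D f F l ζ 0 := by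
    intro w G hw q hq
    have hG := hw.isW11.integrable_grad
    have h1 := hσ (q - G) (hq.sub hG)
    have h2 := perturbedInf_le (f := f) hF hl hζ hw (q - G)
    rw [add_sub_cancel] at h2
    have h3 : ∫ x in Ω, ⟪σ x, (q - G) x⟫ = (∫ x in Ω, ⟪σ x, q x⟫) - ∫ x in Ω, ⟪σ x, G x⟫ := by
      rw [← integral_sub (integrable_inner_Linfty σ hq) (integrable_inner_Linfty σ hG)]
      simp only [Pi.sub_apply, inner_sub_right]
    rw [integral_sub (integrable_inner_Linfty σ hq) (hF.integrable_comp hq)]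
    rw [primal] at h2
    linarith
  refine le_iInf fun w => le_iInf fun G => le_iInf fun hW => le_iInf fun hL => ?_
  have hw : IsCompetitor Ω D ζ w G := ⟨hW, hL⟩
  have h1 := hF.lintegral_conj_le (Lp.stronglyMeasurable σ) hσi (key w G hw)
  -- The choice `q = 0` shows that the bound is nonnegative, as needed to leave `ENNReal.ofReal`.
  have h2 : 0 ≤ (∫ x in Ω, ⟪σ x, G x⟫) + dataTerm Ω D f l ζ w - perturbedInf Ω D f F l ζ 0 := by
    have := key w G hw 0 (integrable_zero _ _ _)
    simpa [hF.zero] using this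
  have hfin := ne_top_of_le_ne_top ENNReal.ofReal_ne_top h1
  rw [lagrangian_eq hfin, EReal.coe_le_coe_iff]
  have h3 := ENNReal.toReal_le_of_le_ofReal h2 h1
  linarith

/-- Some field reaches the primal infimum, so every maximizer does. Dual optimality is used only in
this form afterwards. -/
theorem IsDualSolution.perturbedInf_le_R [IsFiniteMeasure (volume.restrict Ω)]
    (hF : IsIntegrand F ν) (hl : 0 < l) (hζ : 1 < ζ)
    (hf : MemLp f (ENNReal.ofReal ζ) (volume.restrict (Ω \ D)))
    {σ : Lp (Tens n M) ∞ (volume.restrict Ω)} (hσ : IsDualSolution Ω D f F l ζ σ) :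
    ((perturbedInf Ω D f F l ζ 0 : ℝ) : EReal) ≤ R Ω D f F l ζ σ := by
  obtain ⟨τ, hτ⟩ := exists_perturbedInf_le_R (D := D) hF hl hζ hf
  exact hτ.trans (hσ τ)

/-! ### Optimality along minimizing sequences and uniqueness. -/

section Optimal

variable {σ : Lp (Tens n M) ∞ (volume.restrict Ω)}

theorem conj_finite_of_perturbedInf_le_R
    (hσ : ((perturbedInf Ω D f F l ζ 0 : ℝ) : EReal) ≤ R Ω D f F l ζ σ) :
    ∫⁻ x in Ω, (conj F (σ x)).toENNReal ≠ ∞ := fun h => by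
  have := hσ.trans (R_le_lagrangian isCompetitor_zero σ)
  rw [lagrangian_eq_bot h] at this
  simp at this

/-- The integrated gap is the primal energy minus the Lagrangian, and `R[σ]`, hence the Lagrangian,
is at least the primal infimum. -/
theorem integral_fenchelGap_le (hF : IsIntegrand F ν)
    (hσ : ((perturbedInf Ω D f F l ζ 0 : ℝ) : EReal) ≤ R Ω D f F l ζ σ)
    {w : Dom n → Val M} {G : Dom n → Tens n M} (hw : IsCompetitor Ω D ζ w G) :
    ∫ x in Ω, fenchelGap F (σ x) (G x) ≤
      primal Ω D f F l ζ w G - perturbedInf Ω D f F l ζ 0 := by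
  have hfin := conj_finite_of_perturbedInf_le_R hσ
  have h1 := hσ.trans (R_le_lagrangian hw σ)
  rw [lagrangian_eq hfin, EReal.coe_le_coe_iff] at h1
  rw [integral_fenchelGap hF hfin hw.isW11.integrable_grad, primal]
  linarith

/-- Along a minimizing sequence the Fenchel–Young gap tends to zero almost everywhere, up to a
subsequence. -/
theorem exists_subseq_fenchelGap_tendsto (hF : IsIntegrand F ν)
    (hσ : ((perturbedInf Ω D f F l ζ 0 : ℝ) : EReal) ≤ R Ω D f F l ζ σ)
    {w : ℕ → Dom n → Val M} {G : ℕ → Dom n → Tens n M}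
    (hw : ∀ k, IsCompetitor Ω D ζ (w k) (G k))
    (hlim : Tendsto (fun k => primal Ω D f F l ζ (w k) (G k)) atTop
      (𝓝 (perturbedInf Ω D f F l ζ 0))) :
    ∃ ns : ℕ → ℕ, StrictMono ns ∧ ∀ᵐ x ∂(volume.restrict Ω),
      Tendsto (fun k => fenchelGap F (σ x) (G (ns k) x)) atTop (𝓝 0) := by
  have hfin := conj_finite_of_perturbedInf_le_R hσ
  have hi := fun k => integrable_fenchelGap hF hfin (hw k).isW11.integrable_grad
  have hnn : ∀ k, 0 ≤ᵐ[volume.restrict Ω] fun x => fenchelGap F (σ x) (G k x) := fun k => by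
    filter_upwards [ae_conj_ne_top hF hfin] with x hx using hF.fenchelGap_nonneg hx _
  have h0 : Tendsto (fun k => ∫ x in Ω, fenchelGap F (σ x) (G k x)) atTop (𝓝 0) := by
    refine squeeze_zero (fun k => integral_nonneg_of_ae (hnn k))
      (fun k => integral_fenchelGap_le hF hσ (hw k)) ?_
    simpa using hlim.sub_const (perturbedInf Ω D f F l ζ 0)
  have h1 : Tendsto (fun k => eLpNorm ((fun x => fenchelGap F (σ x) (G k x)) - 0) 1
      (volume.restrict Ω)) atTop (𝓝 0) := by
    have : (fun k => eLpNorm ((fun x => fenchelGap F (σ x) (G k x)) - 0) 1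
      (volume.restrict Ω)) = fun k => ENNReal.ofReal (∫ x in Ω, fenchelGap F (σ x) (G k x)) := by
      funext k
      rw [sub_zero, eLpNorm_one_eq_lintegral_enorm,
        ofReal_integral_eq_lintegral_ofReal (hi k) (hnn k)]
      refine lintegral_congr_ae ?_
      filter_upwards [hnn k] with x hx
      rw [← ofReal_norm, Real.norm_of_nonneg hx]
    rw [this]
    simpa using ENNReal.tendsto_ofReal h0
  exact (tendstoInMeasure_of_tendsto_eLpNorm one_ne_zero (fun k => (hi k).1)
    aestronglyMeasurable_zero h1).exists_seq_tendsto_ae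

/-- If the Fenchel–Young gap tends to zero along `P k → P`, then `Q = DF(P)`. -/
theorem IsIntegrand.eq_gradient_of_tendsto (hF : IsIntegrand F ν) {Q : Tens n M}
    (hQ : (conj F Q).toENNReal ≠ ∞) {P : ℕ → Tens n M} {P₀ : Tens n M}
    (hP : Tendsto P atTop (𝓝 P₀)) (h : Tendsto (fun k => fenchelGap F Q (P k)) atTop (𝓝 0)) :
    Q = gradient F P₀ := by
  have h1 : Tendsto (fun k => fenchelGap F Q (P k)) atTop (𝓝 (fenchelGap F Q P₀)) :=
    (((hF.continuous.tendsto P₀).comp hP).add_const _).sub (tendsto_const_nhds.inner hP)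
  have h2 := tendsto_nhds_unique h1 h
  refine hF.eq_gradient_of_eq hQ ?_
  rw [fenchelGap] at h2
  linarith

end Optimal

theorem exists_minimizing_seq (Ω D : Set (Dom n)) (f : Dom n → Val M) (F : Tens n M → ℝ) (l ζ : ℝ)
    (hF : IsIntegrand F ν) (hl : 0 < l) (hζ : 1 < ζ) :
    ∃ (w : ℕ → Dom n → Val M) (G : ℕ → Dom n → Tens n M), (∀ k, IsCompetitor Ω D ζ (w k) (G k)) ∧
      Tendsto (fun k => primal Ω D f F l ζ (w k) (G k)) atTop
        (𝓝 (perturbedInf Ω D f F l ζ 0)) := by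
  have h : ∀ k : ℕ, ∃ w G, IsCompetitor Ω D ζ w G ∧ primal Ω D f F l ζ w (G + 0) <
      perturbedInf Ω D f F l ζ 0 + 1 / ((k : ℝ) + 1) := fun k =>
    exists_primal_lt (lt_add_of_pos_right _ Nat.one_div_pos_of_nat)
  choose w G hw hlt using h
  refine ⟨w, G, hw, tendsto_of_tendsto_of_tendsto_of_le_of_le tendsto_const_nhds
    (h := fun k : ℕ => perturbedInf Ω D f F l ζ 0 + 1 / ((k : ℝ) + 1)) ?_ (fun k => ?_) fun k => ?_⟩
  · simpa using tendsto_one_div_add_atTop_nhds_zero_nat.const_add (perturbedInf Ω D f F l ζ 0)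
  · simpa using perturbedInf_le (f := f) hF hl hζ (hw k) 0
  · simpa using (hlt k).le

/-- A sequence that is bounded in `L¹` is bounded at almost every point along a subsequence
depending on the point. -/
theorem ae_exists_frequently_norm_le {X E : Type*} [MeasurableSpace X] {μ : Measure X}
    [NormedAddCommGroup E] {G : ℕ → X → E} (hG : ∀ k, Integrable (G k) μ) {C : ℝ}
    (hC : ∀ k, ∫ x, ‖G k x‖ ∂μ ≤ C) : ∀ᵐ x ∂μ, ∃ r : ℝ, ∃ᶠ k in atTop, ‖G k x‖ ≤ r := by
  have hm : ∀ k, AEMeasurable (fun x => ‖G k x‖ₑ) μ := fun k => (hG k).1.enorm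
  -- Fatou's lemma: the lower limit of the norms has finite integral, so it is finite almost
  -- everywhere.
  have h1 : ∫⁻ x, liminf (fun k => ‖G k x‖ₑ) atTop ∂μ ≤ ENNReal.ofReal C := by
    refine (lintegral_liminf_le' hm).trans (liminf_le_of_le (by isBoundedDefault) fun b hb => ?_)
    obtain ⟨k, hk⟩ := hb.exists
    refine hk.trans ?_
    rw [← ofReal_integral_norm_eq_lintegral_enorm (hG k)]
    exact ENNReal.ofReal_le_ofReal (hC k)
  have hl : AEMeasurable (fun x => liminf (fun k => ‖G k x‖ₑ) atTop) μ := by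
    refine ⟨fun x => liminf (fun k => (hm k).mk _ x) atTop,
      Measurable.liminf fun k => (hm k).measurable_mk, ?_⟩
    filter_upwards [ae_all_iff.2 fun k => (hm k).ae_eq_mk] with x hx
    simp only [hx]
  filter_upwards [ae_lt_top' hl (ne_top_of_le_ne_top ENNReal.ofReal_ne_top h1)]
    with x hx
  obtain ⟨r, hr, hr'⟩ := ENNReal.lt_iff_exists_nnreal_btwn.1 hx
  refine ⟨r, (frequently_lt_of_liminf_lt (by isBoundedDefault) hr).mono fun k hk => ?_⟩
  rw [← ofReal_norm] at hk
  have := (ENNReal.ofReal_lt_coe_iff (norm_nonneg _)).1 hk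
  exact this.le

/-- Uniqueness of the dual solution. -/
theorem eq_of_perturbedInf_le_R [IsFiniteMeasure (volume.restrict Ω)] (hF : IsIntegrand F ν)
    (hl : 0 < l) (hζ : 1 < ζ) {ν₂ ν₃ : ℝ} (hν₂ : 0 < ν₂)
    (hgrowth : ∀ P, ν₂ * ‖P‖ - ν₃ ≤ F P) {σ τ : Lp (Tens n M) ∞ (volume.restrict Ω)}
    (hσ : ((perturbedInf Ω D f F l ζ 0 : ℝ) : EReal) ≤ R Ω D f F l ζ σ)
    (hτ : ((perturbedInf Ω D f F l ζ 0 : ℝ) : EReal) ≤ R Ω D f F l ζ τ) : τ = σ := by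
  obtain ⟨w, G, hw, hlim⟩ := exists_minimizing_seq Ω D f F l ζ hF hl hζ
  obtain ⟨ns, hns, h1⟩ := exists_subseq_fenchelGap_tendsto hF hσ hw hlim
  -- The second subsequence is extracted from the first, so that both gaps vanish along the same
  -- gradients.
  obtain ⟨ms, hms, h2⟩ := exists_subseq_fenchelGap_tendsto hF hτ (fun k => hw (ns k))
    (hlim.comp hns.tendsto_atTop)
  obtain ⟨B, hB⟩ := hlim.bddAbove_range
  have hbd : ∀ k, ∫ x in Ω, ‖G (ns (ms k)) x‖ ≤
      (B + ν₃ * (volume.restrict Ω).real univ) / ν₂ := by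
    intro k
    have hG := (hw (ns (ms k))).isW11.integrable_grad
    have h3 : primal Ω D f F l ζ (w (ns (ms k))) (G (ns (ms k))) ≤ B := hB ⟨_, rfl⟩
    have h4 : ∫ x in Ω, (ν₂ * ‖G (ns (ms k)) x‖ - ν₃) ≤ ∫ x in Ω, F (G (ns (ms k)) x) :=
      integral_mono ((hG.norm.const_mul ν₂).sub (integrable_const _)) (hF.integrable_comp hG)
        fun x => hgrowth _
    rw [integral_sub (hG.norm.const_mul ν₂) (integrable_const _), integral_const_mul,
      integral_const, smul_eq_mul] at h4
    have h5 := dataTerm_nonneg (Ω := Ω) (D := D) (f := f) hl hζ (w (ns (ms k)))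
    rw [primal] at h3
    rw [le_div_iff₀ hν₂]
    linarith
  have h3 := ae_exists_frequently_norm_le (fun k => (hw (ns (ms k))).isW11.integrable_grad) hbd
  ext1
  filter_upwards [h1, h2, h3, ae_conj_ne_top hF (conj_finite_of_perturbedInf_le_R hσ),
    ae_conj_ne_top hF (conj_finite_of_perturbedInf_le_R hτ)] with x h1 h2 ⟨r, hr⟩ hc1 hc2
  -- The subsequence and the limit `P` depend on `x`. No measurability in `x` is needed, since `P`
  -- only serves to compare `σ x` with `τ x`.
  obtain ⟨P, -, φ, hφ, hP⟩ := tendsto_subseq_of_frequently_bounded (s := Metric.closedBall 0 r)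
    Metric.isBounded_closedBall (x := fun k => G (ns (ms k)) x)
    (hr.mono fun k hk => mem_closedBall_zero_iff.2 hk)
  rw [hF.eq_gradient_of_tendsto hc1 hP
      ((h1.comp hms.tendsto_atTop).comp hφ.tendsto_atTop),
    hF.eq_gradient_of_tendsto hc2 hP (h2.comp hφ.tendsto_atTop)]

/-- A dual solution is determined by the limit in measure of the gradients of a minimizing
sequence. -/
theorem eq_gradient_of_tendstoInMeasure (hF : IsIntegrand F ν)
    {σ : Lp (Tens n M) ∞ (volume.restrict Ω)}
    (hσ : ((perturbedInf Ω D f F l ζ 0 : ℝ) : EReal) ≤ R Ω D f F l ζ σ)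
    {w : ℕ → Dom n → Val M} {G : ℕ → Dom n → Tens n M}
    (hw : ∀ k, IsCompetitor Ω D ζ (w k) (G k))
    (hlim : Tendsto (fun k => primal Ω D f F l ζ (w k) (G k)) atTop
      (𝓝 (perturbedInf Ω D f F l ζ 0))) {a : Dom n → Tens n M}
    (ha : TendstoInMeasure (volume.restrict Ω) G atTop a) :
    ∀ᵐ x ∂(volume.restrict Ω), σ x = gradient F (a x) := by
  obtain ⟨ns, hns, h1⟩ := ha.exists_seq_tendsto_ae
  obtain ⟨ms, hms, h2⟩ := exists_subseq_fenchelGap_tendsto hF hσ (fun k => hw (ns k))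
    (hlim.comp hns.tendsto_atTop)
  filter_upwards [h1, h2, ae_conj_ne_top hF (conj_finite_of_perturbedInf_le_R hσ)] with x h1 h2 hc
  exact hF.eq_gradient_of_tendsto hc (h1.comp hms.tendsto_atTop) h2

end Inpainting

/-! ### Mollification -/

namespace Inpainting

section Mollification

variable {n : ℕ} {E : Type*} [NormedAddCommGroup E] [NormedSpace ℝ E]

/-- The mollification kernel associated with a bump function. -/
noncomputable def kernel (b : ContDiffBump (0 : Dom n)) (x y : Dom n) : ℝ :=
  b.normed volume (x - y)

theorem kernel_nonneg (b : ContDiffBump (0 : Dom n)) (x y : Dom n) : 0 ≤ kernel b x y :=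
  b.nonneg_normed _

theorem continuous_kernel (b : ContDiffBump (0 : Dom n)) :
    Continuous fun p : Dom n × Dom n => kernel b p.1 p.2 :=
  b.continuous_normed.comp (continuous_fst.sub continuous_snd)

theorem kernel_eq_zero {b : ContDiffBump (0 : Dom n)} {x y : Dom n} (h : b.rOut ≤ dist x y) :
    kernel b x y = 0 := by
  by_contra hne
  have : x - y ∈ Function.support (b.normed (volume : Measure (Dom n))) := hne
  rw [b.support_normed_eq, mem_ball_zero_iff, ← dist_eq_norm] at this
  exact absurd this (not_lt.2 h)

theorem lintegral_kernel (b : ContDiffBump (0 : Dom n)) (y : Dom n) :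
    ∫⁻ x, ENNReal.ofReal (kernel b x y) = 1 := by
  have h1 : ∫⁻ x, ENNReal.ofReal (kernel b x y) =
      ∫⁻ x, ENNReal.ofReal (b.normed volume x) :=
    lintegral_sub_right_eq_self (fun x => ENNReal.ofReal (b.normed volume x)) y
  rw [h1, ← ofReal_integral_eq_lintegral_ofReal b.integrable_normed
    (ae_of_all _ b.nonneg_normed), b.integral_normed, ENNReal.ofReal_one]

theorem exists_kernel_le (b : ContDiffBump (0 : Dom n)) : ∃ C, ∀ x y, ‖kernel b x y‖ ≤ C := by
  obtain ⟨C, hC⟩ := b.hasCompactSupport_normed (μ := volume).exists_bound_of_continuous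
    b.continuous_normed
  exact ⟨C, fun x y => hC _⟩

/-- Mollification. -/
noncomputable def moll (b : ContDiffBump (0 : Dom n)) (g : Dom n → E) (x : Dom n) : E :=
  ∫ y, kernel b x y • g y

theorem moll_eq_convolution (b : ContDiffBump (0 : Dom n)) (g : Dom n → E) :
    moll b g = convolution (b.normed volume) g (ContinuousLinearMap.lsmul ℝ ℝ) volume := by
  funext x
  rw [convolution_eq_swap]; rfl

theorem integrable_kernel_smul {ν : Measure (Dom n)} (b : ContDiffBump (0 : Dom n)) {g : Dom n → E}
    (hg : Integrable g ν) (x : Dom n) : Integrable (fun y => kernel b x y • g y) ν := by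
  obtain ⟨C, hC⟩ := exists_kernel_le b
  exact hg.bdd_smul C ((continuous_kernel b).comp (Continuous.prodMk_right x)).aestronglyMeasurable
    (ae_of_all _ fun y => hC x y)

theorem lintegral_lintegral_kernel {ν : Measure (Dom n)} [SFinite ν]
    (b : ContDiffBump (0 : Dom n)) {g : Dom n → ℝ≥0∞} (hg : AEMeasurable g ν) :
    ∫⁻ x, ∫⁻ y, ENNReal.ofReal (kernel b x y) * g y ∂ν = ∫⁻ y, g y ∂ν := by
  rw [lintegral_lintegral_swap]
  · refine lintegral_congr fun y => ?_
    have hm : Measurable fun x => ENNReal.ofReal (kernel b x y) :=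
      ((continuous_kernel b).comp (Continuous.prodMk_left y)).measurable.ennreal_ofReal
    rw [lintegral_mul_const _ hm, lintegral_kernel, one_mul]
  · exact ((continuous_kernel b).measurable.ennreal_ofReal.aemeasurable).mul hg.comp_snd

theorem lintegral_enorm_moll_le (b : ContDiffBump (0 : Dom n)) {g : Dom n → E}
    (hg : Integrable g) : ∫⁻ x, ‖moll b g x‖ₑ ≤ ∫⁻ x, ‖g x‖ₑ := by
  rw [← lintegral_lintegral_kernel b hg.1.enorm]
  refine lintegral_mono fun x => (enorm_integral_le_lintegral_enorm _).trans ?_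
  refine lintegral_mono fun y => ?_
  simp only [enorm_smul]
  rw [Real.enorm_of_nonneg (kernel_nonneg b x y)]

theorem moll_sub (b : ContDiffBump (0 : Dom n)) {g h : Dom n → E} (hg : Integrable g)
    (hh : Integrable h) (x : Dom n) : moll b (g - h) x = moll b g x - moll b h x := by
  simp only [moll, Pi.sub_apply, smul_sub]
  exact integral_sub (integrable_kernel_smul b hg x) (integrable_kernel_smul b hh x)

theorem continuous_moll [CompleteSpace E] (b : ContDiffBump (0 : Dom n)) {g : Dom n → E}
    (hg : Integrable g) : Continuous (moll b g) := by
  rw [moll_eq_convolution]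
  exact b.hasCompactSupport_normed.continuous_convolution_left _ b.continuous_normed
    hg.locallyIntegrable

/-- Uniform continuity makes the difference uniformly small, and for radii below `1` it is supported
in a fixed compact neighbourhood of the support of `h`. -/
theorem exists_lintegral_moll_sub_le_of_continuous [CompleteSpace E] {h : Dom n → E}
    (hc : Continuous h)
    (hs : HasCompactSupport h) {ε : ℝ≥0∞} (hε : ε ≠ 0) :
    ∃ δ > 0, ∀ b : ContDiffBump (0 : Dom n), b.rOut < δ → ∫⁻ x, ‖moll b h x - h x‖ₑ ≤ ε := by
  set S := Metric.cthickening 1 (tsupport h) with hS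
  have hSc : IsCompact S := hs.isCompact.cthickening
  have hSfin : volume S ≠ ∞ := hSc.measure_lt_top.ne
  obtain ⟨η, hη, hηε⟩ : ∃ η : ℝ, 0 < η ∧ ENNReal.ofReal η * volume S ≤ ε := by
    obtain ⟨η, hη, h⟩ := ENNReal.exists_nnreal_pos_mul_lt hSfin hε
    exact ⟨η, hη, by rw [ENNReal.ofReal_coe_nnreal]; exact h.le⟩
  obtain ⟨δ, hδ, hδη⟩ := Metric.uniformContinuous_iff.1 (hs.uniformContinuous_of_continuous hc) η hη
  refine ⟨min δ 1, lt_min hδ one_pos, fun b hb => ?_⟩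
  have hpt : ∀ x, ‖moll b h x - h x‖ₑ ≤ S.indicator (fun _ => ENNReal.ofReal η) x := by
    intro x
    by_cases hx : x ∈ S
    · rw [indicator_of_mem hx, ← ofReal_norm, ← dist_eq_norm, moll_eq_convolution]
      refine ENNReal.ofReal_le_ofReal ?_
      refine b.dist_normed_convolution_le hc.aestronglyMeasurable fun y hy => (hδη ?_).le
      exact lt_of_lt_of_le (Metric.mem_ball.1 hy) (hb.le.trans (min_le_left _ _))
    · have hz : ∀ y, dist y x < 1 → h y = 0 := fun y hy => by
        refine image_eq_zero_of_notMem_tsupport fun hmem => hx ?_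
        exact Metric.mem_cthickening_of_dist_le x y 1 _ hmem (by rw [dist_comm]; exact hy.le)
      have hm : moll b h x = 0 := by
        refine integral_eq_zero_of_ae (ae_of_all _ fun y => ?_)
        by_cases hy : dist y x < 1
        · simp [hz y hy]
        · simp [kernel_eq_zero (b := b) (x := x) (y := y)
            ((hb.le.trans (min_le_right _ _)).trans (by rw [dist_comm]; exact not_lt.1 hy))]
      simp [hm, hz x (by simp)]
  refine (lintegral_mono hpt).trans ?_
  rw [lintegral_indicator hSc.measurableSet, setLIntegral_const]
  exact hηε

/-- Mollifications converge in `L¹`. -/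
theorem exists_lintegral_moll_sub_le [CompleteSpace E] {g : Dom n → E} (hg : Integrable g)
    {ε : ℝ≥0∞} (hε : ε ≠ 0) :
    ∃ δ > 0, ∀ b : ContDiffBump (0 : Dom n), b.rOut < δ → ∫⁻ x, ‖moll b g x - g x‖ₑ ≤ ε := by
  have hε3 : ε / 3 ≠ 0 := (ENNReal.div_pos hε (by simp)).ne'
  -- Three thirds: replacing `g` by `h`, mollifying `h`, and mollifying `g - h`, where mollification
  -- does not increase the `L¹` norm.
  obtain ⟨h, hs, hle, hc, hi⟩ := hg.exists_hasCompactSupport_lintegral_sub_le hε3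
  obtain ⟨δ, hδ, hb⟩ := exists_lintegral_moll_sub_le_of_continuous hc hs hε3
  refine ⟨δ, hδ, fun b hbδ => ?_⟩
  have hpt : ∀ x, ‖moll b g x - g x‖ₑ ≤
      ‖moll b (g - h) x‖ₑ + (‖moll b h x - h x‖ₑ + ‖g x - h x‖ₑ) := fun x => by
    have : moll b g x - g x = moll b (g - h) x + ((moll b h x - h x) - (g x - h x)) := by
      rw [moll_sub b hg hi]; abel
    rw [this]
    exact (enorm_add_le _ _).trans (add_le_add_right enorm_sub_le _)
  calc ∫⁻ x, ‖moll b g x - g x‖ₑ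
      ≤ ∫⁻ x, (‖moll b (g - h) x‖ₑ + (‖moll b h x - h x‖ₑ + ‖g x - h x‖ₑ)) := lintegral_mono hpt
    _ = (∫⁻ x, ‖moll b (g - h) x‖ₑ) + ((∫⁻ x, ‖moll b h x - h x‖ₑ) + ∫⁻ x, ‖g x - h x‖ₑ) := by
        rw [lintegral_add_left' (continuous_moll b (hg.sub hi)).aestronglyMeasurable.enorm,
          lintegral_add_left' (f := fun x => ‖moll b h x - h x‖ₑ)
            ((continuous_moll b hi).sub hc).aestronglyMeasurable.enorm]
    _ ≤ ε / 3 + (ε / 3 + ε / 3) := by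
        refine add_le_add ((lintegral_enorm_moll_le b (hg.sub hi)).trans hle)
          (add_le_add (hb b hbδ) hle)
    _ = ε := by rw [← add_assoc, ENNReal.add_thirds]

end Mollification

end Inpainting

/-! ### A partition of unity by layers approaching the boundary. -/

namespace Inpainting

section Partition

open scoped Manifold

variable {n : ℕ} {Ω : Set (Dom n)}

/-- Smooth Urysohn for the distance to the complement. The function vanishes in a neighbourhood of
the closed set `infDist ≤ r`, not only on it, so that its closed support lies in `Ω`. -/
theorem exists_cutoff (hb : Bornology.IsBounded Ω) {r s : ℝ} (hr : 0 < r) (hrs : r < s) :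
    ∃ η : Dom n → ℝ, IsTest Ω η ∧ (∀ x, η x ∈ Icc (0 : ℝ) 1) ∧
      (∀ x, s ≤ Metric.infDist x Ωᶜ → η x = 1) ∧ ∀ x, Metric.infDist x Ωᶜ ≤ r → η x = 0 := by
  have hc := Metric.continuous_infDist_pt (Ωᶜ)
  obtain ⟨η, h0, h1, h01⟩ := exists_contMDiffMap_zero_one_nhds_of_isClosed (n := ⊤) 𝓘(ℝ, Dom n)
    (s := {x | Metric.infDist x Ωᶜ ≤ r}) (t := {x | s ≤ Metric.infDist x Ωᶜ})
    (isClosed_le hc continuous_const) (isClosed_le continuous_const hc)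
    (disjoint_left.2 fun x hx hx' => absurd (le_trans hx' hx) (not_le.2 hrs))
  have hsupp : tsupport η ⊆ Ω := by
    intro x hx
    by_contra hxΩ
    have hx0 : Metric.infDist x Ωᶜ ≤ r := by
      rw [Metric.infDist_zero_of_mem hxΩ]; exact hr.le
    have := (eventually_nhdsSet_iff_forall.1 h0) x hx0
    exact (notMem_tsupport_iff_eventuallyEq.2 this) hx
  refine ⟨η, ⟨η.contMDiff.contDiff, ?_, hsupp⟩, h01,
    fun x hx => (eventually_nhdsSet_iff_forall.1 h1 x hx).self_of_nhds,
    fun x hx => (eventually_nhdsSet_iff_forall.1 h0 x hx).self_of_nhds⟩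
  exact Metric.isCompact_of_isClosed_isBounded (isClosed_tsupport _) (hb.subset hsupp)

theorem IsTest.sub {φ ψ : Dom n → ℝ} (hφ : IsTest Ω φ) (hψ : IsTest Ω ψ) :
    IsTest Ω (fun x => φ x - ψ x) := by
  refine ⟨hφ.smooth.sub hψ.smooth, ?_, (tsupport_sub φ ψ).trans
    (union_subset hφ.tsupport_subset hψ.tsupport_subset)⟩
  exact (hφ.hasCompactSupport.isCompact.union hψ.hasCompactSupport.isCompact).of_isClosed_subset
    (isClosed_tsupport _) (tsupport_sub φ ψ)

/-- A smooth partition of unity of `Ω`, subordinate to layers around the boundary. -/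
structure IsLayerPartition (Ω : Set (Dom n)) (φ : ℕ → Dom n → ℝ) : Prop where
  isTest : ∀ k, IsTest Ω (φ k)
  nonneg : ∀ k x, 0 ≤ φ k x
  sum_le : ∀ N x, ∑ k ∈ Finset.range N, φ k x ≤ 1
  sum_eq : ∀ (N : ℕ) x, 1 / ((N : ℝ) + 1) ≤ Metric.infDist x Ωᶜ →
    ∑ k ∈ Finset.range (N + 1), φ k x = 1
  eq_zero : ∀ (k : ℕ) x, 1 / ((k : ℝ) + 1) ≤ Metric.infDist x Ωᶜ → φ (k + 1) x = 0

theorem exists_isLayerPartition (hb : Bornology.IsBounded Ω) : ∃ φ, IsLayerPartition Ω φ := by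
  have hlt : ∀ k : ℕ, 1 / ((k : ℝ) + 2) < 1 / ((k : ℝ) + 1) := fun k =>
    one_div_lt_one_div_of_lt (by positivity) (by linarith)
  choose η hη h01 h1 h0 using fun k : ℕ => exists_cutoff hb
    (show (0 : ℝ) < 1 / ((k : ℝ) + 2) by positivity) (hlt k)
  -- Differences of successive cut-offs, so that the partial sums telescope.
  set φ : ℕ → Dom n → ℝ := fun k => Nat.casesOn k (η 0) fun k x => η (k + 1) x - η k x with hφ
  have hsum : ∀ N x, ∑ k ∈ Finset.range (N + 1), φ k x = η N x := by
    intro N x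
    induction N with
    | zero => simp [hφ]
    | succ N ih => rw [Finset.sum_range_succ, ih]; simp [hφ]
  have hmono : ∀ k x, η k x ≤ η (k + 1) x := by
    intro k x
    -- `η k` vanishes up to distance `1 / (k + 2)`, from which on `η (k + 1)` equals `1`.
    rcases le_total (1 / ((k : ℝ) + 2)) (Metric.infDist x Ωᶜ) with h | h
    · rw [h1 (k + 1) x (by push_cast; rwa [add_assoc, one_add_one_eq_two])]
      exact (h01 k x).2
    · rw [h0 k x h]; exact (h01 _ x).1
  refine ⟨φ, fun k => ?_, fun k x => ?_, fun N x => ?_, fun N x hx => ?_, fun k x hx => ?_⟩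
  · cases k with
    | zero => exact hη 0
    | succ k => exact (hη (k + 1)).sub (hη k)
  · cases k with
    | zero => exact (h01 0 x).1
    | succ k => exact sub_nonneg.2 (hmono k x)
  · cases N with
    | zero => simp
    | succ N => rw [hsum]; exact (h01 N x).2
  · rw [hsum, h1 N x hx]
  · have : 1 / (((k + 1 : ℕ) : ℝ) + 1) ≤ Metric.infDist x Ωᶜ := by
      refine le_trans ?_ hx
      push_cast
      exact one_div_le_one_div_of_le (by positivity) (by linarith)
    simp [hφ, h1 k x hx, h1 (k + 1) x this]

/-- Mollification radii tending to zero make the layers locally finite. -/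
theorem IsLayerPartition.eventually_locallyFinite {φ : ℕ → Dom n → ℝ} (hφ : IsLayerPartition Ω φ)
    (ho : IsOpen Ω) (hne : (Ωᶜ).Nonempty) {b : ℕ → ContDiffBump (0 : Dom n)}
    (hb : ∀ k : ℕ, (b k).rOut ≤ 1 / ((k : ℝ) + 1)) {x : Dom n} (hx : x ∈ Ω) :
    ∃ N : ℕ, ∀ᶠ x' in 𝓝 x, (∀ k ≥ N, ∀ y, kernel (b k) x' y * φ k y = 0) ∧
      ∑ k ∈ Finset.range N, φ k x' = 1 := by
  have hd : 0 < Metric.infDist x Ωᶜ :=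
    (ho.isClosed_compl.notMem_iff_infDist_pos hne).1 (by simpa using hx)
  -- If the kernel at `x'` meets a layer `j + 1` with `j ≥ N`, then the distance of `x'` to the
  -- complement is less than `2 / (N + 1)`, the layer and the radius contributing at most `1 / (N +
  -- 1)` each. A quarter of the distance at `x` excludes this for `x'` near `x`.
  obtain ⟨N, hN⟩ := exists_nat_one_div_lt (half_pos (half_pos hd))
  refine ⟨N + 1 + 1, ?_⟩
  have hev : ∀ᶠ x' in 𝓝 x, Metric.infDist x Ωᶜ / 2 < Metric.infDist x' Ωᶜ :=
    (Metric.continuous_infDist_pt (Ωᶜ)).continuousAt.eventually (lt_mem_nhds (half_lt_self hd))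
  filter_upwards [hev] with x' hx'
  refine ⟨fun k hk y => ?_, ?_⟩
  · by_contra hne'
    obtain ⟨j, rfl⟩ : ∃ j, k = j + 1 := ⟨k - 1, by omega⟩
    have hj : N ≤ j := by omega
    have hjle : 1 / ((j : ℝ) + 1) ≤ 1 / ((N : ℝ) + 1) :=
      one_div_le_one_div_of_le (by positivity) (by exact_mod_cast Nat.succ_le_succ hj)
    have h1 : Metric.infDist y Ωᶜ < 1 / ((j : ℝ) + 1) := by
      by_contra hcon
      exact hne' (by rw [hφ.eq_zero j y (not_lt.1 hcon), mul_zero])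
    have h2 : dist x' y < (b (j + 1)).rOut := by
      by_contra hcon
      exact hne' (by rw [kernel_eq_zero (not_lt.1 hcon), zero_mul])
    have h3 := hb (j + 1)
    have h4 : 1 / (((j + 1 : ℕ) : ℝ) + 1) ≤ 1 / ((j : ℝ) + 1) := by
      push_cast
      exact one_div_le_one_div_of_le (by positivity) (by linarith)
    have h5 := Metric.infDist_le_infDist_add_dist (s := Ωᶜ) (x := x') (y := y)
    linarith
  · refine hφ.sum_eq (N + 1) x' ?_
    have : 1 / (((N + 1 : ℕ) : ℝ) + 1) ≤ 1 / ((N : ℝ) + 1) := by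
      push_cast
      exact one_div_le_one_div_of_le (by positivity) (by linarith)
    linarith

end Partition

end Inpainting

/-! ### Gradients of localized mollifications. -/

namespace Inpainting

variable {n M : ℕ} {Ω : Set (Dom n)}

/-- The distributional gradient of `u` on `Ω` is `a 𝓛ⁿ + s θ`. -/
structure HasGradientParts (Ω : Set (Dom n)) (u : Dom n → Val M) (a : Dom n → Tens n M)
    (θ : Measure (Dom n)) (s : Dom n → Tens n M) : Prop where
  integrable : Integrable u
  integrable_ac : Integrable a
  integrable_sing : Integrable s θ
  weak_grad : ∀ φ, IsTest Ω φ → ∀ i j, ∫ x, u x i * pderiv j φ x =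
    -((∫ x, φ x * a x (i, j)) + ∫ x, φ x * s x (i, j) ∂θ)

theorem IsTest.continuous_pderiv {φ : Dom n → ℝ} (hφ : IsTest Ω φ) (j : Fin n) :
    Continuous (pderiv j φ) :=
  (hφ.smooth.continuous_fderiv (by simp)).clm_apply continuous_const

theorem IsTest.exists_pderiv_le {φ : Dom n → ℝ} (hφ : IsTest Ω φ) (j : Fin n) :
    ∃ C, ∀ x, ‖pderiv j φ x‖ ≤ C :=
  (hφ.hasCompactSupport.fderiv_apply (𝕜 := ℝ) _).exists_bound_of_continuous
    (hφ.continuous_pderiv j)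

/-- The absolutely continuous part of the gradient of `φ u`. -/
noncomputable def prodGrad (φ : Dom n → ℝ) (u : Dom n → Val M) (a : Dom n → Tens n M) (x : Dom n) :
    Tens n M :=
  φ x • a x + WithLp.toLp 2 fun p => u x p.1 * pderiv p.2 φ x

theorem prodGrad_apply (φ : Dom n → ℝ) (u : Dom n → Val M) (a : Dom n → Tens n M) (x : Dom n)
    (i : Fin M) (j : Fin n) :
    prodGrad φ u a x (i, j) = φ x * a x (i, j) + u x i * pderiv j φ x := rfl

theorem integrable_apply {ι : Type*} [Fintype ι] {X : Type*} [MeasurableSpace X] {μ : Measure X}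
    {g : X → EuclideanSpace ℝ ι} (hg : Integrable g μ) (p : ι) : Integrable (fun x => g x p) μ :=
  (EuclideanSpace.proj p : EuclideanSpace ℝ ι →L[ℝ] ℝ).integrable_comp hg

theorem integrable_of_apply {ι : Type*} [Fintype ι] {X : Type*} [MeasurableSpace X] {μ : Measure X}
    {g : X → EuclideanSpace ℝ ι} (hg : ∀ p, Integrable (fun x => g x p) μ) : Integrable g μ := by
  classical
  have h : g = fun x => ∑ p, g x p • (EuclideanSpace.single p (1 : ℝ) : EuclideanSpace ℝ ι) := by
    funext x; ext q; simp [Pi.single_apply]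
  rw [h]
  exact integrable_finsetSum _ fun p _ => (hg p).smul_const _

theorem integral_apply {ι : Type*} [Fintype ι] {X : Type*} [MeasurableSpace X] {μ : Measure X}
    {g : X → EuclideanSpace ℝ ι} (hg : Integrable g μ) (p : ι) :
    (∫ x, g x ∂μ) p = ∫ x, g x p ∂μ :=
  ((EuclideanSpace.proj p : EuclideanSpace ℝ ι →L[ℝ] ℝ).integral_comp_comm hg).symm

theorem IsTest.integrable_smul {φ : Dom n → ℝ} (hφ : IsTest Ω φ) {E : Type*} [NormedAddCommGroup E]
    [NormedSpace ℝ E] {θ : Measure (Dom n)} {g : Dom n → E} (hg : Integrable g θ) :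
    Integrable (fun x => φ x • g x) θ := by
  obtain ⟨C, hC⟩ := hφ.bounded
  exact hg.bdd_smul C hφ.smooth.continuous.aestronglyMeasurable (ae_of_all _ hC)

theorem IsTest.integrable_mul_pderiv {φ : Dom n → ℝ} (hφ : IsTest Ω φ) {g : Dom n → ℝ}
    (hg : Integrable g) (j : Fin n) : Integrable (fun x => g x * pderiv j φ x) := by
  obtain ⟨C, hC⟩ := hφ.exists_pderiv_le j
  exact hg.mul_bdd (hφ.continuous_pderiv j).aestronglyMeasurable (ae_of_all _ hC)

theorem HasGradientParts.integrable_prodGrad {u : Dom n → Val M} {a s : Dom n → Tens n M}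
    {θ : Measure (Dom n)} (h : HasGradientParts Ω u a θ s) {φ : Dom n → ℝ} (hφ : IsTest Ω φ) :
    Integrable (prodGrad φ u a) := by
  refine (hφ.integrable_smul h.integrable_ac).add (integrable_of_apply fun p => ?_)
  exact hφ.integrable_mul_pderiv (integrable_apply h.integrable p.1) p.2

/-- This is the function of `y` inserted into the definition of the weak gradient to differentiate a
mollification of `φ u`. -/
theorem IsTest.kernel_mul {φ : Dom n → ℝ} (hφ : IsTest Ω φ) (b : ContDiffBump (0 : Dom n))
    (x : Dom n) : IsTest Ω fun y => kernel b x y * φ y :=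
  ⟨(b.contDiff_normed.comp (contDiff_const.sub contDiff_id)).mul hφ.smooth,
    hφ.hasCompactSupport.mul_left, (tsupport_mul_subset_right).trans hφ.tsupport_subset⟩

theorem pderiv_kernel_mul {φ : Dom n → ℝ} (hφ : IsTest Ω φ) (b : ContDiffBump (0 : Dom n))
    (j : Fin n) (x y : Dom n) : pderiv j (fun y => kernel b x y * φ y) y =
      kernel b x y * pderiv j φ y -
        fderiv ℝ (b.normed volume) (x - y) (EuclideanSpace.single j 1) * φ y := by
  have h1 : HasFDerivAt (fun y => kernel b x y)
      (-(fderiv ℝ (b.normed volume) (x - y))) y := by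
    have hb : HasFDerivAt (b.normed volume) (fderiv ℝ (b.normed volume) (x - y)) (x - y) :=
      ((b.contDiff_normed (n := 1)).differentiable (by simp) _).hasFDerivAt
    have := hb.comp y ((hasFDerivAt_id y).const_sub x)
    simpa [Function.comp_def, kernel] using! this
  have h2 : HasFDerivAt φ (fderiv ℝ φ y) y :=
    (hφ.smooth.differentiable (by simp) _).hasFDerivAt
  have h3 := (h1.mul h2).fderiv
  change fderiv ℝ (fun y => kernel b x y * φ y) y = _ at h3
  rw [pderiv, h3]
  simp [pderiv]
  ring

theorem contDiff_moll (b : ContDiffBump (0 : Dom n)) {E : Type*} [NormedAddCommGroup E]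
    [NormedSpace ℝ E] [CompleteSpace E] {g : Dom n → E} (hg : Integrable g) :
    ContDiff ℝ 1 (moll b g) := by
  rw [moll_eq_convolution]
  exact b.hasCompactSupport_normed.contDiff_convolution_left _ b.contDiff_normed
    hg.locallyIntegrable

theorem fderiv_moll_apply (b : ContDiffBump (0 : Dom n)) {g : Dom n → Val M} (hg : Integrable g)
    (x v : Dom n) (i : Fin M) : fderiv ℝ (moll b g) x v i =
      ∫ y, fderiv ℝ (b.normed volume) (x - y) v * g y i := by
  have hs := b.hasCompactSupport_normed (μ := volume)
  have hd := hs.hasFDerivAt_convolution_left (ContinuousLinearMap.lsmul ℝ ℝ)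
    (b.contDiff_normed (n := 1)) hg.locallyIntegrable (μ := volume) x
  have hex : ConvolutionExistsAt (fderiv ℝ (b.normed volume)) g x
      ((ContinuousLinearMap.lsmul ℝ ℝ).precompL (Dom n)) volume :=
    (hs.fderiv ℝ).convolutionExists_left _
      ((b.contDiff_normed (n := 1)).continuous_fderiv (by simp)) hg.locallyIntegrable x
  have hi := hex.integrable_swap
  rw [moll_eq_convolution, hd.fderiv, convolution_eq_swap]
  rw [ContinuousLinearMap.integral_apply hi, integral_apply (hi.apply_continuousLinearMap v)]
  rfl

/-- The gradient of the mollification of `φ u`. -/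
theorem HasGradientParts.fderiv_moll {u : Dom n → Val M} {a s : Dom n → Tens n M}
    {θ : Measure (Dom n)} (h : HasGradientParts Ω u a θ s) {φ : Dom n → ℝ} (hφ : IsTest Ω φ)
    (b : ContDiffBump (0 : Dom n)) (x : Dom n) (i : Fin M) (j : Fin n) :
    fderiv ℝ (moll b fun y => φ y • u y) x (EuclideanSpace.single j 1) i =
      (moll b (prodGrad φ u a) x + ∫ y, (kernel b x y * φ y) • s y ∂θ) (i, j) := by
  have hψ := hφ.kernel_mul b x
  -- The kernel depends on `x - y`, so its derivative in `y` is minus the one in `x`; testing with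
  -- `kernel b x y * φ y` thus moves the derivative from the kernel onto `u`.
  have h1 := h.weak_grad _ hψ i j
  have e1 : ∀ y, u y i * pderiv j (fun y => kernel b x y * φ y) y =
      kernel b x y * (u y i * pderiv j φ y) -
        fderiv ℝ (b.normed volume) (x - y) (EuclideanSpace.single j 1) * (φ y • u y) i := fun y => by
    rw [pderiv_kernel_mul hφ]; simp; ring
  have hui := integrable_apply h.integrable i
  have i1 : Integrable fun y => kernel b x y * (u y i * pderiv j φ y) :=
    integrable_kernel_smul b (hφ.integrable_mul_pderiv hui j) x
  have i2 : Integrable fun y =>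
      -- Integrability is read off from the product rule `e1`, whose other two terms are integrable.
      fderiv ℝ (b.normed volume) (x - y) (EuclideanSpace.single j 1) * (φ y • u y) i := by
    have := i1.sub (hψ.integrable_mul_pderiv hui j)
    refine this.congr (ae_of_all _ fun y => ?_)
    simp only [Pi.sub_apply, e1]
    ring
  have i3 : Integrable fun y => kernel b x y * (φ y * a y (i, j)) :=
    integrable_kernel_smul b (hφ.integrable_smul (integrable_apply h.integrable_ac (i, j))) x
  simp only [e1] at h1
  rw [integral_sub i1 i2] at h1
  have e2 : moll b (prodGrad φ u a) x (i, j) =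
      (∫ y, kernel b x y * (φ y * a y (i, j))) + ∫ y, kernel b x y * (u y i * pderiv j φ y) := by
    rw [moll, integral_apply (integrable_kernel_smul b (h.integrable_prodGrad hφ) x),
      ← integral_add i3 i1]
    refine integral_congr_ae (ae_of_all _ fun y => ?_)
    simp only [PiLp.smul_apply, prodGrad_apply, smul_eq_mul, mul_add]
  have e3 : (∫ y, (kernel b x y * φ y) • s y ∂θ) (i, j) =
      ∫ y, kernel b x y * φ y * s y (i, j) ∂θ := by
    rw [integral_apply (hψ.integrable_smul h.integrable_sing)]
    rfl
  rw [fderiv_moll_apply b (hφ.integrable_smul h.integrable), PiLp.add_apply, e2, e3]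
  simp only [← mul_assoc] at *
  linarith

end Inpainting

/-! ### Approximation of `BV` functions by functions smooth in `Ω`. -/

namespace Inpainting

variable {n M : ℕ} {Ω : Set (Dom n)}

theorem exists_bump {r : ℝ} (hr : 0 < r) : ∃ b : ContDiffBump (0 : Dom n), b.rOut = r :=
  ⟨⟨r / 2, r, half_pos hr, half_lt_self hr⟩, rfl⟩

/-- Multiplying the product rule by the kernel once more kills the term in which the kernel is
differentiated. -/
theorem kernel_mul_pderiv_eq_zero {φ : Dom n → ℝ} (hφ : IsTest Ω φ) {b : ContDiffBump (0 : Dom n)}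
    {x : Dom n} (h : ∀ y, kernel b x y * φ y = 0) (j : Fin n) (y : Dom n) :
    kernel b x y * pderiv j φ y = 0 := by
  have h1 := pderiv_kernel_mul hφ b j x y
  have h2 : (fun y => kernel b x y * φ y) = fun _ => 0 := funext h
  rw [h2] at h1
  have h3 : pderiv j (fun _ : Dom n => (0 : ℝ)) y = 0 := by simp [pderiv]
  rw [h3] at h1
  have h4 : kernel b x y * (kernel b x y * pderiv j φ y) = 0 := by
    have := h y
    linear_combination (-kernel b x y) * h1 +
      fderiv ℝ (b.normed volume) (x - y) (EuclideanSpace.single j 1) * this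
  rcases mul_eq_zero.1 h4 with h5 | h5
  · rw [h5, zero_mul]
  · exact h5

/-- The terms with derivatives of `φ k` cancel because the sum is constant near `x`, which is why a
neighbourhood appears in the hypothesis. -/
theorem sum_prodGrad_eq {φ : ℕ → Dom n → ℝ} (hφ : ∀ k, IsTest Ω (φ k)) {N : ℕ} {x : Dom n}
    (h : ∀ᶠ x' in 𝓝 x, ∑ k ∈ Finset.range N, φ k x' = 1) (u : Dom n → Val M)
    (a : Dom n → Tens n M) : ∑ k ∈ Finset.range N, prodGrad (φ k) u a x = a x := by
  have hd : ∀ j, ∑ k ∈ Finset.range N, pderiv j (φ k) x = 0 := fun j => by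
    have h1 : HasFDerivAt (fun x' => ∑ k ∈ Finset.range N, φ k x')
        (∑ k ∈ Finset.range N, fderiv ℝ (φ k) x) x :=
      HasFDerivAt.fun_sum fun k _ => ((hφ k).smooth.differentiable (by simp) x).hasFDerivAt
    have h2 : HasFDerivAt (fun x' => ∑ k ∈ Finset.range N, φ k x') (0 : Dom n →L[ℝ] ℝ) x :=
      (hasFDerivAt_const (1 : ℝ) x).congr_of_eventuallyEq h
    have h3 := congrArg (fun L : Dom n →L[ℝ] ℝ => L (EuclideanSpace.single j 1)) (h1.unique h2)
    simpa [pderiv] using h3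
  ext ⟨i, j⟩
  simp only [WithLp.ofLp_sum, Finset.sum_apply, prodGrad_apply]
  rw [Finset.sum_add_distrib, ← Finset.sum_mul, ← Finset.mul_sum, hd, h.self_of_nhds]
  ring

theorem lintegral_enorm_le_of_locallyFinite {E : Type*} [NormedAddCommGroup E]
    {h : Dom n → E} {g : ℕ → Dom n → E} (hg : ∀ k, AEStronglyMeasurable (g k) volume)
    (hΩ : MeasurableSet Ω) (hsum : ∀ x ∈ Ω, ∃ N, h x = ∑ k ∈ Finset.range N, g k x)
    {e : ℕ → ℝ≥0∞} (he : ∀ k, ∫⁻ x, ‖g k x‖ₑ ≤ e k) :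
    ∫⁻ x in Ω, ‖h x‖ₑ ≤ ∑' k, e k := by
  calc ∫⁻ x in Ω, ‖h x‖ₑ ≤ ∫⁻ x in Ω, ∑' k, ‖g k x‖ₑ := by
        refine setLIntegral_mono' hΩ fun x hx => ?_
        obtain ⟨N, hN⟩ := hsum x hx
        rw [hN]
        exact (enorm_sum_le _ _).trans (ENNReal.sum_le_tsum _)
    _ ≤ ∫⁻ x, ∑' k, ‖g k x‖ₑ := setLIntegral_le_lintegral _ _
    _ = ∑' k, ∫⁻ x, ‖g k x‖ₑ := lintegral_tsum fun k => (hg k).enorm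
    _ ≤ _ := ENNReal.tsum_le_tsum he

/-- The gradient assembled from its absolutely continuous approximation `A` and the integral of the
singular density `s` against the kernel `ψ`. -/
noncomputable def approxGrad (θ : Measure (Dom n)) (s A : Dom n → Tens n M)
    (ψ : Dom n → Dom n → ℝ≥0∞) (x : Dom n) : Tens n M :=
  A x + ∫ y, (ψ x y).toReal • s y ∂θ

/-- `w` approximates, up to `ε`, a function `u` with gradient `a 𝓛ⁿ + s θ`, and is smooth in `Ω`.
The gradient of `w` is the sum of an approximation `A` of `a` and of the mollification of `s θ` by
the kernel `ψ`. -/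
structure IsSmoothApprox (Ω : Set (Dom n)) (u : Dom n → Val M) (a : Dom n → Tens n M)
    (θ : Measure (Dom n)) (s : Dom n → Tens n M) (ε : ℝ) (w : Dom n → Val M)
    (A : Dom n → Tens n M) (ψ : Dom n → Dom n → ℝ≥0∞) : Prop where
  contDiffAt : ∀ x ∈ Ω, ContDiffAt ℝ 1 w x
  fderiv_eq : ∀ x ∈ Ω, ∀ i j,
    fderiv ℝ w x (EuclideanSpace.single j 1) i = approxGrad θ s A ψ x (i, j)
  lintegral_sub_le : ∫⁻ x in Ω, ‖w x - u x‖ₑ ≤ ENNReal.ofReal ε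
  lintegral_grad_sub_le : ∫⁻ x in Ω, ‖A x - a x‖ₑ ≤ ENNReal.ofReal ε
  aestronglyMeasurable : AEStronglyMeasurable A (volume.restrict Ω)
  measurable_kernel : Measurable (Function.uncurry ψ)
  kernel_le : ∀ x ∈ Ω, ∃ C : ℝ≥0, ∀ y, ψ x y ≤ C
  lintegral_kernel_le : ∀ y, ∫⁻ x, ψ x y ≤ 1
  kernel_eq_zero : ∀ x y, ε ≤ dist x y → ψ x y = 0

/-- Approximation of a function of bounded variation by functions that are smooth in `Ω`. -/
theorem HasGradientParts.exists_smooth_approx {u : Dom n → Val M} {a s : Dom n → Tens n M}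
    {θ : Measure (Dom n)} (h : HasGradientParts Ω u a θ s)
    (hb : Bornology.IsBounded Ω) (ho : IsOpen Ω) (hne : (Ωᶜ).Nonempty) {ε : ℝ} (hε : 0 < ε) :
    ∃ w A ψ, IsSmoothApprox Ω u a θ s ε w A ψ := by
  obtain ⟨φ, hφ⟩ := exists_isLayerPartition hb
  have hεne : ENNReal.ofReal ε ≠ 0 := by simpa using hε
  -- The error `ε` is distributed over the layers.
  obtain ⟨e, he, hesum⟩ := ENNReal.exists_pos_sum_of_countable hεne ℕ
  have hi1 : ∀ k, Integrable fun y => φ k y • u y := fun k =>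
    (hφ.isTest k).integrable_smul h.integrable
  have hi2 := fun k => h.integrable_prodGrad (hφ.isTest k)
  choose δ₁ hδ₁ H₁ using fun k => exists_lintegral_moll_sub_le (hi1 k)
    (ENNReal.coe_ne_zero.2 (he k).ne')
  choose δ₂ hδ₂ H₂ using fun k => exists_lintegral_moll_sub_le (hi2 k)
    (ENNReal.coe_ne_zero.2 (he k).ne')
  -- The radius in layer `k` serves four purposes: `L¹` accuracy for `φ k u`, the same for its
  -- absolutely continuous gradient, local finiteness, and range at most `ε` of the kernel.
  choose b hbr using fun k : ℕ => exists_bump (n := n)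
    (show 0 < min (min (δ₁ k / 2) (δ₂ k / 2)) (min (1 / ((k : ℝ) + 1)) ε) from
      lt_min (lt_min (half_pos (hδ₁ k)) (half_pos (hδ₂ k))) (lt_min (by positivity) hε))
  have hb1 : ∀ k, (b k).rOut < δ₁ k := fun k => by
    rw [hbr]
    exact ((min_le_left _ _).trans (min_le_left _ _)).trans_lt (half_lt_self (hδ₁ k))
  have hb2 : ∀ k, (b k).rOut < δ₂ k := fun k => by
    rw [hbr]
    exact ((min_le_left _ _).trans (min_le_right _ _)).trans_lt (half_lt_self (hδ₂ k))
  have hb3 : ∀ k : ℕ, (b k).rOut ≤ 1 / ((k : ℝ) + 1) := fun k => by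
    rw [hbr]; exact (min_le_right _ _).trans (min_le_left _ _)
  have hb4 : ∀ k, (b k).rOut ≤ ε := fun k => by
    rw [hbr]; exact (min_le_right _ _).trans (min_le_right _ _)
  set w : Dom n → Val M := fun x => ∑' k, moll (b k) (fun y => φ k y • u y) x with hw
  set A : Dom n → Tens n M := fun x => ∑' k, moll (b k) (prodGrad (φ k) u a) x with hA
  -- With values in `ℝ≥0∞` the sum makes sense for all `x`, also outside `Ω`, and Tonelli applies
  -- without further conditions.
  set ψ : Dom n → Dom n → ℝ≥0∞ := fun x y => ∑' k, ENNReal.ofReal (kernel (b k) x y * φ k y)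
    with hψ
  have hloc := fun x (hx : x ∈ Ω) => hφ.eventually_locallyFinite ho hne hb3 hx
  have hzero1 : ∀ {x k}, (∀ y, kernel (b k) x y * φ k y = 0) →
      moll (b k) (fun y => φ k y • u y) x = 0 := fun {x k} hz =>
    integral_eq_zero_of_ae (ae_of_all _ fun y => by simp [smul_smul, hz y])
  have hzero2 : ∀ {x k}, (∀ y, kernel (b k) x y * φ k y = 0) →
      moll (b k) (prodGrad (φ k) u a) x = 0 := fun {x k} hz => by
    refine integral_eq_zero_of_ae (ae_of_all _ fun y => ?_)
    ext ⟨i, j⟩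
    have h1 := hz y
    have h2 := kernel_mul_pderiv_eq_zero (hφ.isTest k) hz j y
    simp only [PiLp.smul_apply, prodGrad_apply, smul_eq_mul, Pi.zero_apply, PiLp.zero_apply]
    linear_combination a y (i, j) * h1 + u y i * h2
  have hwsum : ∀ {x N}, (∀ k ≥ N, ∀ y, kernel (b k) x y * φ k y = 0) →
      w x = ∑ k ∈ Finset.range N, moll (b k) (fun y => φ k y • u y) x := fun {x N} hz =>
    tsum_eq_sum fun k hk => hzero1 (hz k (by simpa using hk))
  have hAsum : ∀ {x N}, (∀ k ≥ N, ∀ y, kernel (b k) x y * φ k y = 0) →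
      A x = ∑ k ∈ Finset.range N, moll (b k) (prodGrad (φ k) u a) x := fun {x N} hz =>
    tsum_eq_sum fun k hk => hzero2 (hz k (by simpa using hk))
  have hψsum : ∀ {x N}, (∀ k ≥ N, ∀ y, kernel (b k) x y * φ k y = 0) → ∀ y,
      ψ x y = ∑ k ∈ Finset.range N, ENNReal.ofReal (kernel (b k) x y * φ k y) := fun {x N} hz y =>
    tsum_eq_sum fun k hk => by rw [hz k (by simpa using hk) y, ENNReal.ofReal_zero]
  have hweq : ∀ x ∈ Ω, ∃ N, (w =ᶠ[𝓝 x]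
      fun x' => ∑ k ∈ Finset.range N, moll (b k) (fun y => φ k y • u y) x') ∧
      ∀ k ≥ N, ∀ y, kernel (b k) x y * φ k y = 0 := fun x hx => by
    obtain ⟨N, hN⟩ := hloc x hx
    exact ⟨N, hN.mono fun x' hx' => hwsum hx'.1, hN.self_of_nhds.1⟩
  refine ⟨w, A, ψ, fun x hx => ?_, fun x hx i j => ?_, ?_, ?_, ?_, ?_, fun x hx => ?_, fun y => ?_,
    fun x y hxy => ?_⟩
  · obtain ⟨N, hN, -⟩ := hweq x hx
    exact (ContDiff.sum fun k _ => contDiff_moll (b k) (hi1 k)).contDiffAt.congr_of_eventuallyEq hN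
  · obtain ⟨N, hN, hz⟩ := hweq x hx
    have hd : HasFDerivAt (fun x' => ∑ k ∈ Finset.range N, moll (b k) (fun y => φ k y • u y) x')
        (∑ k ∈ Finset.range N, fderiv ℝ (moll (b k) fun y => φ k y • u y) x) x :=
      HasFDerivAt.fun_sum fun k _ =>
        ((contDiff_moll (b k) (hi1 k)).differentiable (by simp) x).hasFDerivAt
    rw [hN.fderiv_eq, hd.fderiv, _root_.sum_apply, WithLp.ofLp_sum, Finset.sum_apply,
      approxGrad, hAsum hz]
    have hint : ∀ k, Integrable (fun y => (kernel (b k) x y * φ k y) • s y) θ := fun k =>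
      ((hφ.isTest k).kernel_mul (b k) x).integrable_smul h.integrable_sing
    have hs : ∫ y, (ψ x y).toReal • s y ∂θ =
        ∑ k ∈ Finset.range N, ∫ y, (kernel (b k) x y * φ k y) • s y ∂θ := by
      rw [← integral_finsetSum _ fun k _ => hint k]
      refine integral_congr_ae (ae_of_all _ fun y => ?_)
      simp only
      rw [hψsum hz y, ENNReal.toReal_sum fun _ _ => ENNReal.ofReal_ne_top, Finset.sum_smul]
      refine Finset.sum_congr rfl fun k _ => ?_
      rw [ENNReal.toReal_ofReal (mul_nonneg (kernel_nonneg _ _ _) (hφ.nonneg k y))]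
    rw [hs, ← Finset.sum_add_distrib, WithLp.ofLp_sum, Finset.sum_apply]
    exact Finset.sum_congr rfl fun k _ => h.fderiv_moll (hφ.isTest k) (b k) x i j
  · refine (lintegral_enorm_le_of_locallyFinite (e := fun k => e k)
      (g := fun k x => moll (b k) (fun y => φ k y • u y) x - φ k x • u x)
      (fun k => (contDiff_moll (b k) (hi1 k)).continuous.aestronglyMeasurable.sub (hi1 k).1)
      ho.measurableSet (fun x hx => ?_) fun k => H₁ k (b k) (hb1 k)).trans hesum.le
    obtain ⟨N, hN⟩ := hloc x hx
    refine ⟨N, ?_⟩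
    rw [Finset.sum_sub_distrib, ← Finset.sum_smul, hN.self_of_nhds.2, one_smul,
      hwsum hN.self_of_nhds.1]
  · refine (lintegral_enorm_le_of_locallyFinite (e := fun k => e k)
      (g := fun k x => moll (b k) (prodGrad (φ k) u a) x - prodGrad (φ k) u a x)
      (fun k => (contDiff_moll (b k) (hi2 k)).continuous.aestronglyMeasurable.sub (hi2 k).1)
      ho.measurableSet (fun x hx => ?_) fun k => H₂ k (b k) (hb2 k)).trans hesum.le
    obtain ⟨N, hN⟩ := hloc x hx
    refine ⟨N, ?_⟩
    rw [Finset.sum_sub_distrib, sum_prodGrad_eq hφ.isTest (hN.mono fun _ h => h.2),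
      hAsum hN.self_of_nhds.1]
  · refine aestronglyMeasurable_of_tendsto_ae atTop
      (f := fun N x => ∑ k ∈ Finset.range N, moll (b k) (prodGrad (φ k) u a) x)
      (fun N => (continuous_finsetSum _ fun k _ =>
        (contDiff_moll (b k) (hi2 k)).continuous).aestronglyMeasurable) ?_
    filter_upwards [ae_restrict_mem ho.measurableSet] with x hx
    obtain ⟨N, -, hz⟩ := hweq x hx
    refine tendsto_const_nhds.congr' ?_
    filter_upwards [eventually_ge_atTop N] with N' hN'
    exact hAsum fun k hk => hz k (hN'.trans hk)
  · refine Measurable.tsum fun k => Measurable.ennreal_ofReal ?_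
    exact (continuous_kernel (b k)).measurable.mul
      ((hφ.isTest k).smooth.continuous.measurable.comp measurable_snd)
  · obtain ⟨N, -, hz⟩ := hweq x hx
    choose C hC using fun k => ((hφ.isTest k).kernel_mul (b k) x).bounded
    refine ⟨∑ k ∈ Finset.range N, (C k).toNNReal, fun y => ?_⟩
    rw [hψsum hz y, ENNReal.ofNNReal_finsetSum]
    exact Finset.sum_le_sum fun k _ => ENNReal.ofReal_le_ofReal ((le_abs_self _).trans (hC k y))
  · have hm : ∀ k, Measurable fun x => ENNReal.ofReal (kernel (b k) x y) := fun k =>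
      ((continuous_kernel (b k)).comp (Continuous.prodMk_left y)).measurable.ennreal_ofReal
    simp only [hψ]
    rw [lintegral_tsum fun k => ?_]
    · refine ENNReal.tsum_le_of_sum_range_le fun N => ?_
      -- Each kernel has mass one in `x`, so the mass of `ψ` at `y` is the sum of the `φ k y`, which
      -- is at most one.
      have : ∀ k, ∫⁻ x, ENNReal.ofReal (kernel (b k) x y * φ k y) = ENNReal.ofReal (φ k y) := by
        intro k
        simp only [ENNReal.ofReal_mul (kernel_nonneg _ _ _)]
        rw [lintegral_mul_const _ (hm k), lintegral_kernel, one_mul]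
      simp only [this]
      rw [← ENNReal.ofReal_sum_of_nonneg fun k _ => hφ.nonneg k y, ← ENNReal.ofReal_one]
      exact ENNReal.ofReal_le_ofReal (hφ.sum_le N y)
    · simp only [ENNReal.ofReal_mul (kernel_nonneg _ _ _)]
      exact ((hm k).mul_const _).aemeasurable
  · simp only [hψ, ENNReal.tsum_eq_zero]
    intro k
    rw [kernel_eq_zero ((hb4 k).trans hxy), zero_mul, ENNReal.ofReal_zero]

end Inpainting

/-! ### Energy of the smooth approximations and convergence of their gradients in measure. -/

namespace Inpainting

variable {n M : ℕ} {Ω : Set (Dom n)}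

/-- A function which is `C¹` in `Ω` and integrable together with its classical gradient belongs to
`W^{1,1}(Ω)`. -/
theorem IsW11.of_contDiffAt (ho : IsOpen Ω) {w : Dom n → Val M} {G : Dom n → Tens n M}
    (hw : ∀ x ∈ Ω, DifferentiableAt ℝ w x)
    (hG : ∀ x ∈ Ω, ∀ i j, fderiv ℝ w x (EuclideanSpace.single j 1) i = G x (i, j))
    (hwi : IntegrableOn w Ω) (hGi : IntegrableOn G Ω) : IsW11 Ω w G := by
  refine ⟨hwi, hGi, fun φ hφ i j => ?_⟩
  have hd : ∀ x ∈ Ω, HasFDerivAt (fun x => w x i)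
      ((EuclideanSpace.proj i : Val M →L[ℝ] ℝ).comp (fderiv ℝ w x)) x := fun x hx =>
    (EuclideanSpace.proj i : Val M →L[ℝ] ℝ).hasFDerivAt.comp x (hw x hx).hasFDerivAt
  have hG' : ∀ x ∈ Ω, fderiv ℝ (fun x => w x i) x (EuclideanSpace.single j 1) = G x (i, j) :=
    fun x hx => by rw [(hd x hx).fderiv, ← hG x hx i j]; rfl
  have hz : ∀ x ∉ Ω, φ x = 0 := fun x hx => hφ.eq_zero hx
  have hzd : ∀ x ∉ Ω, fderiv ℝ φ x = 0 := fun x hx =>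
    image_eq_zero_of_notMem_tsupport fun h => hx (hφ.tsupport_subset (tsupport_fderiv_subset ℝ h))
  have hwii : IntegrableOn (fun x => w x i) Ω := integrable_apply hwi i
  have hGii : IntegrableOn (fun x => G x (i, j)) Ω := integrable_apply hGi (i, j)
  obtain ⟨C, hC⟩ := hφ.bounded
  obtain ⟨C', hC'⟩ := hφ.exists_pderiv_le j
  -- Test functions vanish outside `Ω`, so the integration by parts can be done on the whole space,
  -- whatever `w` is outside `Ω`.
  have i1 : Integrable fun x => fderiv ℝ φ x (EuclideanSpace.single j 1) * w x i := by
    refine (integrableOn_iff_integrable_of_support_subset (s := Ω) fun x hx => ?_).1 ?_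
    · by_contra hxΩ; exact hx (by simp [hzd x hxΩ])
    · exact hwii.bdd_mul (hφ.continuous_pderiv j).aestronglyMeasurable (ae_of_all _ hC')
  have i2 : Integrable fun x => φ x * fderiv ℝ (fun x => w x i) x (EuclideanSpace.single j 1) := by
    refine (integrableOn_iff_integrable_of_support_subset (s := Ω) fun x hx => ?_).1 ?_
    · by_contra hxΩ; exact hx (by simp [hz x hxΩ])
    · refine (hGii.bdd_mul hφ.smooth.continuous.aestronglyMeasurable (ae_of_all _ hC)).congr ?_
      filter_upwards [ae_restrict_mem ho.measurableSet] with x hx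
      rw [hG' x hx]
  have i3 : Integrable fun x => φ x * w x i := by
    refine (integrableOn_iff_integrable_of_support_subset (s := Ω) fun x hx => ?_).1 ?_
    · by_contra hxΩ; exact hx (by simp [hz x hxΩ])
    · exact hwii.bdd_mul hφ.smooth.continuous.aestronglyMeasurable (ae_of_all _ hC)
  have key := integral_mul_fderiv_eq_neg_fderiv_mul_of_integrable i1 i2 i3
    (fun x _ => hφ.smooth.differentiable (by simp) x)
    (fun x hx => (hd x (hφ.tsupport_subset hx)).differentiableAt)
  have e1 : ∫ x in Ω, w x i * pderiv j φ x =
      ∫ x, fderiv ℝ φ x (EuclideanSpace.single j 1) * w x i := by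
    refine (integral_congr_ae (ae_of_all _ fun x => mul_comm _ _)).trans ?_
    exact setIntegral_eq_integral_of_forall_compl_eq_zero (s := Ω)
      (f := fun x => fderiv ℝ φ x (EuclideanSpace.single j 1) * w x i)
      fun x hx => by simp [hzd x hx]
  have e2 : ∫ x in Ω, φ x * G x (i, j) =
      ∫ x, φ x * fderiv ℝ (fun x => w x i) x (EuclideanSpace.single j 1) := by
    refine (setIntegral_congr_fun ho.measurableSet fun x hx => by simp only [hG' x hx]).trans
      (setIntegral_eq_integral_of_forall_compl_eq_zero (s := Ω)
        (f := fun x => φ x * fderiv ℝ (fun x => w x i) x (EuclideanSpace.single j 1))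
        fun x hx => by simp [hz x hx])
  rw [e1, e2, key, neg_neg]

/-- This supplies the measurability of the classical gradients. -/
theorem continuousOn_of_fderiv_eq {w : Dom n → Val M} {G : Dom n → Tens n M}
    (hw : ∀ x ∈ Ω, ContDiffAt ℝ 1 w x)
    (hG : ∀ x ∈ Ω, ∀ i j, fderiv ℝ w x (EuclideanSpace.single j 1) i = G x (i, j)) :
    ContinuousOn G Ω := by
  have hc : ContinuousOn (fun x => (WithLp.toLp 2 fun p : Fin M × Fin n =>
      fderiv ℝ w x (EuclideanSpace.single p.2 1) p.1 : Tens n M)) Ω := by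
    intro x hx
    have h1 : ContinuousAt (fderiv ℝ w) x := (hw x hx).continuousAt_fderiv (by simp)
    refine ContinuousAt.continuousWithinAt ?_
    refine (PiLp.continuous_toLp 2 _).continuousAt.comp (continuousAt_pi.2 fun p => ?_)
    exact (EuclideanSpace.proj p.1 : Val M →L[ℝ] ℝ).continuous.continuousAt.comp
      (h1.clm_apply continuousAt_const)
  refine hc.congr fun x hx => ?_
  ext ⟨i, j⟩
  exact (hG x hx i j).symm

namespace IsSmoothApprox

variable {u : Dom n → Val M} {a s : Dom n → Tens n M} {θ : Measure (Dom n)} {ε : ℝ}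
  {w : Dom n → Val M} {A : Dom n → Tens n M} {ψ : Dom n → Dom n → ℝ≥0∞}

theorem measurable_kernel_right (h : IsSmoothApprox Ω u a θ s ε w A ψ) (x : Dom n) :
    Measurable (ψ x) := h.measurable_kernel.comp measurable_prodMk_left

theorem kernel_ne_top (h : IsSmoothApprox Ω u a θ s ε w A ψ) {x : Dom n} (hx : x ∈ Ω) (y : Dom n) :
    ψ x y ≠ ∞ := by
  obtain ⟨C, hC⟩ := h.kernel_le x hx
  exact ne_top_of_le_ne_top ENNReal.coe_ne_top (hC y)

theorem integrable_kernel_smul (h : IsSmoothApprox Ω u a θ s ε w A ψ) {E : Type*}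
    [NormedAddCommGroup E] [NormedSpace ℝ E] {g : Dom n → E} (hg : Integrable g θ) {x : Dom n}
    (hx : x ∈ Ω) : Integrable (fun y => (ψ x y).toReal • g y) θ := by
  obtain ⟨C, hC⟩ := h.kernel_le x hx
  refine hg.bdd_smul C (h.measurable_kernel_right x).ennreal_toReal.aestronglyMeasurable
    (ae_of_all _ fun y => ?_)
  rw [Real.norm_of_nonneg ENNReal.toReal_nonneg]
  exact ENNReal.toReal_mono ENNReal.coe_ne_top (hC y)

theorem enorm_integral_le (h : IsSmoothApprox Ω u a θ s ε w A ψ) {x : Dom n} (hx : x ∈ Ω) :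
    ‖∫ y, (ψ x y).toReal • s y ∂θ‖ₑ ≤ ∫⁻ y, ψ x y * ‖s y‖ₑ ∂θ := by
  refine (enorm_integral_le_lintegral_enorm _).trans (lintegral_mono fun y => ?_)
  rw [enorm_smul, Real.enorm_of_nonneg ENNReal.toReal_nonneg, ENNReal.ofReal_toReal
    (h.kernel_ne_top hx y)]

theorem lintegral_lintegral_kernel_le (h : IsSmoothApprox Ω u a θ s ε w A ψ) [SFinite θ]
    {g : Dom n → ℝ≥0∞} (hg : AEMeasurable g θ) :
    ∫⁻ x in Ω, ∫⁻ y, ψ x y * g y ∂θ ≤ ∫⁻ y, g y ∂θ := by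
  refine (setLIntegral_le_lintegral _ _).trans ?_
  rw [lintegral_lintegral_swap (h.measurable_kernel.aemeasurable.mul hg.comp_snd)]
  refine lintegral_mono fun y => ?_
  have hm : Measurable fun x => ψ x y := h.measurable_kernel.comp measurable_prodMk_right
  rw [lintegral_mul_const _ hm]
  exact (mul_le_mul_left (h.lintegral_kernel_le y) _).trans (one_mul _).le

theorem aemeasurable_lintegral_kernel (h : IsSmoothApprox Ω u a θ s ε w A ψ) [SFinite θ]
    {g : Dom n → ℝ≥0∞} (hg : AEMeasurable g θ) :
    AEMeasurable (fun x => ∫⁻ y, ψ x y * g y ∂θ) (volume.restrict Ω) :=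
  (h.measurable_kernel.aemeasurable.mul hg.comp_snd).lintegral_prod_right'

theorem continuousOn (h : IsSmoothApprox Ω u a θ s ε w A ψ) : ContinuousOn w Ω := fun x hx =>
  (h.contDiffAt x hx).continuousAt.continuousWithinAt

theorem integrableOn (h : IsSmoothApprox Ω u a θ s ε w A ψ) (ho : IsOpen Ω) (hu : Integrable u) :
    IntegrableOn w Ω := by
  have hm := h.continuousOn.aestronglyMeasurable ho.measurableSet (μ := volume)
  have hd : IntegrableOn (fun x => w x - u x) Ω :=
    ⟨hm.sub hu.1.restrict, h.lintegral_sub_le.trans_lt ENNReal.ofReal_lt_top⟩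
  refine (hd.add hu.integrableOn).congr (ae_of_all _ fun x => ?_)
  simp

theorem continuousOn_approxGrad (h : IsSmoothApprox Ω u a θ s ε w A ψ) :
    ContinuousOn (approxGrad θ s A ψ) Ω :=
  continuousOn_of_fderiv_eq h.contDiffAt h.fderiv_eq

theorem lintegral_approxGrad_le (h : IsSmoothApprox Ω u a θ s ε w A ψ) [SFinite θ]
    (ho : IsOpen Ω) (ha : Integrable a) (hs : Integrable s θ) :
    ∫⁻ x in Ω, ‖approxGrad θ s A ψ x‖ₑ ≤
      ENNReal.ofReal ε + (∫⁻ x, ‖a x‖ₑ) + ∫⁻ y, ‖s y‖ₑ ∂θ := by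
  calc ∫⁻ x in Ω, ‖approxGrad θ s A ψ x‖ₑ
      ≤ ∫⁻ x in Ω, ((‖A x - a x‖ₑ + ‖a x‖ₑ) + ∫⁻ y, ψ x y * ‖s y‖ₑ ∂θ) := by
        refine setLIntegral_mono' ho.measurableSet fun x hx => ?_
        refine (enorm_add_le _ _).trans (add_le_add ?_ (h.enorm_integral_le hx))
        simpa using enorm_add_le (A x - a x) (a x)
    _ = (∫⁻ x in Ω, ‖A x - a x‖ₑ) + (∫⁻ x in Ω, ‖a x‖ₑ) +
          ∫⁻ x in Ω, ∫⁻ y, ψ x y * ‖s y‖ₑ ∂θ := by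
        rw [lintegral_add_right' _ (h.aemeasurable_lintegral_kernel hs.1.enorm),
          lintegral_add_right' _ ha.1.restrict.enorm]
    _ ≤ _ := add_le_add (add_le_add h.lintegral_grad_sub_le (setLIntegral_le_lintegral _ _))
        (h.lintegral_lintegral_kernel_le hs.1.enorm)

theorem integrableOn_approxGrad (h : IsSmoothApprox Ω u a θ s ε w A ψ) [SFinite θ]
    (ho : IsOpen Ω) (ha : Integrable a) (hs : Integrable s θ) :
    IntegrableOn (approxGrad θ s A ψ) Ω := by
  refine ⟨h.continuousOn_approxGrad.aestronglyMeasurable ho.measurableSet,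
    (h.lintegral_approxGrad_le ho ha hs).trans_lt ?_⟩
  exact ENNReal.add_lt_top.2 ⟨ENNReal.add_lt_top.2 ⟨ENNReal.ofReal_lt_top, ha.2⟩, hs.2⟩

/-- The energy of the approximation does not exceed that of `a 𝓛ⁿ + s θ` essentially. -/
theorem integral_energy_le (h : IsSmoothApprox Ω u a θ s ε w A ψ) [SFinite θ] {F : Tens n M → ℝ}
    {ν : ℝ} (hF : IsIntegrand F ν) (hε : 0 ≤ ε)
    (ho : IsOpen Ω) (ha : Integrable a) (hs : Integrable s θ) :
    ∫ x in Ω, F (approxGrad θ s A ψ x) ≤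
      (∫ x in Ω, F (a x)) + ν * ε + ∫ y, recession F (s y) ∂θ := by
  have hri : Integrable (fun y => recession F (s y)) θ := by
    refine (hs.norm.const_mul ν).mono'
      (hF.measurable_recession.comp_aemeasurable hs.1.aemeasurable).aestronglyMeasurable
      (ae_of_all _ fun y => ?_)
    rw [Real.norm_of_nonneg (hF.recession_nonneg _)]
    exact hF.recession_le_norm _
  have hFa : IntegrableOn (fun x => F (a x)) Ω := hF.integrable_comp ha.integrableOn
  have hFG := hF.integrable_comp (h.integrableOn_approxGrad ho ha hs)
  have hrm : AEMeasurable (fun y => ENNReal.ofReal (recession F (s y))) θ :=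
    hri.1.aemeasurable.ennreal_ofReal
  have hpt : ∀ x ∈ Ω, ENNReal.ofReal (F (approxGrad θ s A ψ x)) ≤
      ENNReal.ofReal (F (a x)) + ENNReal.ofReal ν * ‖A x - a x‖ₑ +
        ∫⁻ y, ψ x y * ENNReal.ofReal (recession F (s y)) ∂θ := by
    intro x hx
    set B := ∫ y, (ψ x y).toReal • s y ∂θ with hB
    -- For given `x` the slope `Q` is constant in `y`, so `⟪Q, ·⟫` passes under the integral that
    -- defines `B`, where it is bounded by the recession function.
    set Q := gradient F (A x + B) with hQ
    have h1 : F (A x + B) ≤ F (A x) + ⟪Q, B⟫ := hF.add_le _ _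
    have h2 : F (A x) ≤ F (a x) + ν * ‖A x - a x‖ := by
      linarith [(le_abs_self _).trans (hF.abs_sub_le (A x) (a x))]
    have h3 : ⟪Q, B⟫ ≤ ∫ y, (ψ x y).toReal * recession F (s y) ∂θ := by
      rw [hB, ← integral_inner (h.integrable_kernel_smul hs hx)]
      refine integral_mono ((h.integrable_kernel_smul hs hx).const_inner Q)
        (h.integrable_kernel_smul hri hx) fun y => ?_
      simp only [inner_smul_right]
      exact mul_le_mul_of_nonneg_left (hF.inner_gradient_le_recession _ _) ENNReal.toReal_nonneg
    have h4 : ENNReal.ofReal (∫ y, (ψ x y).toReal * recession F (s y) ∂θ) =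
        ∫⁻ y, ψ x y * ENNReal.ofReal (recession F (s y)) ∂θ := by
      have hi : Integrable (fun y => (ψ x y).toReal * recession F (s y)) θ :=
        h.integrable_kernel_smul hri hx
      rw [ofReal_integral_eq_lintegral_ofReal hi
        (ae_of_all _ fun y => mul_nonneg ENNReal.toReal_nonneg (hF.recession_nonneg _))]
      refine lintegral_congr fun y => ?_
      rw [ENNReal.ofReal_mul ENNReal.toReal_nonneg,
        ENNReal.ofReal_toReal (h.kernel_ne_top hx y)]
    rw [← h4, ← ofReal_norm, ← ENNReal.ofReal_mul hF.pos.le,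
      ← ENNReal.ofReal_add (hF.nonneg _) (mul_nonneg hF.pos.le (norm_nonneg _)),
      ← ENNReal.ofReal_add (add_nonneg (hF.nonneg _) (mul_nonneg hF.pos.le (norm_nonneg _)))
        (integral_nonneg fun y => mul_nonneg ENNReal.toReal_nonneg (hF.recession_nonneg _))]
    exact ENNReal.ofReal_le_ofReal (show F (A x + B) ≤ _ by linarith)
  have key : ENNReal.ofReal (∫ x in Ω, F (approxGrad θ s A ψ x)) ≤
      ENNReal.ofReal (∫ x in Ω, F (a x)) + ENNReal.ofReal ν * ENNReal.ofReal ε +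
        ENNReal.ofReal (∫ y, recession F (s y) ∂θ) := by
    rw [ofReal_integral_eq_lintegral_ofReal hFG (ae_of_all _ fun x => hF.nonneg _),
      ofReal_integral_eq_lintegral_ofReal hFa (ae_of_all _ fun x => hF.nonneg _),
      ofReal_integral_eq_lintegral_ofReal hri (ae_of_all _ fun x => hF.recession_nonneg _)]
    -- Tonelli and the bound one for the mass of `ψ` in `x` turn the kernel term into `∫ F^∞(s) dθ`.
    refine (setLIntegral_mono' ho.measurableSet hpt).trans ?_
    rw [lintegral_add_right' _ (h.aemeasurable_lintegral_kernel hrm),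
      lintegral_add_left' hFa.1.aemeasurable.ennreal_ofReal,
      lintegral_const_mul' _ _ ENNReal.ofReal_ne_top]
    exact add_le_add (add_le_add le_rfl (mul_le_mul_right h.lintegral_grad_sub_le _))
      (h.lintegral_lintegral_kernel_le hrm)
  rw [← ENNReal.ofReal_mul hF.pos.le] at key
  have p1 : 0 ≤ ∫ x in Ω, F (a x) := integral_nonneg fun _ => hF.nonneg _
  have p2 : 0 ≤ ν * ε := mul_nonneg hF.pos.le hε
  have p3 : 0 ≤ ∫ y, recession F (s y) ∂θ := integral_nonneg fun _ => hF.recession_nonneg _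
  rw [← ENNReal.ofReal_add p1 p2, ← ENNReal.ofReal_add (add_nonneg p1 p2) p3] at key
  exact (ENNReal.ofReal_le_ofReal_iff (add_nonneg (add_nonneg p1 p2) p3)).1 key

end IsSmoothApprox

/-- The mollified singular part is small away from a set of small measure: the gradients of
sufficiently good approximations are close to `a` in measure. -/
theorem exists_approxGrad_close {a s : Dom n → Tens n M} {θ : Measure (Dom n)}
    [IsFiniteMeasure θ] (hθ : θ ⟂ₘ volume) (hs : Integrable s θ)
    {η : ℝ} (hη : 0 < η) : ∃ ε₀ > 0, ∀ ε ≤ ε₀, ∀ (u w : Dom n → Val M) (A : Dom n → Tens n M)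
      (ψ : Dom n → Dom n → ℝ≥0∞), IsSmoothApprox Ω u a θ s ε w A ψ → IsOpen Ω → Integrable a →
      volume (Ω ∩ {x | η ≤ ‖approxGrad θ s A ψ x - a x‖}) ≤ ENNReal.ofReal η := by
  obtain ⟨S, hSm, hSθ, hSv⟩ := hθ
  set κ : Measure (Dom n) := θ.withDensity fun y => ‖s y‖ₑ with hκ
  have : IsFiniteMeasure κ := ⟨by
    rw [hκ, withDensity_apply _ MeasurableSet.univ, Measure.restrict_univ]; exact hs.2⟩
  have hκS : κ S = 0 := withDensity_absolutelyContinuous _ _ hSθ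
  -- Markov's inequality at height `η / 2` turns an `L¹` norm of at most `τ` into an exceptional set
  -- of measure at most `η / 4`.
  set τ : ℝ := η / 2 * (η / 4) with hτ
  have hτ0 : 0 < τ := by positivity
  -- Inner regularity: up to mass `τ`, the singular part is carried by a compact Lebesgue null set
  -- `T`, whose thin neighbourhoods have small measure.
  obtain ⟨T, hTS, hTc, hTκ⟩ := hSm.compl.exists_isCompact_sdiff_lt (measure_ne_top κ _)
    (show ENNReal.ofReal τ ≠ 0 by simpa using hτ0)
  have hκT : κ Tᶜ ≤ ENNReal.ofReal τ := by
    have : Tᶜ ⊆ (Sᶜ \ T) ∪ S := fun x hx => by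
      by_cases hxS : x ∈ S
      · exact Or.inr hxS
      · exact Or.inl ⟨hxS, hx⟩
    refine (measure_mono this).trans ((measure_union_le _ _).trans ?_)
    rw [hκS, add_zero]
    exact hTκ.le
  have hTv : volume T = 0 := measure_mono_null hTS hSv
  obtain ⟨δ, hδ, hδv⟩ : ∃ δ > 0, volume (Metric.cthickening δ T) ≤ ENNReal.ofReal (η / 4) := by
    have h1 := tendsto_measure_cthickening_of_isCompact (μ := (volume : Measure (Dom n))) hTc
    rw [hTv] at h1
    have h2 := (h1.mono_left (nhdsWithin_le_nhds (s := Ioi 0))).eventually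
      (ge_mem_nhds (show (0 : ℝ≥0∞) < ENNReal.ofReal (η / 4) by simpa using hη))
    obtain ⟨δ, hδ, hδ0⟩ := (h2.and self_mem_nhdsWithin).exists
    exact ⟨δ, hδ0, hδ⟩
  refine ⟨min δ τ, lt_min hδ hτ0, fun ε hε u w A ψ h ho ha => ?_⟩
  set β : Dom n → ℝ≥0∞ := fun x => ∫⁻ y, ψ x y * Tᶜ.indicator (fun y => ‖s y‖ₑ) y ∂θ with hβ
  have hsm : AEMeasurable (Tᶜ.indicator fun y => ‖s y‖ₑ) θ :=
    hs.1.enorm.indicator hTc.measurableSet.compl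
  have hβint : ∫⁻ x in Ω, β x ≤ ENNReal.ofReal τ := by
    refine (h.lintegral_lintegral_kernel_le hsm).trans ?_
    rw [lintegral_indicator hTc.measurableSet.compl, ← withDensity_apply _ hTc.measurableSet.compl]
    exact hκT
  have hAint : ∫⁻ x in Ω, ‖A x - a x‖ₑ ≤ ENNReal.ofReal τ :=
    h.lintegral_grad_sub_le.trans (ENNReal.ofReal_le_ofReal (hε.trans (min_le_right _ _)))
  have hη2 : ENNReal.ofReal (η / 2) ≠ 0 := by simpa using hη
  have hmarkov : ENNReal.ofReal τ / ENNReal.ofReal (η / 2) = ENNReal.ofReal (η / 4) := by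
    rw [← ENNReal.ofReal_div_of_pos (half_pos hη), hτ, mul_div_cancel_left₀ _ (half_pos hη).ne']
  have m1 : volume.restrict Ω {x | ENNReal.ofReal (η / 2) ≤ β x} ≤ ENNReal.ofReal (η / 4) := by
    rw [← hmarkov]
    exact (meas_ge_le_lintegral_div (h.aemeasurable_lintegral_kernel hsm) hη2
      ENNReal.ofReal_ne_top).trans (ENNReal.div_le_div_right hβint _)
  have m2 : volume.restrict Ω {x | ENNReal.ofReal (η / 2) ≤ ‖A x - a x‖ₑ} ≤
      ENNReal.ofReal (η / 4) := by
    rw [← hmarkov]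
    exact (meas_ge_le_lintegral_div (h.aestronglyMeasurable.sub ha.1.restrict).enorm hη2
      ENNReal.ofReal_ne_top).trans (ENNReal.div_le_div_right hAint _)
  rw [Measure.restrict_apply' ho.measurableSet] at m1 m2
  have hsub : Ω ∩ {x | η ≤ ‖approxGrad θ s A ψ x - a x‖} ⊆ Metric.cthickening δ T ∪
      (({x | ENNReal.ofReal (η / 2) ≤ β x} ∩ Ω) ∪
        ({x | ENNReal.ofReal (η / 2) ≤ ‖A x - a x‖ₑ} ∩ Ω)) := by
    rintro x ⟨hx, hxη : η ≤ _⟩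
    by_contra hcon
    simp only [mem_union, mem_inter_iff, mem_ofPred_eq, not_or, not_and_or, hx, not_true_eq_false,
      or_false, not_le] at hcon
    obtain ⟨hx1, hx2, hx3⟩ := hcon
    have hB : ‖∫ y, (ψ x y).toReal • s y ∂θ‖ₑ ≤ β x := by
      refine (h.enorm_integral_le hx).trans (lintegral_mono fun y => ?_)
      by_cases hy : y ∈ T
      · have : ψ x y = 0 := h.kernel_eq_zero x y <| by
          by_contra hd
          exact hx1 (Metric.mem_cthickening_of_dist_le x y δ T hy
            ((not_le.1 hd).le.trans (hε.trans (min_le_left _ _))))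
        simp [this]
      · simp [hy]
    have hlt : ‖approxGrad θ s A ψ x - a x‖ₑ < ENNReal.ofReal (η / 2) + ENNReal.ofReal (η / 2) := by
      have e : approxGrad θ s A ψ x - a x = (A x - a x) + ∫ y, (ψ x y).toReal • s y ∂θ := by
        rw [approxGrad]; abel
      rw [e]
      exact (enorm_add_le _ _).trans_lt (ENNReal.add_lt_add hx3 (hB.trans_lt hx2))
    rw [← ENNReal.ofReal_add (half_pos hη).le (half_pos hη).le, add_halves, ← ofReal_norm] at hlt
    exact absurd (ENNReal.ofReal_le_ofReal hxη) (not_le.2 hlt)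
  refine (measure_mono hsub).trans ((measure_union_le _ _).trans ?_)
  refine (add_le_add hδv ((measure_union_le _ _).trans (add_le_add m1 m2))).trans ?_
  rw [← ENNReal.ofReal_add (by positivity) (by positivity),
    ← ENNReal.ofReal_add (by positivity) (by positivity)]
  exact ENNReal.ofReal_le_ofReal (by linarith)

end Inpainting

/-! ### Smooth truncation and choice of the level. -/

namespace Inpainting

variable {n M : ℕ} {Ω D : Set (Dom n)}

section Truncation

/-- A smooth cut-off function, equal to `1` on the unit ball and supported in the ball of
radius `2`. -/
noncomputable def cutoff (M : ℕ) : ContDiffBump (0 : Val M) := ⟨1, 2, one_pos, one_lt_two⟩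

/-- The smooth truncation at height `r`. -/
noncomputable def truncate (r : ℝ) (y : Val M) : Val M := cutoff M (r⁻¹ • y) • y

variable {r : ℝ}

theorem contDiff_truncate (r : ℝ) : ContDiff ℝ 1 (truncate r : Val M → Val M) :=
  ((cutoff M).contDiff.comp (contDiff_const_smul r⁻¹)).smul contDiff_id

theorem truncate_eq_self (hr : 0 < r) {y : Val M} (hy : ‖y‖ ≤ r) : truncate r y = y := by
  have : cutoff M (r⁻¹ • y) = 1 := (cutoff M).one_of_mem_closedBall <| by
    rw [mem_closedBall_zero_iff, norm_smul, Real.norm_of_nonneg (inv_nonneg.2 hr.le)]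
    exact (inv_mul_le_iff₀ hr).2 (by simpa [cutoff] using hy)
  rw [truncate, this, one_smul]

theorem truncate_eq_zero (hr : 0 < r) {y : Val M} (hy : 2 * r ≤ ‖y‖) : truncate r y = 0 := by
  have : cutoff M (r⁻¹ • y) = 0 := (cutoff M).zero_of_le_dist <| by
    rw [dist_zero_right, norm_smul, Real.norm_of_nonneg (inv_nonneg.2 hr.le)]
    exact (le_inv_mul_iff₀ hr).2 (by simpa [cutoff, mul_comm] using hy)
  rw [truncate, this, zero_smul]

theorem norm_truncate_le (r : ℝ) (y : Val M) : ‖truncate r y‖ ≤ ‖y‖ := by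
  rw [truncate, norm_smul, Real.norm_of_nonneg (cutoff M).nonneg]
  exact mul_le_of_le_one_left (norm_nonneg _) (cutoff M).le_one

theorem norm_truncate_le_two_mul (hr : 0 < r) (y : Val M) : ‖truncate r y‖ ≤ 2 * r := by
  rcases le_total (2 * r) ‖y‖ with h | h
  · rw [truncate_eq_zero hr h, norm_zero]; positivity
  · exact (norm_truncate_le r y).trans h

/-- All truncations are rescalings of one map, so the bound for their derivatives does not depend on
`r`. -/
theorem fderiv_truncate (hr : 0 < r) (y : Val M) :
    fderiv ℝ (truncate r) y = fderiv ℝ (truncate 1) (r⁻¹ • y) := by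
  have e : (truncate r : Val M → Val M) = fun y => r • truncate 1 (r⁻¹ • y) := by
    funext y
    simp only [truncate, inv_one, one_smul]
    rw [smul_comm, smul_smul r, mul_inv_cancel₀ hr.ne', one_smul]
  have h1 : HasFDerivAt (truncate 1 : Val M → Val M) (fderiv ℝ (truncate 1) (r⁻¹ • y)) (r⁻¹ • y) :=
    ((contDiff_truncate 1).differentiable (by simp) _).hasFDerivAt
  have h2 := (h1.comp y ((hasFDerivAt_id y).const_smul r⁻¹)).const_smul r
  rw [e]
  refine HasFDerivAt.fderiv (h2.congr_fderiv ?_)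
  ext v
  simp [smul_smul, hr.ne']

theorem exists_norm_fderiv_truncate_le (M : ℕ) : ∃ C : ℝ, 0 < C ∧ ∀ r > 0, ∀ y : Val M,
    ‖fderiv ℝ (truncate r) y‖ ≤ C := by
  have hs : HasCompactSupport (truncate 1 : Val M → Val M) := by
    refine HasCompactSupport.intro (isCompact_closedBall (0 : Val M) 2) fun y hy => ?_
    rw [mem_closedBall_zero_iff, not_le] at hy
    exact truncate_eq_zero one_pos (by linarith)
  obtain ⟨C, hC⟩ := (hs.fderiv (𝕜 := ℝ)).exists_bound_of_continuous
    ((contDiff_truncate 1).continuous_fderiv (by simp))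
  refine ⟨max C 1, lt_max_of_lt_right one_pos, fun r hr y => ?_⟩
  rw [fderiv_truncate hr]
  exact (hC _).trans (le_max_left _ _)

theorem fderiv_truncate_eq_id (hr : 0 < r) {y : Val M} (hy : ‖y‖ < r) :
    fderiv ℝ (truncate r) y = ContinuousLinearMap.id ℝ (Val M) := by
  have : (truncate r : Val M → Val M) =ᶠ[𝓝 y] id := by
    filter_upwards [continuous_norm.continuousAt.eventually_lt continuousAt_const hy] with z hz
    exact truncate_eq_self hr hz.le
  rw [this.fderiv_eq, fderiv_id]

theorem fderiv_truncate_eq_zero (hr : 0 < r) {y : Val M} (hy : 2 * r < ‖y‖) :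
    fderiv ℝ (truncate r) y = 0 := by
  have : (truncate r : Val M → Val M) =ᶠ[𝓝 y] fun _ => 0 := by
    filter_upwards [continuousAt_const.eventually_lt continuous_norm.continuousAt hy] with z hz
    exact truncate_eq_zero hr hz.le
  rw [this.fderiv_eq, fderiv_const_apply]

/-- The composition of a linear map with (the linear map with matrix) `P`. -/
noncomputable def compTens (L : Val M →L[ℝ] Val M) (P : Tens n M) : Tens n M :=
  WithLp.toLp 2 fun p => L (WithLp.toLp 2 fun i => P (i, p.2)) p.1

theorem compTens_id (P : Tens n M) : compTens (ContinuousLinearMap.id ℝ (Val M)) P = P := by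
  ext p; rfl

theorem compTens_zero (P : Tens n M) : compTens (0 : Val M →L[ℝ] Val M) P = 0 := by
  ext p; rfl

/-- `L` acts on each column separately, and the squared norm is the sum over the columns. -/
theorem norm_compTens_le (L : Val M →L[ℝ] Val M) (P : Tens n M) :
    ‖compTens L P‖ ≤ ‖L‖ * ‖P‖ := by
  refine le_of_sq_le_sq ?_ (by positivity)
  rw [mul_pow, EuclideanSpace.real_norm_sq_eq, EuclideanSpace.real_norm_sq_eq,
    Fintype.sum_prod_type_right, Fintype.sum_prod_type_right, Finset.mul_sum]
  refine Finset.sum_le_sum fun j _ => ?_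
  have h := L.le_opNorm (WithLp.toLp 2 fun i => P (i, j))
  have h2 := pow_le_pow_left₀ (norm_nonneg _) h 2
  rw [mul_pow, EuclideanSpace.real_norm_sq_eq, EuclideanSpace.real_norm_sq_eq] at h2
  exact h2

end Truncation

section TruncatedCompetitor

variable {w : Dom n → Val M} {G : Dom n → Tens n M} {r : ℝ}

theorem norm_compTens_truncate_le {C : ℝ} (hC : ∀ r > 0, ∀ y : Val M, ‖fderiv ℝ (truncate r) y‖ ≤ C)
    (hr : 0 < r) (y : Val M) (P : Tens n M) :
    ‖compTens (fderiv ℝ (truncate r) y) P‖ ≤ C * ‖P‖ :=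
  (norm_compTens_le _ _).trans (mul_le_mul_of_nonneg_right (hC r hr _) (norm_nonneg _))

/-- Truncation turns functions that are smooth in `Ω` into competitors. -/
theorem isCompetitor_truncate [IsFiniteMeasure (volume.restrict Ω)] (ho : IsOpen Ω)
    (hw : ∀ x ∈ Ω, ContDiffAt ℝ 1 w x)
    (hG : ∀ x ∈ Ω, ∀ i j, fderiv ℝ w x (EuclideanSpace.single j 1) i = G x (i, j))
    (hGi : IntegrableOn G Ω) (hr : 0 < r) (ζ : ℝ) :
    IsCompetitor Ω D ζ (fun x => truncate r (w x))
      (fun x => compTens (fderiv ℝ (truncate r) (w x)) (G x)) := by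
  obtain ⟨C, -, hC⟩ := exists_norm_fderiv_truncate_le M
  have hT : ∀ x ∈ Ω, ContDiffAt ℝ 1 (fun x => truncate r (w x)) x := fun x hx =>
    (contDiff_truncate r).contDiffAt.comp x (hw x hx)
  have hH : ∀ x ∈ Ω, ∀ i j, fderiv ℝ (fun x => truncate r (w x)) x (EuclideanSpace.single j 1) i =
      compTens (fderiv ℝ (truncate r) (w x)) (G x) (i, j) := fun x hx i j => by
    have h1 : HasFDerivAt (fun x => truncate r (w x))
        ((fderiv ℝ (truncate r) (w x)).comp (fderiv ℝ w x)) x :=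
      ((contDiff_truncate r).differentiable (by simp) _).hasFDerivAt.comp x
        ((hw x hx).differentiableAt (by simp)).hasFDerivAt
    have h2 : fderiv ℝ w x (EuclideanSpace.single j 1) = WithLp.toLp 2 fun i => G x (i, j) := by
      ext i; exact hG x hx i j
    rw [h1.fderiv, ContinuousLinearMap.comp_apply, h2]
    rfl
  have hTm : AEStronglyMeasurable (fun x => truncate r (w x)) (volume.restrict Ω) :=
    ContinuousOn.aestronglyMeasurable
      (fun x hx => (hT x hx).continuousAt.continuousWithinAt) ho.measurableSet
  have hmem : ∀ p : ℝ≥0∞, MemLp (fun x => truncate r (w x)) p (volume.restrict Ω) := fun p =>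
    MemLp.of_bound hTm (2 * r) (ae_of_all _ fun x => norm_truncate_le_two_mul hr _)
  refine ⟨.of_contDiffAt ho (fun x hx => (hT x hx).differentiableAt (by simp)) hH
    (memLp_one_iff_integrable.1 (hmem 1)) ?_,
    (hmem _).mono_measure (Measure.restrict_mono sdiff_subset le_rfl)⟩
  exact (hGi.norm.const_mul C).mono'
    ((continuousOn_of_fderiv_eq hT hH).aestronglyMeasurable ho.measurableSet)
    (ae_of_all _ fun x => norm_compTens_truncate_le hC hr _ _)

/-- Truncation increases the energy at most by a contribution from the level sets between `r` and
`2 r`. -/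
theorem integral_truncate_le {F : Tens n M → ℝ} {ν : ℝ} (hF : IsIntegrand F ν) {C : ℝ}
    (hC : ∀ r > 0, ∀ y : Val M, ‖fderiv ℝ (truncate r) y‖ ≤ C)
    (hwm : AEStronglyMeasurable w (volume.restrict Ω)) (hGi : IntegrableOn G Ω) (hr : 0 < r) :
    ∫ x in Ω, F (compTens (fderiv ℝ (truncate r) (w x)) (G x)) ≤ (∫ x in Ω, F (G x)) +
      ν * C * ∫ x in Ω, (Icc r (2 * r)).indicator 1 ‖w x‖ * ‖G x‖ := by
  have hC0 : 0 ≤ C := (norm_nonneg _).trans (hC 1 one_pos 0)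
  have hi : IntegrableOn (fun x => (Icc r (2 * r)).indicator (1 : ℝ → ℝ) ‖w x‖ * ‖G x‖) Ω := by
    refine hGi.norm.bdd_mul (c := 1) ?_ (ae_of_all _ fun x => ?_)
    · exact ((measurable_const.indicator measurableSet_Icc).comp_aemeasurable
        hwm.norm.aemeasurable).aestronglyMeasurable
    · by_cases h : ‖w x‖ ∈ Icc r (2 * r) <;> simp [h]
  rw [← integral_const_mul, ← integral_add (hF.integrable_comp hGi) (hi.const_mul _)]
  refine integral_mono_of_nonneg (ae_of_all _ fun x => hF.nonneg _)
    ((hF.integrable_comp hGi).add (hi.const_mul _)) (ae_of_all _ fun x => ?_)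
  change F _ ≤ F (G x) + ν * C * _
  by_cases h : ‖w x‖ ∈ Icc r (2 * r)
  · rw [indicator_of_mem h, Pi.one_apply, one_mul, mul_assoc]
    refine (hF.le_norm _).trans ((mul_le_mul_of_nonneg_left
      (norm_compTens_truncate_le hC hr _ _) hF.pos.le).trans ?_)
    exact le_add_of_nonneg_left (hF.nonneg _)
  · rw [indicator_of_notMem h, zero_mul, mul_zero, add_zero]
    rw [mem_Icc, not_and_or, not_le, not_le] at h
    rcases h with h | h
    · rw [fderiv_truncate_eq_id hr h, compTens_id]
    · rw [fderiv_truncate_eq_zero hr h, compTens_zero, hF.zero]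
      exact hF.nonneg _

/-- Among sufficiently many disjoint level ranges, one carries only a small part of the gradient. -/
theorem exists_level_integral_le (hwm : AEStronglyMeasurable w (volume.restrict Ω))
    (hGi : IntegrableOn G Ω) {N : ℕ} (hN : 0 < N) {r₀ : ℝ} (hr₀ : 0 < r₀) :
    ∃ j < N, ∫ x in Ω, (Icc (r₀ * 3 ^ j) (2 * (r₀ * 3 ^ j))).indicator 1 ‖w x‖ * ‖G x‖ ≤
      (∫ x in Ω, ‖G x‖) / N := by
  -- Levels grow by the factor `3 > 2`, so the closed ranges from `r` to `2 r` are disjoint and the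
  -- average over `N` of them is at most `1 / N` of the total.
  set χ : ℕ → ℝ → ℝ := fun j => (Icc (r₀ * 3 ^ j) (2 * (r₀ * 3 ^ j))).indicator 1 with hχ
  have hi : ∀ j, IntegrableOn (fun x => χ j ‖w x‖ * ‖G x‖) Ω := fun j => by
    refine hGi.norm.bdd_mul (c := 1) ?_ (ae_of_all _ fun x => ?_)
    · exact ((measurable_const.indicator measurableSet_Icc).comp_aemeasurable
        hwm.norm.aemeasurable).aestronglyMeasurable
    · by_cases h : ‖w x‖ ∈ Icc (r₀ * 3 ^ j) (2 * (r₀ * 3 ^ j)) <;> simp [hχ, h]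
  have hdisj : ∀ i j t, i < j → χ i t ≠ 0 → χ j t = 0 := fun i j t hij h => by
    have h1 : t ≤ 2 * (r₀ * 3 ^ i) := (mem_of_indicator_ne_zero h).2
    refine indicator_of_notMem (fun h2 => ?_) _
    have h3 : (3 : ℝ) ^ (i + 1) ≤ 3 ^ j := pow_le_pow_right₀ (by norm_num) hij
    have h4 := mul_le_mul_of_nonneg_left h3 hr₀.le
    have h5 : 0 < r₀ * 3 ^ i := by positivity
    rw [pow_succ] at h4
    linarith [h2.1]
  have hsum : ∀ t, ∑ j ∈ Finset.range N, χ j t ≤ 1 := fun t => by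
    by_cases h : ∃ i ∈ Finset.range N, χ i t ≠ 0
    · obtain ⟨i, hiN, hi⟩ := h
      rw [Finset.sum_eq_single_of_mem i hiN fun j _ hj => ?_]
      · exact indicator_le_self' (fun _ _ => zero_le_one) t |>.trans le_rfl
      · rcases lt_or_gt_of_ne hj with hlt | hlt
        · by_contra hne
          exact hi (hdisj j i t hlt hne)
        · exact hdisj i j t hlt hi
    · push Not at h
      rw [Finset.sum_eq_zero h]; exact zero_le_one
  have hle : ∑ j ∈ Finset.range N, ∫ x in Ω, χ j ‖w x‖ * ‖G x‖ ≤
      ∑ _j ∈ Finset.range N, (∫ x in Ω, ‖G x‖) / N := by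
    rw [← integral_finsetSum _ fun j _ => hi j, Finset.sum_const, Finset.card_range, nsmul_eq_mul,
      mul_div_cancel₀ _ (by exact_mod_cast hN.ne')]
    refine integral_mono (integrable_finsetSum _ fun j _ => hi j) hGi.norm fun x => ?_
    simp only [← Finset.sum_mul]
    exact mul_le_of_le_one_left (norm_nonneg _) (hsum _)
  obtain ⟨j, hj, h⟩ := Finset.exists_le_of_sum_le (by simpa using hN.ne') hle
  exact ⟨j, Finset.mem_range.1 hj, h⟩

end TruncatedCompetitor

section Data

variable {f : Dom n → Val M} {l ζ : ℝ}

/-- Dominated convergence, for a general filter since it is used both for levels tending to infinity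
and along sequences. -/
theorem tendsto_dataTerm (hζ : 1 < ζ)
    (hf : MemLp f (ENNReal.ofReal ζ) (volume.restrict (Ω \ D))) {ι : Type*} {L : Filter ι}
    [L.IsCountablyGenerated] {v : ι → Dom n → Val M} {u : Dom n → Val M} {b : Dom n → ℝ}
    (hv : ∀ i, AEStronglyMeasurable (v i) (volume.restrict (Ω \ D)))
    (hb : MemLp b (ENNReal.ofReal ζ) (volume.restrict (Ω \ D))) (hvb : ∀ i x, ‖v i x‖ ≤ b x)
    (hlim : ∀ᵐ x ∂volume.restrict (Ω \ D), Tendsto (fun i => v i x) L (𝓝 (u x))) :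
    Tendsto (fun i => dataTerm Ω D f l ζ (v i)) L (𝓝 (dataTerm Ω D f l ζ u)) := by
  have hζ0 : 0 < ζ := zero_lt_one.trans hζ
  refine Tendsto.const_mul _ (tendsto_integral_filter_of_dominated_convergence
    (fun x => ‖b x + ‖f x‖‖ ^ ζ) (.of_forall fun i => ?_) (.of_forall fun i => ae_of_all _ fun x => ?_)
    ?_ ?_)
  · exact (((hv i).sub hf.1).norm.aemeasurable.pow_const ζ).aestronglyMeasurable
  · rw [Real.norm_of_nonneg (Real.rpow_nonneg (norm_nonneg _) _)]
    exact Real.rpow_le_rpow (norm_nonneg _) ((norm_sub_le _ _).trans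
      ((add_le_add_left (hvb i x) _).trans (le_abs_self _))) hζ0.le
  · have := (hb.add hf.norm).integrable_norm_rpow (by simpa using hζ0) ENNReal.ofReal_ne_top
    simpa [ENNReal.toReal_ofReal hζ0.le] using! this
  · filter_upwards [hlim] with x hx
    exact ((hx.sub_const (f x)).norm).rpow_const (Or.inr hζ0.le)

theorem tendsto_dataTerm_truncate (hζ : 1 < ζ)
    (hf : MemLp f (ENNReal.ofReal ζ) (volume.restrict (Ω \ D))) {u : Dom n → Val M}
    (hu : MemLp u (ENNReal.ofReal ζ) (volume.restrict (Ω \ D))) :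
    Tendsto (fun r => dataTerm Ω D f l ζ fun x => truncate r (u x)) atTop
      (𝓝 (dataTerm Ω D f l ζ u)) := by
  refine tendsto_dataTerm hζ hf
    (fun r => (contDiff_truncate r).continuous.comp_aestronglyMeasurable hu.1) hu.norm
    (fun r x => norm_truncate_le _ _) (ae_of_all _ fun x => ?_)
  refine tendsto_const_nhds.congr' ?_
  filter_upwards [eventually_ge_atTop ‖u x‖, eventually_gt_atTop 0] with r hr hr0
  exact (truncate_eq_self hr0 hr).symm

/-- At a fixed level the truncations are uniformly bounded, so almost everywhere convergence
suffices and `w k` need not converge in `L^ζ`. -/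
theorem tendsto_dataTerm_truncate_seq [IsFiniteMeasure (volume.restrict Ω)] (hζ : 1 < ζ)
    (hf : MemLp f (ENNReal.ofReal ζ) (volume.restrict (Ω \ D))) {w : ℕ → Dom n → Val M}
    {u : Dom n → Val M} (hw : ∀ k, AEStronglyMeasurable (w k) (volume.restrict Ω))
    (hlim : ∀ᵐ x ∂volume.restrict Ω, Tendsto (fun k => w k x) atTop (𝓝 (u x))) {r : ℝ}
    (hr : 0 < r) :
    Tendsto (fun k => dataTerm Ω D f l ζ fun x => truncate r (w k x)) atTop
      (𝓝 (dataTerm Ω D f l ζ fun x => truncate r (u x))) := by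
  have hle : volume.restrict (Ω \ D) ≤ volume.restrict Ω := Measure.restrict_mono sdiff_subset le_rfl
  have hc := (contDiff_truncate (M := M) r).continuous
  refine tendsto_dataTerm hζ hf (fun k => hc.comp_aestronglyMeasurable ((hw k).mono_measure hle))
    ((memLp_const (2 * r)).mono_measure hle) (fun k x => norm_truncate_le_two_mul hr _) ?_
  filter_upwards [ae_mono hle hlim] with x hx
  exact (hc.tendsto _).comp hx

end Data

end Inpainting

/-! ### Approximation of `BV` functions by competitors. -/

namespace Inpainting

variable {n M : ℕ} {Ω D : Set (Dom n)}

/-- Test functions vanish outside `Ω`, so everything may be extended by zero or restricted to `Ω`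
without changing the weak formulation. -/
theorem IsBV.hasGradientParts (hΩ : MeasurableSet Ω) {u : Dom n → Val M}
    {Du : VectorMeasure (Dom n) (Tens n M)} (h : IsBV Ω u Du) :
    HasGradientParts Ω (Ω.indicator u) (Ω.indicator (acGrad Du))
      ((singGrad Du).variation.restrict Ω) (density (singGrad Du) (singGrad Du).variation) := by
  have hac : Integrable (acGrad Du) := integrable_density Du volume
  have hsg := integrable_density (singGrad Du) (singGrad Du).variation
  refine ⟨(integrable_indicator_iff hΩ).2 h.integrable, hac.indicator hΩ, hsg.restrict,
    fun φ hφ i j => ?_⟩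
  obtain ⟨C, hC⟩ := hφ.bounded
  have hi1 := hφ.integrable_smul hac
  have hi2 := hφ.integrable_smul hsg
  have e0 : ∫ x, Ω.indicator u x i * pderiv j φ x = ∫ x in Ω, u x i * pderiv j φ x := by
    rw [← integral_indicator hΩ]
    congr 1; funext x
    by_cases hx : x ∈ Ω <;> simp [hx]
  have e1 : (∫ x, φ x • acGrad Du x) (i, j) = ∫ x, φ x * Ω.indicator (acGrad Du) x (i, j) := by
    rw [integral_apply hi1]
    congr 1; funext x
    by_cases hx : x ∈ Ω
    · simp [hx]
    · simp [hx, hφ.eq_zero hx]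
  have e2 : (∫ x, φ x • density (singGrad Du) (singGrad Du).variation x
      ∂(singGrad Du).variation) (i, j) = ∫ x in Ω, φ x *
        density (singGrad Du) (singGrad Du).variation x (i, j) ∂(singGrad Du).variation := by
    rw [integral_apply hi2]
    refine (setIntegral_eq_integral_of_forall_compl_eq_zero (s := Ω) fun x hx => ?_).symm
    simp [hφ.eq_zero hx]
  rw [e0, h.distrib_grad φ hφ i j, integral_bounded_eq Du hφ.smooth.continuous.measurable hC,
    PiLp.add_apply, e1, e2]

theorem volume_norm_ge_le (ho : IsOpen Ω) {w : Dom n → Val M} (hw : IntegrableOn w Ω) {r : ℝ}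
    (hr : 0 < r) : volume (Ω ∩ {x | r ≤ ‖w x‖}) ≤ ENNReal.ofReal ((∫ x in Ω, ‖w x‖) / r) := by
  have h := meas_ge_le_lintegral_div hw.1.enorm (ENNReal.ofReal_pos.2 hr).ne' ENNReal.ofReal_ne_top
  rw [Measure.restrict_apply' ho.measurableSet, inter_comm] at h
  rw [ENNReal.ofReal_div_of_pos hr, ofReal_integral_norm_eq_lintegral_enorm hw]
  refine le_trans (measure_mono (inter_subset_inter_right _ fun x (hx : r ≤ ‖w x‖) => ?_)) h
  rw [mem_ofPred_eq, ← ofReal_norm]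
  exact ENNReal.ofReal_le_ofReal hx

/-- Every function of bounded variation is approximated, with respect to the relaxed functional, by
competitors of the primal problem whose gradients are close in measure to the absolutely continuous
part of the gradient. -/
theorem IsBV.exists_competitor_le {f : Dom n → Val M} {F : Tens n M → ℝ} {l ζ ν : ℝ}
    (hF : IsIntegrand F ν) (hζ : 1 < ζ)
    (hf : MemLp f (ENNReal.ofReal ζ) (volume.restrict (Ω \ D)))
    (hb : Bornology.IsBounded Ω) (ho : IsOpen Ω) (hne : (Ωᶜ).Nonempty) {u : Dom n → Val M}
    {Du : VectorMeasure (Dom n) (Tens n M)} (hu : IsBV Ω u Du)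
    (hm : MemLp u (ENNReal.ofReal ζ) (volume.restrict (Ω \ D))) {ε : ℝ} (hε : 0 < ε) :
    ∃ w G, IsCompetitor Ω D ζ w G ∧ primal Ω D f F l ζ w G ≤ K Ω D f F l ζ u Du + ε ∧
      volume (Ω ∩ {x | ε ≤ ‖G x - acGrad Du x‖}) ≤ ENNReal.ofReal ε := by
  have : IsFiniteMeasure (volume.restrict Ω) := ⟨by
    rw [Measure.restrict_apply_univ]; exact hb.measure_lt_top⟩
  have hΩ := ho.measurableSet
  have hP := hu.hasGradientParts hΩ
  set θ := (singGrad Du).variation.restrict Ω with hθ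
  set s := density (singGrad Du) (singGrad Du).variation with hs
  set a := Ω.indicator (acGrad Du) with ha
  have hθv : θ ⟂ₘ volume := (singGrad_variation_mutuallySingular Du).restrict Ω
  obtain ⟨ε₀, hε₀, hclose⟩ := exists_approxGrad_close (Ω := Ω) (a := a) hθv hP.integrable_sing
    (half_pos hε)
  choose w A ψ h using fun k : ℕ => hP.exists_smooth_approx hb ho hne
    (show 0 < 1 / ((k : ℝ) + 1) by positivity)
  have hε1 : ∀ k : ℕ, 1 / ((k : ℝ) + 1) ≤ 1 := fun k => by
    rw [div_le_one (by positivity)]; linarith [(Nat.cast_nonneg k : (0 : ℝ) ≤ k)]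
  set G := fun k => approxGrad θ s (A k) (ψ k) with hG
  have hwi : ∀ k, IntegrableOn (w k) Ω := fun k => (h k).integrableOn ho hP.integrable
  have hGi : ∀ k, IntegrableOn (G k) Ω := fun k =>
    (h k).integrableOn_approxGrad ho hP.integrable_ac hP.integrable_sing
  have hε_lim : Tendsto (fun k : ℕ => 1 / ((k : ℝ) + 1)) atTop (𝓝 0) :=
    tendsto_one_div_add_atTop_nhds_zero_nat
  -- a subsequence converging almost everywhere
  obtain ⟨φ, hφ, hφlim⟩ : ∃ φ : ℕ → ℕ, StrictMono φ ∧ ∀ᵐ x ∂volume.restrict Ω,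
      Tendsto (fun k => w (φ k) x) atTop (𝓝 (Ω.indicator u x)) := by
    refine TendstoInMeasure.exists_seq_tendsto_ae (tendstoInMeasure_of_tendsto_eLpNorm one_ne_zero
      (fun k => (hwi k).1) hP.integrable.1.restrict ?_)
    have hlim : Tendsto (fun k : ℕ => ENNReal.ofReal (1 / ((k : ℝ) + 1))) atTop (𝓝 0) := by
      simpa using ENNReal.tendsto_ofReal hε_lim
    refine tendsto_of_tendsto_of_tendsto_of_le_of_le tendsto_const_nhds hlim
      (fun _ => zero_le) fun k => ?_
    rw [eLpNorm_one_eq_lintegral_enorm]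
    exact (h k).lintegral_sub_le
  -- uniform bounds
  set B : ℝ := 1 + (∫ x, ‖a x‖) + ∫ y, ‖s y‖ ∂θ with hB
  have hB0 : 0 < B := by positivity
  have hGB : ∀ k, ∫ x in Ω, ‖G k x‖ ≤ B := fun k => by
    have h1 := (h k).lintegral_approxGrad_le ho hP.integrable_ac hP.integrable_sing
    rw [← ofReal_integral_norm_eq_lintegral_enorm (hGi k),
      ← ofReal_integral_norm_eq_lintegral_enorm hP.integrable_ac,
      ← ofReal_integral_norm_eq_lintegral_enorm hP.integrable_sing,
      ← ENNReal.ofReal_add (by positivity) (by positivity),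
      ← ENNReal.ofReal_add (by positivity) (by positivity)] at h1
    refine ((ENNReal.ofReal_le_ofReal_iff (by positivity)).1 h1).trans ?_
    linarith [hε1 k]
  set B' : ℝ := 1 + ∫ x in Ω, ‖Ω.indicator u x‖ with hB'
  have hB'0 : 0 < B' := by positivity
  have hwB : ∀ k, ∫ x in Ω, ‖w k x‖ ≤ B' := fun k => by
    have hd : IntegrableOn (fun x => w k x - Ω.indicator u x) Ω :=
      (hwi k).sub hP.integrable.integrableOn
    have h1 := (h k).lintegral_sub_le
    rw [← ofReal_integral_norm_eq_lintegral_enorm hd,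
      ENNReal.ofReal_le_ofReal_iff (by positivity)] at h1
    calc ∫ x in Ω, ‖w k x‖ ≤ ∫ x in Ω, (‖w k x - Ω.indicator u x‖ + ‖Ω.indicator u x‖) := by
          refine integral_mono (hwi k).norm (hd.norm.add hP.integrable.integrableOn.norm)
            fun x => ?_
          simpa using norm_add_le (w k x - Ω.indicator u x) (Ω.indicator u x)
      _ = _ := integral_add hd.norm hP.integrable.integrableOn.norm
      _ ≤ _ := add_le_add_left (h1.trans (hε1 k)) _
  -- the truncation levels
  obtain ⟨C, hC0, hC⟩ := exists_norm_fderiv_truncate_le M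
  have hν := hF.pos
  -- The energy budget is four times `ε / 4`: mollification, the transition range of the truncation,
  -- truncation of `u` in the data term, and the passage from `w` to `u` there. This `N` settles the
  -- second item.
  obtain ⟨N, hN⟩ := exists_nat_gt (ν * C * B / (ε / 4))
  have hN0 : 0 < N := by
    have : (0 : ℝ) < N := lt_of_le_of_lt (by positivity) hN
    exact_mod_cast this
  have hNε : ν * C * (B / N) ≤ ε / 4 := by
    rw [div_lt_iff₀ (by positivity)] at hN
    rw [← mul_div_assoc, div_le_iff₀ (by exact_mod_cast hN0)]
    linarith
  have hε4 : 0 < ε / 4 := by positivity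
  -- The lowest level is so high that truncating `u` hardly changes the data term and that `w`
  -- exceeds it only on a set of measure at most `ε / 2`.
  obtain ⟨r₀, hr₀, hr₀d, hr₀m⟩ : ∃ r₀ > 0, (∀ r ≥ r₀, (dataTerm Ω D f l ζ fun x => truncate r (u x)) ≤
      dataTerm Ω D f l ζ u + ε / 4) ∧ B' / r₀ ≤ ε / 2 := by
    have h1 := (tendsto_dataTerm_truncate (l := l) hζ hf hm).eventually_lt_const
      (show dataTerm Ω D f l ζ u < dataTerm Ω D f l ζ u + ε / 4 by linarith)
    obtain ⟨r₁, hr₁⟩ := eventually_atTop.1 h1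
    refine ⟨max r₁ (max 1 (B' / (ε / 2))), by positivity, fun r hr =>
      (hr₁ r ((le_max_left _ _).trans hr)).le, ?_⟩
    rw [div_le_iff₀ (by positivity), ← div_le_iff₀' (by positivity)]
    exact (le_max_right _ _).trans (le_max_right _ _)
  have hr : ∀ j, 0 < r₀ * 3 ^ j := fun j => by positivity
  have hr_ge : ∀ j : ℕ, r₀ ≤ r₀ * 3 ^ j := fun j =>
    le_mul_of_one_le_right hr₀.le (one_le_pow₀ (by norm_num))
  -- the choice of the approximation
  have hu_eq : ∀ r, (dataTerm Ω D f l ζ fun x => truncate r (Ω.indicator u x)) =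
      dataTerm Ω D f l ζ fun x => truncate r (u x) := fun r => by
    simp only [dataTerm]
    congr 1
    refine integral_congr_ae ?_
    filter_upwards [ae_mono (Measure.restrict_mono sdiff_subset le_rfl) (ae_restrict_mem hΩ)]
      with x hx
    simp only [indicator_of_mem hx]
  -- The good level is known only once `k` is fixed, so the data term is controlled at all `N`
  -- levels at once.
  have hev : ∀ᶠ k in atTop, ∀ j ∈ Finset.range N,
      (dataTerm Ω D f l ζ fun x => truncate (r₀ * 3 ^ j) (w (φ k) x)) ≤
        dataTerm Ω D f l ζ u + ε / 4 + ε / 4 := by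
    rw [Filter.eventually_all_finset]
    intro j _
    have h1 := tendsto_dataTerm_truncate_seq (l := l) hζ hf (fun k => (hwi (φ k)).1) hφlim (hr j)
    rw [hu_eq] at h1
    have h2 := hr₀d _ (hr_ge j)
    filter_upwards [h1.eventually_lt_const (lt_add_of_pos_right _ hε4)] with k hk
    linarith
  have hε_lim' := hε_lim.comp hφ.tendsto_atTop
  obtain ⟨k, hk, hk1, hk2⟩ := (hev.and ((hε_lim'.eventually_le_const hε₀).and
    (hε_lim'.eventually_le_const (show 0 < ε / 4 / ν by positivity)))).exists
  simp only [Function.comp_apply] at hk1 hk2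
  obtain ⟨j, hj, hjle⟩ := exists_level_integral_le (hwi (φ k)).1 (hGi (φ k)) hN0 hr₀
  set r := r₀ * 3 ^ j with hrdef
  refine ⟨fun x => truncate r (w (φ k) x),
    fun x => compTens (fderiv ℝ (truncate r) (w (φ k) x)) (G (φ k) x),
    isCompetitor_truncate ho (h (φ k)).contDiffAt (h (φ k)).fderiv_eq (hGi (φ k)) (hr j) ζ, ?_, ?_⟩
  · have h1 := integral_truncate_le hF hC (hwi (φ k)).1 (hGi (φ k)) (hr j)
    have h2 := (h (φ k)).integral_energy_le hF (by positivity) ho hP.integrable_ac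
      hP.integrable_sing
    have h3 := hk j (Finset.mem_range.2 hj)
    have h4 : ν * C * ∫ x in Ω, (Icc r (2 * r)).indicator 1 ‖w (φ k) x‖ * ‖G (φ k) x‖ ≤ ε / 4 := by
      refine (mul_le_mul_of_nonneg_left (hjle.trans ?_) (by positivity)).trans hNε
      exact div_le_div_of_nonneg_right (hGB _) (Nat.cast_nonneg _)
    have h5 : ν * (1 / ((φ k : ℝ) + 1)) ≤ ε / 4 := by rwa [le_div_iff₀' hν] at hk2
    have h6 : ∫ x in Ω, F (a x) = ∫ x in Ω, F (acGrad Du x) :=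
      setIntegral_congr_fun hΩ fun x hx => by simp only [ha, indicator_of_mem hx]
    rw [h6] at h2
    simp only [primal, K]
    linarith
  · have m1 := hclose _ hk1 _ _ _ _ (h (φ k)) ho hP.integrable_ac
    have m2 := volume_norm_ge_le ho (hwi (φ k)) (hr j)
    have m3 : (∫ x in Ω, ‖w (φ k) x‖) / r ≤ ε / 2 :=
      (div_le_div₀ hB'0.le (hwB _) hr₀ (hr_ge j)).trans hr₀m
    have hsub : Ω ∩ {x | ε ≤ ‖compTens (fderiv ℝ (truncate r) (w (φ k) x)) (G (φ k) x) -
        acGrad Du x‖} ⊆ (Ω ∩ {x | ε / 2 ≤ ‖G (φ k) x - a x‖}) ∪ (Ω ∩ {x | r ≤ ‖w (φ k) x‖}) := by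
      rintro x ⟨hx, hxε⟩
      -- Below the level the truncation is the identity and leaves the gradient unchanged.
      by_cases hxr : r ≤ ‖w (φ k) x‖
      · exact Or.inr ⟨hx, hxr⟩
      · refine Or.inl ⟨hx, ?_⟩
        rw [mem_ofPred_eq, fderiv_truncate_eq_id (hr j) (not_le.1 hxr), compTens_id] at hxε
        rw [mem_ofPred_eq, ha, indicator_of_mem hx]
        linarith
    refine (measure_mono hsub).trans ((measure_union_le _ _).trans
      ((add_le_add m1 (m2.trans (ENNReal.ofReal_le_ofReal m3))).trans ?_))
    rw [← ENNReal.ofReal_add (half_pos hε).le (half_pos hε).le, add_halves]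

end Inpainting

/-! ### The duality relation and the theorem. -/

namespace Inpainting

/-- The layers are built on the distance to the complement, and `infDist` to the empty set is zero
by convention. -/
theorem IsBoundedLipschitzDomain.compl_nonempty {n : ℕ} (hn : n ≠ 0) {Ω : Set (Dom n)}
    (hΩ : IsBoundedLipschitzDomain Ω) : (Ωᶜ).Nonempty := by
  have : Nonempty (Fin n) := Fin.pos_iff_nonempty.1 (Nat.pos_of_ne_zero hn)
  rw [nonempty_compl]
  rintro rfl
  exact NormedSpace.unbounded_univ ℝ (Dom n) hΩ.isBounded

/-- The duality relation between the dual solution and a minimizer of the relaxed functional. -/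
theorem IsKMinimizer.eq_gradient {n M : ℕ} {Ω D : Set (Dom n)} {f : Dom n → Val M}
    {F : Tens n M → ℝ} {l ζ ν : ℝ} (hF : IsIntegrand F ν) (hl : 0 < l) (hζ : 1 < ζ)
    (hf : MemLp f (ENNReal.ofReal ζ) (volume.restrict (Ω \ D)))
    (hb : Bornology.IsBounded Ω) (ho : IsOpen Ω) (hne : (Ωᶜ).Nonempty)
    {σ : Lp (Tens n M) ∞ (volume.restrict Ω)}
    (hσ : ((perturbedInf Ω D f F l ζ 0 : ℝ) : EReal) ≤ R Ω D f F l ζ σ) {u : Dom n → Val M}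
    {Du : VectorMeasure (Dom n) (Tens n M)} (hu : IsKMinimizer Ω D f F l ζ u Du) :
    ∀ᵐ x ∂(volume.restrict Ω), σ x = gradient F (acGrad Du x) := by
  choose w G hc hle hmeas using fun k : ℕ => hu.isBV.exists_competitor_le (l := l) hF hζ hf hb ho
    hne hu.memLp (show 0 < 1 / ((k : ℝ) + 1) by positivity)
  have hlim0 : Tendsto (fun k : ℕ => 1 / ((k : ℝ) + 1)) atTop (𝓝 0) :=
    tendsto_one_div_add_atTop_nhds_zero_nat
  -- Sobolev competitors are `BV` competitors, so `K[u]` is at most the primal infimum; this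
  -- squeezes the approximations of `u` into a minimizing sequence.
  have hK : K Ω D f F l ζ u Du ≤ perturbedInf Ω D f F l ζ 0 := le_perturbedInf fun v H h => by
    rw [add_zero]
    exact hu.le_primal ho.measurableSet h.isW11 h.memLp
  refine eq_gradient_of_tendstoInMeasure hF hσ hc (tendsto_of_tendsto_of_tendsto_of_le_of_le
    tendsto_const_nhds (by simpa using hlim0.const_add (perturbedInf Ω D f F l ζ 0))
    (fun k => ?_) fun k => (hle k).trans (add_le_add_left hK _)) ?_
  · simpa using perturbedInf_le (f := f) (l := l) hF hl hζ (hc k) 0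
  · rw [tendstoInMeasure_iff_norm]
    intro η hη
    have hlim1 : Tendsto (fun k : ℕ => ENNReal.ofReal (1 / ((k : ℝ) + 1))) atTop (𝓝 0) := by
      simpa using ENNReal.tendsto_ofReal hlim0
    refine tendsto_of_tendsto_of_tendsto_of_le_of_le' tendsto_const_nhds hlim1
      (.of_forall fun _ => zero_le) ?_
    filter_upwards [hlim0.eventually_le_const hη] with k hk
    rw [Measure.restrict_apply' ho.measurableSet, inter_comm]
    refine le_trans (measure_mono ?_) (hmeas k)
    exact inter_subset_inter_right _ fun x (hx : η ≤ ‖G k x - acGrad Du x‖) => hk.trans hx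

end Inpainting

theorem theorem1p3 {n M : ℕ} (hn : 2 ≤ n) (hM : 1 ≤ M)
    (Ω : Set (Dom n)) (hΩ : IsBoundedLipschitzDomain Ω)
    (D : Set (Dom n)) (hD : NullMeasurableSet D volume) (hDΩ : D ⊆ Ω)
    (hvol : volume D < volume Ω)
    (l ζ : ℝ) (hl : 0 < l) (hζ : 1 < ζ)
    (f : Dom n → Val M) (hf : MemLp f (ENNReal.ofReal ζ) (volume.restrict (Ω \ D)))
    (F : Tens n M → ℝ) (hF_nonneg : ∀ P, 0 ≤ F P) (hF_C1 : ContDiff ℝ 1 F)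
    (hF_convex : StrictConvexOn ℝ Set.univ F) (hF_zero : F 0 = 0)
    (ν₁ ν₂ ν₃ : ℝ) (hν₁ : 0 < ν₁) (hν₂ : 0 < ν₂)
    (hF_grad : ∀ P, ‖gradient F P‖ ≤ ν₁) (hF_growth : ∀ P, ν₂ * ‖P‖ - ν₃ ≤ F P) :
    ∃ σ : Lp (Tens n M) ∞ (volume.restrict Ω),
      IsDualSolution Ω D f F l ζ σ ∧
      (∀ τ : Lp (Tens n M) ∞ (volume.restrict Ω), IsDualSolution Ω D f F l ζ τ → τ = σ) ∧
      ∀ (u : Dom n → Val M) (Du : VectorMeasure (Dom n) (Tens n M)),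
        IsKMinimizer Ω D f F l ζ u Du →
          ∀ᵐ x ∂(volume.restrict Ω), σ x = gradient F (acGrad Du x) := by
  have hint : IsIntegrand F ν₁ := ⟨hF_nonneg, hF_C1, hF_convex.convexOn, hF_zero, hν₁, hF_grad⟩
  have : IsFiniteMeasure (volume.restrict Ω) := ⟨by
    rw [Measure.restrict_apply_univ]; exact hΩ.isBounded.measure_lt_top⟩
  obtain ⟨σ, hσ⟩ := exists_perturbedInf_le_R hint hl hζ hf
  -- By weak duality no field exceeds the primal infimum, which `σ` reaches.
  refine ⟨σ, fun κ => (R_le_perturbedInf hint κ).trans hσ, fun τ hτ => ?_, fun u Du hu => ?_⟩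
  · exact eq_of_perturbedInf_le_R hint hl hζ hν₂ hF_growth hσ (hτ.perturbedInf_le_R hint hl hζ hf)
  · exact hu.eq_gradient hint hl hζ hf hΩ.isBounded hΩ.isOpen
      (hΩ.compl_nonempty (by omega)) hσ
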